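/- Let $k$ be a commutative ring and let $\mathcal C$ be a dg category over $k$ (cohomological grading). For objects $X,Y$ write $X\mathcal C Y=\operatorname{Hom}_{\mathcal C}(Y,X)$. The cyclic bar complex of $\mathcal C$ is $$\mathbf C(\mathcal C)=\bigoplus_{r\ge 0}\ \bigoplus_{X_1,\dots,X_{r+1}\in\mathcal C}\Sigma^r\big(X_1\mathcal C X_2\otimes_k X_2\mathcal C X_3\otimes_k\cdots\otimes_k X_{r+1}\mathcal C X_1\big)$$ with differential $$d(f_1|\cdots|f_{r+1})=(-1)^r\sum_{i=1}^{r+1}(-1)^{|f_1|+\cdots+|f_{i-1}|}f_1|\cdots|d f_i|\cdots|f_{r+1}+\sum_{i=1}^{r}(-1)^i f_1|\cdots|f_if_{i+1}|\cdots|f_{r+1}+(-1)^{|f_1|(|f_2|+\cdots+|f_{r+1}|)}f_2|\cdots|f_{r+1}f_1,$$ where the last summand is absent for $r=0$. A deformation retract $M\to N$ of complexes consists of chain maps $\pi\colon M\to N$ and $\sigma\colon N\to M$ of degree $0$ and a map $h\colon M\to M$ of degree $-1$ with $\pi\sigma=\operatorname{Id}_N$, $dh+hd=\operatorname{Id}_M-\sigma\pi$,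 $h\sigma=0$ and $\pi h=0$; the map $\sigma$ is called its section. A complex, or an object of a dg category, is contractible if its identity is null-homotopic. (1) Let $\mathcal B\subset\mathcal C$ be a full dg subcategory that generates $\mathcal C$, that is: for every dg functor $F$ from $\mathcal C$ to complexes of $k$-modules, if $F(X)$ is contractible for all $X\in\mathcal B$, then $F(X)$ is contractible for all $X\in\mathcal C$. Then the natural inclusion $\mathbf C(\mathcal B)\hookrightarrow\mathbf C(\mathcal C)$ is the section of a deformation retract $\mathbf C(\mathcal C)\to\mathbf C(\mathcal B)$. (2) Let $\Gamma$ be a finite poset and let $\{\mathcal B_\gamma\}_{\gamma\in\Gamma}$ be a semi-orthogonal decomposition of $\mathcal C$ into full dg subcategories no two of which have an object in common. This means: (a) every object of $\mathcal C$ is homotopy equivalent to a twisted complex $\operatorname{tw}_\delta\big(\bigoplus_{\gamma\in\Gamma}Z_\gamma\big)$, where each $Z_\gamma$ is an object of $\mathcal B_\gamma$ or, more generally, a finite (possibly empty) formal direct sum of translates of objects of $\mathcal B_\gamma$, and where the twist $\delta$ is strictly lower triangular, i.e. its component $Z_\gamma\to Z_{\gamma'}$ vanishes unless $\gamma<\gamma'$;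 (b) for $Y\in\mathcal B_\gamma$ and $Y'\in\mathcal B_{\gamma'}$ the complex $\operatorname{Hom}_{\mathcal C}(Y,Y')$ is contractible unless $\gamma\le\gamma'$. Then $\mathbf C(\mathcal C)$ deformation retracts onto $\bigoplus_{\gamma\in\Gamma}\mathbf C(\mathcal B_\gamma)$: the natural map $\bigoplus_{\gamma\in\Gamma}\mathbf C(\mathcal B_\gamma)\to\mathbf C(\mathcal C)$ induced by the inclusions is the section of a deformation retract. -/

import Mathlib

open scoped TensorProduct DirectSum

universe w u v u' v' t

/-! ### Complexes of modules -/

/-- A complex of `k`-modules (a dg `k`-module), with the cohomological convention: a module which is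
the direct sum of its homogeneous parts `gr n`, with a differential of degree `1`. -/
structure DGMod (k : Type w) [CommRing k] where
  carrier : Type v
  [grp : AddCommGroup carrier]
  [mod : Module k carrier]
  gr : ℤ → Submodule k carrier
  internal : DirectSum.IsInternal gr
  d : carrier →ₗ[k] carrier
  d_mem : ∀ {n : ℤ} {x : carrier}, x ∈ gr n → d x ∈ gr (n + 1)
  d_d : ∀ x : carrier, d (d x) = 0

namespace DGMod

variable {k : Type w} [CommRing k]

instance : CoeSort (DGMod.{w, v} k) (Type v) := ⟨DGMod.carrier⟩

attribute [instance] DGMod.grp DGMod.mod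

/-- `M ≃ 0`: the identity is null-homotopic. -/
def Contractible (M : DGMod.{w, v} k) : Prop :=
  ∃ h : M →ₗ[k] M, (∀ (n : ℤ) (x : M), x ∈ M.gr n → h x ∈ M.gr (n - 1)) ∧
    ∀ x, M.d (h x) + h (M.d x) = x

/-- A deformation retract `M → N` of complexes. -/
structure DeformationRetract (M : DGMod.{w, v} k) (N : DGMod.{w, v'} k) where
  /-- the projection -/
  π : M →ₗ[k] N
  /-- the section -/
  σ : N →ₗ[k] M
  /-- the homotopy -/
  h : M →ₗ[k] M
  π_mem : ∀ {n : ℤ} {x : M}, x ∈ M.gr n → π x ∈ N.gr n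
  σ_mem : ∀ {n : ℤ} {y : N}, y ∈ N.gr n → σ y ∈ M.gr n
  h_mem : ∀ {n : ℤ} {x : M}, x ∈ M.gr n → h x ∈ M.gr (n - 1)
  π_d : ∀ x, π (M.d x) = N.d (π x)
  σ_d : ∀ y, σ (N.d y) = M.d (σ y)
  π_σ : ∀ y, π (σ y) = y
  d_h : ∀ x, M.d (h x) + h (M.d x) = x - σ (π x)
  h_σ : ∀ y, h (σ y) = 0
  π_h : ∀ x, π (h x) = 0

theorem isInternal_of {V : Type v} [AddCommGroup V] [Module k V] (gr : ℤ → Submodule k V)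
    (Φ : V →ₗ[k] ⨁ _ : ℤ, V)
    (hΦ : ∀ (n : ℤ) (x : V), x ∈ gr n → Φ x = DirectSum.lof k ℤ (fun _ => V) n x)
    (top : ⨆ n, gr n = ⊤) : DirectSum.IsInternal gr := by
  constructor
  · have key : Φ ∘ₗ DirectSum.coeLinearMap gr
        = DirectSum.lmap (fun n => (gr n).subtype) := by
      ext n x : 2
      simp [hΦ n x.1 x.2]
    have hinj : Function.Injective (DirectSum.lmap (fun n => (gr n).subtype)) := by
      intro x y hxy
      ext n
      have := congrArg (fun z => z n) hxy
      simpa using this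
    intro x y hxy
    apply hinj
    rw [← key]
    simp only [LinearMap.comp_apply]
    exact congrArg Φ hxy
  · intro x
    have : x ∈ LinearMap.range (DirectSum.coeLinearMap gr) := by
      rw [DirectSum.range_coeLinearMap, top]; trivial
    exact this

section
variable (M : DGMod.{w, v} k)

/-- A complex is the direct sum of its homogeneous parts. -/
noncomputable def gradEquiv : (⨁ n, M.gr n) ≃ₗ[k] M :=
  LinearEquiv.ofBijective (DirectSum.coeLinearMap M.gr) M.internal

/-- The linear map on `M` with prescribed restrictions to the homogeneous parts. -/
noncomputable def homLift {P : Type v'} [AddCommGroup P] [Module k P]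
    (φ : ∀ n : ℤ, M.gr n →ₗ[k] P) : M →ₗ[k] P :=
  DirectSum.toModule k ℤ P φ ∘ₗ
    M.gradEquiv.symm.toLinearMap

theorem homLift_apply {P : Type v'} [AddCommGroup P] [Module k P]
    (φ : ∀ n : ℤ, M.gr n →ₗ[k] P) {n : ℤ} {x : M} (hx : x ∈ M.gr n) :
    M.homLift φ x = φ n ⟨x, hx⟩ := by
  have : M.gradEquiv.symm x = DirectSum.lof k ℤ (fun n => M.gr n) n ⟨x, hx⟩ := by
    rw [LinearEquiv.symm_apply_eq]
    exact (DirectSum.coeLinearMap_lof M.gr n ⟨x, hx⟩).symm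
  simp [homLift, this]

theorem iSup_gr : ⨆ n, M.gr n = ⊤ := M.internal.submodule_iSup_eq_top

variable {M} in
theorem hom_ind {p : M → Prop} (hom : ∀ (n : ℤ) (x : M), x ∈ M.gr n → p x) (zero : p 0)
    (add : ∀ x y, p x → p y → p (x + y)) (x : M) : p x := by
  have hx : x ∈ ⨆ n, M.gr n := by rw [iSup_gr]; trivial
  exact Submodule.iSup_induction _ (motive := p) hx hom zero add

variable {M} in
theorem hom_ext {P : Type v'} [AddCommGroup P] [Module k P] {f g : M →ₗ[k] P}
    (h : ∀ (n : ℤ) (x : M), x ∈ M.gr n → f x = g x) : f = g := by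
  ext x
  induction x using hom_ind with
  | hom n x hx => exact h n x hx
  | zero => simp
  | add x y hx hy => simp [hx, hy]

/-- The operator `x ↦ (-1)^(i * |x|) x`. -/
noncomputable def sgnPow (i : ℤ) : M →ₗ[k] M :=
  M.homLift fun n => (i * n).negOnePow • (M.gr n).subtype

theorem sgnPow_apply (i : ℤ) {n : ℤ} {x : M} (hx : x ∈ M.gr n) :
    M.sgnPow i x = (i * n).negOnePow • x := by
  rw [sgnPow, homLift_apply _ _ hx]; rfl

/-- The operator `x ↦ (-1)^|x| x`. -/
noncomputable abbrev sgn : M →ₗ[k] M := M.sgnPow 1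

theorem sgn_apply {n : ℤ} {x : M} (hx : x ∈ M.gr n) : M.sgn x = n.negOnePow • x := by
  rw [sgn, sgnPow_apply _ _ hx, one_mul]

theorem units_smul_mem {n : ℤ} {x : M} (e : ℤˣ) (hx : x ∈ M.gr n) : e • x ∈ M.gr n := by
  rcases Int.units_eq_one_or e with rfl | rfl <;> simp [hx]

theorem sgn_mem {n : ℤ} {x : M} (hx : x ∈ M.gr n) : M.sgn x ∈ M.gr n := by
  rw [sgn_apply _ hx]; exact M.units_smul_mem _ hx

theorem sgn_d (x : M) : M.sgn (M.d x) = - M.d (M.sgn x) := by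
  induction x using hom_ind with
  | hom n x hx =>
    rw [sgn_apply _ hx, sgn_apply _ (M.d_mem hx), Int.negOnePow_succ, Units.smul_def,
      Units.smul_def]
    simp
  | zero => simp
  | add x y hx hy => simp only [map_add, hx, hy]; abel

/-- The translate `Σ^l M`, with `(Σ^l M)^n = M^(n+l)` and differential `(-1)^l d`. -/
def shift (l : ℤ) : DGMod.{w, v} k where
  carrier := M
  gr n := M.gr (n + l)
  internal := by
    refine isInternal_of _ (M.homLift fun n => DirectSum.lof k ℤ (fun _ => M.carrier) (n - l) ∘ₗ
      (M.gr n).subtype) ?_ ?_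
    · intro n x hx
      rw [homLift_apply _ _ hx]
      simp
    · rw [← M.iSup_gr]
      exact (Equiv.addRight l).iSup_comp (g := M.gr)
  d := l.negOnePow • M.d
  d_mem := by
    intro n x hx
    have := M.d_mem hx
    rw [add_right_comm] at this
    exact M.units_smul_mem _ this
  d_d := by
    intro x
    simp only [LinearMap.smul_apply, Units.smul_def, map_zsmul, M.d_d, smul_zero]

end

/-- The tensor product of two complexes: `d (x ⊗ y) = d x ⊗ y + (-1)^|x| x ⊗ d y`. -/
noncomputable def tensor (M : DGMod.{w, v} k) (N : DGMod.{w, v'} k) : DGMod.{w, max v v'} k where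
  carrier := M ⊗[k] N
  gr n := Submodule.span k {z | ∃ (i j : ℤ) (x : M) (y : N),
    i + j = n ∧ x ∈ M.gr i ∧ y ∈ N.gr j ∧ z = x ⊗ₜ y}
  internal := by
    refine isInternal_of _ (TensorProduct.lift (M.homLift fun i =>
      LinearMap.flip (N.homLift fun j =>
        ((TensorProduct.mk k M N).flip.compr₂
          (DirectSum.lof k ℤ (fun _ => M.carrier ⊗[k] N.carrier) (i + j))) ∘ₗ (N.gr j).subtype)
        ∘ₗ (M.gr i).subtype)) ?_ ?_
    · intro n z hz
      induction hz using Submodule.span_induction with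
      | mem z hz =>
        obtain ⟨i, j, x, y, rfl, hx, hy, rfl⟩ := hz
        simp [homLift_apply _ _ hx, homLift_apply _ _ hy]
      | zero => simp
      | add x y _ _ hx hy => simp [hx, hy]
      | smul a x _ hx => simp [hx]
    · rw [eq_top_iff]
      rintro z -
      induction z using TensorProduct.induction_on with
      | zero => exact zero_mem _
      | add x y hx hy => exact add_mem hx hy
      | tmul x y =>
        induction x using hom_ind with
        | zero => simp
        | add x y hx hy => rw [TensorProduct.add_tmul]; exact add_mem hx hy
        | hom i x hx =>
          induction y using hom_ind with
          | zero => simp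
          | add x y hx hy => rw [TensorProduct.tmul_add]; exact add_mem hx hy
          | hom j y hy =>
            exact Submodule.mem_iSup_of_mem (i + j)
              (Submodule.subset_span ⟨i, j, x, y, rfl, hx, hy, rfl⟩)
  d := TensorProduct.map M.d LinearMap.id + TensorProduct.map M.sgn N.d
  d_mem := by
    intro n z hz
    induction hz using Submodule.span_induction with
    | mem z hz =>
      obtain ⟨i, j, x, y, rfl, hx, hy, rfl⟩ := hz
      simp only [LinearMap.add_apply, TensorProduct.map_tmul, LinearMap.id_apply]
      exact add_mem
        (Submodule.subset_span ⟨i + 1, j, _, _, by ring, M.d_mem hx, hy, rfl⟩)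
        (Submodule.subset_span ⟨i, j + 1, _, _, by ring, M.sgn_mem hx, N.d_mem hy, rfl⟩)
    | zero => simp
    | add x y _ _ hx hy => rw [map_add]; exact add_mem hx hy
    | smul a x _ hx => rw [map_smul]; exact Submodule.smul_mem _ _ hx
  d_d := by
    intro z
    induction z using TensorProduct.induction_on with
    | zero => simp
    | add x y hx hy => simp only [map_add, hx, hy, add_zero]
    | tmul x y =>
      simp [M.d_d, N.d_d, sgn_d, TensorProduct.neg_tmul]

theorem tmul_mem {M : DGMod.{w, v} k} {N : DGMod.{w, v'} k} {i j : ℤ} {x : M} {y : N}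
    (hx : x ∈ M.gr i) (hy : y ∈ N.gr j) :
    TensorProduct.mk k M N x y ∈ (M.tensor N).gr (i + j) := by
  have key : x ⊗ₜ[k] y ∈ Submodule.span k {z | ∃ (i' j' : ℤ) (x : M) (y : N),
      i' + j' = i + j ∧ x ∈ M.gr i' ∧ y ∈ N.gr j' ∧ z = x ⊗ₜ[k] y} :=
    Submodule.subset_span ⟨i, j, x, y, rfl, hx, hy, rfl⟩
  exact key

theorem tensor_mem_ind {M : DGMod.{w, v} k} {N : DGMod.{w, v'} k} {n : ℤ}
    {p : M.tensor N → Prop} (zero : p 0) (add : ∀ x y, p x → p y → p (x + y))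
    (smul : ∀ (a : k) x, p x → p (a • x))
    (hom : ∀ (i j : ℤ) (f : M) (s : N), i + j = n → f ∈ M.gr i → s ∈ N.gr j → p (f ⊗ₜ[k] s))
    (x : M.tensor N) (hx : x ∈ (M.tensor N).gr n) : p x := by
  have key : ∀ y : M ⊗[k] N, y ∈ Submodule.span k {z | ∃ (i j : ℤ) (x : M) (y : N),
      i + j = n ∧ x ∈ M.gr i ∧ y ∈ N.gr j ∧ z = x ⊗ₜ[k] y} → p y := by
    intro y hy
    induction hy using Submodule.span_induction with
    | mem z hz =>
      obtain ⟨i, j, f, s, h, hf, hs, rfl⟩ := hz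
      exact hom i j f s h hf hs
    | zero => exact zero
    | add x y _ _ hx hy => exact add x y hx hy
    | smul a x _ hx => exact smul a x hx
  exact key x hx

/-- The braiding `x ⊗ y ↦ (-1)^(|x||y|) y ⊗ x`. -/
noncomputable def braid (M : DGMod.{w, v} k) (N : DGMod.{w, v'} k) :
    M ⊗[k] N →ₗ[k] N ⊗[k] M :=
  TensorProduct.lift (M.homLift fun i =>
    (TensorProduct.mk k N M ∘ₗ N.sgnPow i).flip ∘ₗ (M.gr i).subtype)

theorem braid_tmul (M : DGMod.{w, v} k) (N : DGMod.{w, v'} k) {i j : ℤ} {x : M} {y : N}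
    (hx : x ∈ M.gr i) (hy : y ∈ N.gr j) :
    M.braid N (x ⊗ₜ y) = (i * j).negOnePow • (y ⊗ₜ[k] x) := by
  simp [braid, homLift_apply _ _ hx, sgnPow_apply _ _ hy, Units.smul_def,
    TensorProduct.smul_tmul']

open scoped Classical in
/-- The direct sum of a family of complexes. -/
noncomputable def directSum {ι : Type t} (M : ι → DGMod.{w, v} k) : DGMod.{w, max t v} k where
  carrier := ⨁ i, M i
  gr n :=
    { carrier := {x | ∀ i, x i ∈ (M i).gr n}
      zero_mem' := fun _ => zero_mem _
      add_mem' := fun hx hy i => add_mem (hx i) (hy i)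
      smul_mem' := fun a _ hx i => Submodule.smul_mem _ a (hx i) }
  internal := by
    refine isInternal_of _ (DirectSum.toModule k ι _ fun i => (M i).homLift fun n =>
      DirectSum.lof k ℤ (fun _ => ⨁ i, (M i).carrier) n ∘ₗ
        DirectSum.lof k ι (fun i => (M i).carrier) i ∘ₗ ((M i).gr n).subtype) ?_ ?_
    · intro n x hx
      conv_lhs => rw [← DirectSum.sum_support_of x]
      conv_rhs => rw [← DirectSum.sum_support_of x]
      rw [map_sum, map_sum]
      refine Finset.sum_congr rfl fun i _ => ?_
      erw [DirectSum.toModule_lof, homLift_apply _ _ (hx i)]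
      rfl
    · rw [eq_top_iff]
      rintro x -
      induction x using DirectSum.induction_on with
      | zero => exact zero_mem _
      | add x y hx hy => exact add_mem hx hy
      | of i x =>
        induction x using hom_ind with
        | zero => simp
        | add x y hx hy => rw [map_add]; exact add_mem hx hy
        | hom n x hx =>
          refine Submodule.mem_iSup_of_mem n ?_
          intro j
          by_cases hij : i = j
          · subst hij
            rwa [DirectSum.of_eq_same]
          · rw [DirectSum.of_eq_of_ne _ _ _ (Ne.symm hij)]; exact zero_mem _
  d := DirectSum.lmap fun i => (M i).d
  d_mem := by
    intro n x hx i
    rw [DirectSum.lmap_apply]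
    exact (M i).d_mem (hx i)
  d_d := by
    intro x
    ext i
    simp [(M i).d_d]

open scoped Classical in
/-- The map out of a direct sum of complexes with prescribed components. -/
noncomputable def directSumDesc {ι : Type t} (M : ι → DGMod.{w, v} k) {N : DGMod.{w, v'} k}
    (f : ∀ i, M i →ₗ[k] N) : directSum M →ₗ[k] N :=
  DirectSum.toModule k ι N f

end DGMod

/-! ### dg categories -/

set_option linter.checkUnivs false in
/-- A dg category over `k`. The composite `g ∘ f` is `comp g f`. -/
structure DGCat (k : Type w) [CommRing k] where
  Obj : Type u
  /-- the complex of morphisms from `X` to `Y` -/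
  Hom : Obj → Obj → DGMod.{w, v} k
  id : ∀ X, Hom X X
  comp : ∀ {X Y Z}, Hom Y Z →ₗ[k] Hom X Y →ₗ[k] Hom X Z
  id_mem : ∀ X, id X ∈ (Hom X X).gr 0
  comp_mem : ∀ {X Y Z} {i j : ℤ} {g : Hom Y Z} {f : Hom X Y},
    g ∈ (Hom Y Z).gr i → f ∈ (Hom X Y).gr j → comp g f ∈ (Hom X Z).gr (i + j)
  id_comp : ∀ {X Y} (f : Hom X Y), comp (id Y) f = f
  comp_id : ∀ {X Y} (f : Hom X Y), comp f (id X) = f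
  assoc : ∀ {W X Y Z} (h : Hom Y Z) (g : Hom X Y) (f : Hom W X),
    comp (comp h g) f = comp h (comp g f)
  leibniz : ∀ {X Y Z} {i : ℤ} {g : Hom Y Z} (f : Hom X Y), g ∈ (Hom Y Z).gr i →
    (Hom X Z).d (comp g f) = comp ((Hom Y Z).d g) f + i.negOnePow • comp g ((Hom X Y).d f)

/-- A dg functor. -/
structure DGFunctor {k : Type w} [CommRing k] (B : DGCat.{w, u', v'} k) (C : DGCat.{w, u, v} k) where
  obj : B.Obj → C.Obj
  map : ∀ {X Y}, B.Hom X Y →ₗ[k] C.Hom (obj X) (obj Y)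
  map_mem : ∀ {X Y} {n : ℤ} {f : B.Hom X Y}, f ∈ (B.Hom X Y).gr n →
    map f ∈ (C.Hom (obj X) (obj Y)).gr n
  map_d : ∀ {X Y} (f : B.Hom X Y), map ((B.Hom X Y).d f) = (C.Hom (obj X) (obj Y)).d (map f)
  map_id : ∀ X, map (B.id X) = C.id (obj X)
  map_comp : ∀ {X Y Z} (g : B.Hom Y Z) (f : B.Hom X Y), map (B.comp g f) = C.comp (map g) (map f)

/-- A dg functor from `C` to the dg category of complexes of `k`-modules. The morphisms of degree
`n` between complexes are the linear maps raising degrees by `n`, and the differential of such a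
morphism `φ` is `d ∘ φ - (-1)^n φ ∘ d`. -/
structure DGFunctorToMod {k : Type w} [CommRing k] (C : DGCat.{w, u, v} k) where
  obj : C.Obj → DGMod.{w, v'} k
  map : ∀ {X Y}, C.Hom X Y →ₗ[k] obj X →ₗ[k] obj Y
  map_mem : ∀ {X Y} {n m : ℤ} {f : C.Hom X Y} {x : obj X}, f ∈ (C.Hom X Y).gr n →
    x ∈ (obj X).gr m → map f x ∈ (obj Y).gr (n + m)
  map_d : ∀ {X Y} {n : ℤ} {f : C.Hom X Y} (x : obj X), f ∈ (C.Hom X Y).gr n →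
    map ((C.Hom X Y).d f) x = (obj Y).d (map f x) - n.negOnePow • map f ((obj X).d x)
  map_id : ∀ X (x : obj X), map (C.id X) x = x
  map_comp : ∀ {X Y Z} (g : C.Hom Y Z) (f : C.Hom X Y) (x : obj X),
    map (C.comp g f) x = map g (map f x)

namespace DGCat

variable {k : Type w} [CommRing k] (C : DGCat.{w, u, v} k)

/-- The full dg subcategory on a set of objects. -/
def full (B : Set C.Obj) : DGCat.{w, u, v} k where
  Obj := B
  Hom X Y := C.Hom X Y
  id X := C.id X
  comp := C.comp
  id_mem X := C.id_mem X
  comp_mem := C.comp_mem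
  id_comp := C.id_comp
  comp_id := C.comp_id
  assoc := C.assoc
  leibniz := C.leibniz

/-- The inclusion of a full dg subcategory. -/
def fullIncl (B : Set C.Obj) : DGFunctor (C.full B) C where
  obj X := X.1
  map := LinearMap.id
  map_mem h := h
  map_d _ := rfl
  map_id _ := rfl
  map_comp _ _ := rfl

/-- The full subcategory on `B` generates `C`: a dg functor from `C` to complexes which is
contractible on all objects of `B` is contractible on all objects of `C`. -/
def Generates (B : Set C.Obj) : Prop :=
  ∀ F : DGFunctorToMod.{w, u, v, max u v} C,
    (∀ X ∈ B, (F.obj X).Contractible) → ∀ X, (F.obj X).Contractible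

/-! ### The cyclic bar complex -/

/-- For `L = [X₂, …, X_m]`, the complex `X C X₂ ⊗ X₂ C X₃ ⊗ ⋯ ⊗ X_m C Y`,
where `X C Y` is the complex of morphisms from `Y` to `X`. -/
noncomputable def tens (Y : C.Obj) : List C.Obj → C.Obj → DGMod.{w, v} k
  | [], X => C.Hom Y X
  | Z :: L, X => (C.Hom Z X).tensor (tens Y L Z)

variable {C}

/-- `f ↦ t ↦ f ⊗ t`. -/
noncomputable def cons {X Y Z : C.Obj} {L : List C.Obj} :
    C.Hom Z X →ₗ[k] C.tens Y L Z →ₗ[k] C.tens Y (Z :: L) X :=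
  TensorProduct.mk k (C.Hom Z X) (C.tens Y L Z)

/-- Linear maps out of `(X C Z) ⊗ (Z C ⋯ C Y)`. -/
noncomputable def consLift {X Y Z : C.Obj} {L : List C.Obj} {P : Type t} [AddCommGroup P]
    [Module k P] (φ : C.Hom Z X →ₗ[k] C.tens Y L Z →ₗ[k] P) : C.tens Y (Z :: L) X →ₗ[k] P :=
  TensorProduct.lift φ

@[simp] theorem consLift_cons {X Y Z : C.Obj} {L : List C.Obj} {P : Type t} [AddCommGroup P]
    [Module k P] (φ : C.Hom Z X →ₗ[k] C.tens Y L Z →ₗ[k] P) (f : C.Hom Z X) (s : C.tens Y L Z) :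
    consLift φ (cons f s) = φ f s :=
  TensorProduct.lift.tmul f s

theorem cons_ind {X Y Z : C.Obj} {L : List C.Obj} {p : C.tens Y (Z :: L) X → Prop}
    (zero : p 0) (add : ∀ x y, p x → p y → p (x + y)) (cons : ∀ f s, p (cons f s)) (x) : p x :=
  TensorProduct.induction_on (motive := p) x zero cons add

/-- Multiplication from the left, `f ↦ (f₁ ⊗ ⋯ ⊗ f_m ↦ f f₁ ⊗ f₂ ⊗ ⋯ ⊗ f_m)`. -/
noncomputable def lmul {Y X Z : C.Obj} : ∀ L : List C.Obj,
    C.Hom Z X →ₗ[k] C.tens Y L Z →ₗ[k] C.tens Y L X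
  | [] => C.comp
  | _ :: _ => LinearMap.mk₂ k (fun f => consLift (cons ∘ₗ C.comp f))
      (by intro f g x; induction x using cons_ind <;> simp_all [add_add_add_comm])
      (by intro a f x; induction x using cons_ind <;> simp_all)
      (by intros; simp) (by intros; simp)

/-- Multiplication from the right, `f ↦ (f₁ ⊗ ⋯ ⊗ f_m ↦ f₁ ⊗ ⋯ ⊗ f_{m-1} ⊗ f_m f)`. -/
noncomputable def rmul {Y Y' : C.Obj} : ∀ (L : List C.Obj) {X : C.Obj},
    C.tens Y L X →ₗ[k] C.Hom Y' Y →ₗ[k] C.tens Y' L X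
  | [], _ => C.comp
  | Z :: L, X => consLift (LinearMap.mk₂ k (fun f s => cons f ∘ₗ rmul L s)
      (by intros; ext; simp) (by intros; ext; simp) (by intros; ext; simp) (by intros; ext; simp))

variable (C) in
/-- The sum of all `X C X₂ ⊗ ⋯ ⊗ X_m C Y`. -/
abbrev Bar (Y X : C.Obj) : Type (max u v) := ⨁ L : List C.Obj, C.tens Y L X

open scoped Classical in
/-- `f ↦ (t ↦ f ⊗ t)`, on all summands. -/
noncomputable def barCons {X Y Z : C.Obj} : C.Hom Z X →ₗ[k] C.Bar Y Z →ₗ[k] C.Bar Y X :=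
  LinearMap.flip <| DirectSum.toModule k _ _ fun L => LinearMap.flip <|
    LinearMap.compr₂ cons (DirectSum.lof k _ (fun L => (C.tens Y L X).carrier) (Z :: L))

open scoped Classical in
@[simp] theorem barCons_lof {X Y Z : C.Obj} (f : C.Hom Z X) (L : List C.Obj) (s : C.tens Y L Z) :
    barCons f (DirectSum.lof k _ (fun L => (C.tens Y L Z).carrier) L s)
      = DirectSum.lof k _ (fun L => (C.tens Y L X).carrier) (Z :: L) (cons f s) := by
  simp [barCons]

open scoped Classical in
/-- The bar differential `f₁ ⊗ ⋯ ⊗ f_{r+1} ↦ ∑_{i=1}^r (-1)^i f₁ ⊗ ⋯ ⊗ f_i f_{i+1} ⊗ ⋯ ⊗ f_{r+1}`. -/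
noncomputable def barD {Y : C.Obj} : ∀ (L : List C.Obj) {X : C.Obj}, C.tens Y L X →ₗ[k] C.Bar Y X
  | [], _ => 0
  | _ :: L, X => consLift
      (- LinearMap.compr₂ (lmul L) (DirectSum.lof k _ (fun L => (C.tens Y L X).carrier) L)
        - LinearMap.compl₂ barCons (barD L))

/-- `f₁ ⊗ ⋯ ⊗ f_{r+1} ↦ (-1)^(|f₁|(|f₂|+⋯+|f_{r+1}|)) f₂ ⊗ ⋯ ⊗ f_r ⊗ f_{r+1} f₁`, for `r ≥ 1`. -/
noncomputable def rot {X Z : C.Obj} (L : List C.Obj) : C.tens X (Z :: L) X →ₗ[k] C.tens Z L Z :=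
  TensorProduct.lift (rmul L) ∘ₗ (C.Hom Z X).braid (C.tens X L Z)

variable (C) in
/-- The module `⨁_{X₁} ⨁_{[X₂, …, X_{r+1}]} X₁ C X₂ ⊗ ⋯ ⊗ X_{r+1} C X₁`. -/
abbrev Cyc : Type (max u v) := ⨁ p : C.Obj × List C.Obj, C.tens p.1 p.2 p.1

open scoped Classical in
/-- The inclusion of a summand. -/
noncomputable def cycOf (X : C.Obj) (L : List C.Obj) : C.tens X L X →ₗ[k] C.Cyc :=
  DirectSum.lof k _ (fun p : C.Obj × List C.Obj => (C.tens p.1 p.2 p.1).carrier) (X, L)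

open scoped Classical in
/-- The inclusion of the summands with a given `X₁`. -/
noncomputable def cycIncl (X : C.Obj) : C.Bar X X →ₗ[k] C.Cyc :=
  DirectSum.toModule k _ _ fun L => cycOf X L

/-- The summand of the cyclic bar differential which multiplies the first factor to the last. -/
noncomputable def cycRot (X : C.Obj) : ∀ L : List C.Obj, C.tens X L X →ₗ[k] C.Cyc
  | [] => 0
  | Z :: L => cycOf Z L ∘ₗ rot L

open scoped Classical in
variable (C) in
/-- The part of the differential of the cyclic bar complex that involves composition. -/
noncomputable def cycDelta : C.Cyc →ₗ[k] C.Cyc :=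
  DirectSum.toModule k _ _ fun p => cycIncl p.1 ∘ₗ barD p.2 + cycRot p.1 p.2

theorem cons_mem {X Y Z : C.Obj} {L : List C.Obj} {i j : ℤ} {f : C.Hom Z X} {s : C.tens Y L Z}
    (hf : f ∈ (C.Hom Z X).gr i) (hs : s ∈ (C.tens Y L Z).gr j) :
    cons f s ∈ (C.tens Y (Z :: L) X).gr (i + j) :=
  DGMod.tmul_mem hf hs

theorem cons_mem_ind {X Y Z : C.Obj} {L : List C.Obj} {n : ℤ}
    {p : ∀ x : C.tens Y (Z :: L) X, x ∈ (C.tens Y (Z :: L) X).gr n → Prop}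
    (zero : ∀ h, p 0 h) (add : ∀ (x y : C.tens Y (Z :: L) X) hx hy h, p x hx → p y hy → p (x + y) h)
    (smul : ∀ (a : k) (x : C.tens Y (Z :: L) X) hx h, p x hx → p (a • x) h)
    (hom : ∀ (i j : ℤ) (f) (s) (_ : i + j = n) (_ : f ∈ (C.Hom Z X).gr i)
      (_ : s ∈ (C.tens Y L Z).gr j) h, p (cons f s) h)
    (x : C.tens Y (Z :: L) X) (hx : x ∈ (C.tens Y (Z :: L) X).gr n) : p x hx := by
  let q : C.tens Y (Z :: L) X → Prop := fun x => ∃ h, p x h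
  have h0 : q 0 := ⟨Submodule.zero_mem _, zero _⟩
  have h1 : ∀ x y, q x → q y → q (x + y) := fun x y ⟨hx, hx'⟩ ⟨hy, hy'⟩ =>
    ⟨Submodule.add_mem _ hx hy, add _ _ hx hy _ hx' hy'⟩
  have h2 : ∀ (a : k) x, q x → q (a • x) := fun a x ⟨hx, hx'⟩ =>
    ⟨Submodule.smul_mem _ a hx, smul _ _ hx _ hx'⟩
  have h3 : ∀ (i j : ℤ) f s, i + j = n → f ∈ (C.Hom Z X).gr i → s ∈ (C.tens Y L Z).gr j →
      q (cons f s) := fun i j f s h hf hs => ⟨h ▸ cons_mem hf hs, hom i j f s h hf hs _⟩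
  have key : q x := DGMod.tensor_mem_ind (p := q) h0 h1 h2 h3 x hx
  exact key.2

theorem cons_hom_ind {X Y Z : C.Obj} {L : List C.Obj} {p : C.tens Y (Z :: L) X → Prop}
    (zero : p 0) (add : ∀ x y, p x → p y → p (x + y))
    (hom : ∀ (i j : ℤ) (f) (s), f ∈ (C.Hom Z X).gr i → s ∈ (C.tens Y L Z).gr j →
      p (cons f s)) (x : C.tens Y (Z :: L) X) : p x := by
  induction x using cons_ind with
  | zero => exact zero
  | add x y hx hy => exact add x y hx hy
  | cons f s =>
    induction f using DGMod.hom_ind with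
    | zero => simpa using zero
    | add f g hf hg => simpa using add _ _ hf hg
    | hom i f hf =>
      induction s using DGMod.hom_ind with
      | zero => simpa using zero
      | add f g hf hg => simpa using add _ _ hf hg
      | hom j s hs => exact hom i j f s hf hs

theorem d_cons {X Y Z : C.Obj} {L : List C.Obj} {i : ℤ} {f : C.Hom Z X} (s : C.tens Y L Z)
    (hf : f ∈ (C.Hom Z X).gr i) :
    (C.tens Y (Z :: L) X).d (cons f s) = cons ((C.Hom Z X).d f) s
      + i.negOnePow • cons f ((C.tens Y L Z).d s) := by
  have : (C.tens Y (Z :: L) X).d (cons f s) = cons ((C.Hom Z X).d f) s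
      + cons ((C.Hom Z X).sgn f) ((C.tens Y L Z).d s) := rfl
  rw [this, DGMod.sgn_apply _ hf, Units.smul_def, Units.smul_def, map_zsmul]
  rfl

@[simp] theorem lmul_nil {Y X Z : C.Obj} (f : C.Hom Z X) (s : C.tens Y [] Z) :
    lmul [] f s = C.comp (X := Y) f s := rfl

@[simp] theorem lmul_cons {Y X Z W : C.Obj} (L : List C.Obj) (f : C.Hom Z X) (g : C.Hom W Z)
    (s : C.tens Y L W) : lmul (W :: L) f (cons g s) = cons (C.comp f g) s := by
  simp [lmul]

@[simp] theorem rmul_nil {Y Y' X : C.Obj} (s : C.tens Y [] X) (f : C.Hom Y' Y) :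
    rmul [] s f = C.comp (Z := X) s f := rfl

@[simp] theorem rmul_cons {Y Y' X Z : C.Obj} (L : List C.Obj) (f : C.Hom Z X) (s : C.tens Y L Z)
    (g : C.Hom Y' Y) : rmul (Z :: L) (cons f s) g = cons f (rmul L s g) := by
  simp [rmul]

theorem rmul_mem {Y Y' : C.Obj} : ∀ (L : List C.Obj) {X : C.Obj} {i j : ℤ} {s : C.tens Y L X}
    {f : C.Hom Y' Y}, s ∈ (C.tens Y L X).gr i → f ∈ (C.Hom Y' Y).gr j →
    rmul L s f ∈ (C.tens Y' L X).gr (i + j)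
  | [], _, _, _, _, _, hs, hf => C.comp_mem hs hf
  | Z :: L, X, i, j, s, f, hs, hf => by
    induction s, hs using cons_mem_ind with
    | zero => simp
    | add x y _ _ _ hx hy => rw [map_add]; exact add_mem hx hy
    | smul a x _ _ hx => rw [map_smul]; exact Submodule.smul_mem _ _ hx
    | hom a b g s hab hg hs =>
      rw [rmul_cons, ← hab, add_assoc]
      exact cons_mem hg (rmul_mem L hs hf)

theorem lmul_mem {Y X Z : C.Obj} : ∀ (L : List C.Obj) {i j : ℤ} {f : C.Hom Z X}
    {s : C.tens Y L Z}, f ∈ (C.Hom Z X).gr i → s ∈ (C.tens Y L Z).gr j →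
    lmul L f s ∈ (C.tens Y L X).gr (i + j)
  | [], _, _, _, _, hf, hs => C.comp_mem hf hs
  | W :: L, i, j, f, s, hf, hs => by
    induction s, hs using cons_mem_ind with
    | zero => simp
    | add x y _ _ _ hx hy => rw [map_add]; exact add_mem hx hy
    | smul a x _ _ hx => rw [map_smul]; exact Submodule.smul_mem _ _ hx
    | hom a b g s hab hg hs =>
      rw [lmul_cons, ← hab, ← add_assoc]
      exact cons_mem (C.comp_mem hf hg) hs

theorem d_lmul {Y X Z : C.Obj} : ∀ (L : List C.Obj) {i : ℤ} {f : C.Hom Z X}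
    (s : C.tens Y L Z), f ∈ (C.Hom Z X).gr i →
    (C.tens Y L X).d (lmul L f s) = lmul L ((C.Hom Z X).d f) s
      + i.negOnePow • lmul L f ((C.tens Y L Z).d s)
  | [], _, _, s, hf => C.leibniz s hf
  | W :: L, i, f, s, hf => by
    induction s using cons_hom_ind with
    | zero => simp
    | add x y hx hy => simp only [map_add, hx, hy, smul_add]; abel
    | hom a b g s hg hs =>
      rw [lmul_cons, d_cons _ (C.comp_mem hf hg), C.leibniz _ hf, d_cons _ hg]
      simp only [map_add, LinearMap.add_apply, Units.smul_def, map_zsmul, LinearMap.smul_apply,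
        lmul_cons, smul_add, Int.negOnePow_add, mul_smul]
      abel

theorem d_rmul {Y Y' : C.Obj} : ∀ (L : List C.Obj) {X : C.Obj} {i : ℤ} {s : C.tens Y L X}
    (f : C.Hom Y' Y), s ∈ (C.tens Y L X).gr i →
    (C.tens Y' L X).d (rmul L s f) = rmul L ((C.tens Y L X).d s) f
      + i.negOnePow • rmul L s ((C.Hom Y' Y).d f)
  | [], _, _, _, f, hs => C.leibniz f hs
  | Z :: L, X, i, s, f, hs => by
    induction s, hs using cons_mem_ind with
    | zero => simp
    | add x y _ _ _ hx hy => simp only [map_add, hx, hy, smul_add, LinearMap.add_apply]; abel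
    | smul a x _ _ hx =>
      simp only [map_smul, hx, LinearMap.smul_apply, smul_add]
      rw [smul_comm a]
    | hom a b g s hab hg hs =>
      subst hab
      rw [rmul_cons, d_cons _ hg, d_rmul L _ hs, d_cons _ hg]
      simp only [map_add, LinearMap.add_apply, Units.smul_def, map_zsmul, LinearMap.smul_apply,
        rmul_cons, smul_add, Int.negOnePow_add, mul_smul]
      abel

theorem lmul_lmul {Y X Z W : C.Obj} (f : C.Hom Z X) (g : C.Hom W Z) : ∀ (L : List C.Obj)
    (s : C.tens Y L W), lmul L f (lmul L g s) = lmul L (C.comp f g) s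
  | [], s => (C.assoc f g s).symm
  | V :: L, s => by
    induction s using cons_ind with
    | zero => simp
    | add x y hx hy => simp only [map_add, hx, hy]
    | cons h s => simp [C.assoc]

theorem rmul_rmul {Y Y' Y'' : C.Obj} (f : C.Hom Y' Y) (g : C.Hom Y'' Y') : ∀ (L : List C.Obj)
    {X : C.Obj} (s : C.tens Y L X), rmul L (rmul L s f) g = rmul L s (C.comp f g)
  | [], _, s => C.assoc _ _ _
  | Z :: L, X, s => by
    induction s using cons_ind with
    | zero => simp
    | add x y hx hy => simp only [map_add, hx, hy, LinearMap.add_apply]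
    | cons h s => simp [rmul_rmul f g L s]

theorem lmul_rmul {Y Y' Z X : C.Obj} (f : C.Hom Z X) (g : C.Hom Y' Y) : ∀ (L : List C.Obj)
    (s : C.tens Y L Z), lmul L f (rmul L s g) = rmul L (lmul L f s) g
  | [], s => (C.assoc _ _ _).symm
  | V :: L, s => by
    induction s using cons_ind with
    | zero => simp
    | add x y hx hy => simp only [map_add, hx, hy, LinearMap.add_apply]
    | cons h s => simp

section
open scoped Classical

@[simp] theorem barD_nil {X Y : C.Obj} (s : C.tens Y [] X) : barD [] s = 0 := rfl

@[simp] theorem barD_cons {X Y Z : C.Obj} (L : List C.Obj) (f : C.Hom Z X) (s : C.tens Y L Z) :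
    barD (Z :: L) (cons f s)
      = - DirectSum.lof k _ (fun L => (C.tens Y L X).carrier) L (lmul L f s)
        - barCons f (barD L s) := by
  simp [barD]

/-- The homogeneous elements with a given number of factors in the sum of tensor products. -/
noncomputable def barGr (Y X : C.Obj) (m : ℕ) (n : ℤ) : Submodule k (C.Bar Y X) :=
  Submodule.span k {x | ∃ (L : List C.Obj) (s : C.tens Y L X), L.length = m ∧
    s ∈ (C.tens Y L X).gr n ∧ x = DirectSum.lof k _ (fun L => (C.tens Y L X).carrier) L s}

theorem barCons_mem {X Y Z : C.Obj} {f : C.Hom Z X} {i n : ℤ} {m : ℕ} {x : C.Bar Y Z}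
    (hf : f ∈ (C.Hom Z X).gr i) (hx : x ∈ barGr Y Z m n) :
    barCons f x ∈ barGr Y X (m + 1) (i + n) := by
  induction hx using Submodule.span_induction with
  | zero => simp
  | add x y _ _ hx hy => rw [map_add]; exact add_mem hx hy
  | smul a x _ hx => rw [map_smul]; exact Submodule.smul_mem _ _ hx
  | mem x hx =>
    obtain ⟨L, s, hL, hs, rfl⟩ := hx
    rw [barCons_lof]
    exact Submodule.subset_span ⟨_, _, by simp [hL], cons_mem hf hs, rfl⟩

theorem barD_mem {Y : C.Obj} : ∀ (L : List C.Obj) {X : C.Obj} {m : ℕ} {n : ℤ} {s : C.tens Y L X},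
    L.length = m + 1 → s ∈ (C.tens Y L X).gr n → barD L s ∈ barGr Y X m n
  | [], _, _, _, _, h, _ => by simp at h
  | Z :: L, X, m, n, s, h, hs => by
    induction s, hs using cons_mem_ind with
    | zero => simp
    | add x y _ _ _ hx hy => rw [map_add]; exact add_mem hx hy
    | smul a x _ _ hx => rw [map_smul]; exact Submodule.smul_mem _ _ hx
    | hom a b g s hab hg hs =>
      subst hab
      rw [barD_cons]
      refine sub_mem (neg_mem (Submodule.subset_span
        ⟨_, _, by simpa using h, lmul_mem L hg hs, rfl⟩)) ?_
      cases L with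
      | nil => simp
      | cons W L =>
        obtain ⟨m, rfl⟩ : ∃ m', m = m' + 1 := ⟨L.length, by simpa using h.symm⟩
        exact barCons_mem hg (barD_mem (W :: L) (by simpa using h) hs)

/-- The internal differential on the sum of tensor products. -/
noncomputable def barInt (Y X : C.Obj) : C.Bar Y X →ₗ[k] C.Bar Y X :=
  DirectSum.lmap fun L => (C.tens Y L X).d

theorem barInt_barCons {X Y Z : C.Obj} {f : C.Hom Z X} {i : ℤ} (hf : f ∈ (C.Hom Z X).gr i)
    (x : C.Bar Y Z) : barInt Y X (barCons f x)
      = barCons ((C.Hom Z X).d f) x + i.negOnePow • barCons f (barInt Y Z x) := by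
  induction x using DirectSum.induction_on with
  | zero => simp
  | add x y hx hy => simp only [map_add, hx, hy, smul_add]; abel
  | of L s =>
    change barInt Y X (barCons f (DirectSum.lof k _ (fun L => (C.tens Y L Z).carrier) L s))
      = barCons _ (DirectSum.lof k _ (fun L => (C.tens Y L Z).carrier) L s) + _ • barCons f
        (barInt Y Z (DirectSum.lof k _ (fun L => (C.tens Y L Z).carrier) L s))
    rw [barInt, barInt, DirectSum.lmap_lof, barCons_lof, barCons_lof, barCons_lof,
      DirectSum.lmap_lof, d_cons _ hf]
    simp [Units.smul_def]

theorem barD_d {Y : C.Obj} : ∀ (L : List C.Obj) {X : C.Obj} (s : C.tens Y L X),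
    barD L ((C.tens Y L X).d s) = barInt Y X (barD L s)
  | [], _, _ => by simp
  | Z :: L, X, s => by
    induction s using cons_hom_ind with
    | zero => simp
    | add x y hx hy => simp only [map_add, hx, hy]
    | hom a b g s hg hs =>
      rw [d_cons _ hg, barD_cons, map_sub, map_neg, barInt_barCons hg, ← barD_d L s]
      rw [barInt, DirectSum.lmap_lof, d_lmul L _ hg]
      simp only [map_add, Units.smul_def, map_zsmul, barD_cons, smul_sub, smul_neg]
      abel

/-- The bar differential on the sum of tensor products. -/
noncomputable def barDT (Y X : C.Obj) : C.Bar Y X →ₗ[k] C.Bar Y X :=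
  DirectSum.toModule k _ _ fun L => barD L

theorem barDT_barCons {X Y Z : C.Obj} (f : C.Hom Z X) (x : C.Bar Y Z) :
    barDT Y X (barCons f x) = - DirectSum.lmap (fun L => lmul L f) x
      - barCons f (barDT Y Z x) := by
  induction x using DirectSum.induction_on with
  | zero => simp
  | add x y hx hy => simp only [map_add, hx, hy]; abel
  | of L s =>
    change barDT Y X (barCons f (DirectSum.lof k _ (fun L => (C.tens Y L Z).carrier) L s)) =
      - DirectSum.lmap (fun L => lmul L f) (DirectSum.lof k _ (fun L => (C.tens Y L Z).carrier) L s)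
      - barCons f (barDT Y Z (DirectSum.lof k _ (fun L => (C.tens Y L Z).carrier) L s))
    rw [barCons_lof, barDT, DirectSum.toModule_lof, barDT, DirectSum.toModule_lof,
      DirectSum.lmap_lof, barD_cons]

theorem lmap_lmul_barCons {X Y Z W : C.Obj} (f : C.Hom Z X) (g : C.Hom W Z) (x : C.Bar Y W) :
    DirectSum.lmap (fun L => lmul L f) (barCons g x) = barCons (C.comp f g) x := by
  induction x using DirectSum.induction_on with
  | zero => simp
  | add x y hx hy => simp only [map_add, hx, hy]
  | of L s =>
    change DirectSum.lmap (fun L => lmul L f)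
        (barCons g (DirectSum.lof k _ (fun L => (C.tens Y L W).carrier) L s)) =
      barCons _ (DirectSum.lof k _ (fun L => (C.tens Y L W).carrier) L s)
    rw [barCons_lof, barCons_lof, DirectSum.lmap_lof, lmul_cons]

theorem barD_lmul {Y X Z : C.Obj} (f : C.Hom Z X) : ∀ (L : List C.Obj) (s : C.tens Y L Z),
    barD L (lmul L f s) = DirectSum.lmap (fun L => lmul L f) (barD L s)
  | [], s => by rw [barD_nil, barD_nil, map_zero]
  | W :: L, s => by
    induction s using cons_ind with
    | zero => simp
    | add x y hx hy => simp only [map_add, hx, hy]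
    | cons h s =>
      rw [lmul_cons, barD_cons, barD_cons, map_sub, map_neg, lmap_lmul_barCons,
        DirectSum.lmap_lof, lmul_lmul]

theorem barD_barD {Y : C.Obj} : ∀ (L : List C.Obj) {X : C.Obj} (s : C.tens Y L X),
    barDT Y X (barD L s) = 0
  | [], _, _ => by simp
  | Z :: L, X, s => by
    induction s using cons_ind with
    | zero => simp
    | add x y hx hy => simp only [map_add, hx, hy, add_zero]
    | cons f s =>
      rw [barD_cons, map_sub, map_neg, barDT_barCons, barD_barD L s]
      rw [barDT, DirectSum.toModule_lof, barD_lmul]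
      simp

theorem barD_rmul {Y Y' : C.Obj} (g : C.Hom Y' Y) : ∀ (L : List C.Obj) {X : C.Obj}
    (s : C.tens Y L X),
    barD L (rmul L s g) = DirectSum.lmap (fun L => (rmul L).flip g) (barD L s)
  | [], _, s => by rw [barD_nil, barD_nil, map_zero]
  | Z :: L, X, s => by
    induction s using cons_ind with
    | zero => simp
    | add x y hx hy => simp only [map_add, hx, hy, LinearMap.add_apply]
    | cons f s =>
      rw [rmul_cons, barD_cons, barD_cons, map_sub, map_neg, DirectSum.lmap_lof,
        LinearMap.flip_apply, lmul_rmul, barD_rmul g L s]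
      congr 1
      generalize barD L s = x
      induction x using DirectSum.induction_on with
      | zero => simp
      | add x y hx hy => simp only [map_add, hx, hy]
      | of L s =>
        change barCons f (DirectSum.lmap (fun L => (rmul L).flip g)
            (DirectSum.lof k _ (fun L => (C.tens Y L Z).carrier) L s)) =
          DirectSum.lmap (fun L => (rmul L).flip g)
            (barCons f (DirectSum.lof k _ (fun L => (C.tens Y L Z).carrier) L s))
        rw [barCons_lof, DirectSum.lmap_lof, DirectSum.lmap_lof, barCons_lof]
        simp

theorem rot_cons {X Z : C.Obj} (L : List C.Obj) {i j : ℤ} {f : C.Hom Z X} {s : C.tens X L Z}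
    (hf : f ∈ (C.Hom Z X).gr i) (hs : s ∈ (C.tens X L Z).gr j) :
    rot L (cons f s) = (i * j).negOnePow • rmul L s f := by
  have : rot L (cons f s)
      = TensorProduct.lift (rmul L) ((C.Hom Z X).braid (C.tens X L Z) (f ⊗ₜ s)) := rfl
  rw [this, DGMod.braid_tmul _ _ hf hs, Units.smul_def, map_zsmul, TensorProduct.lift.tmul,
    Units.smul_def]

theorem rot_mem {X Z : C.Obj} (L : List C.Obj) {n : ℤ} {s : C.tens X (Z :: L) X}
    (hs : s ∈ (C.tens X (Z :: L) X).gr n) : rot L s ∈ (C.tens Z L Z).gr n := by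
  induction s, hs using cons_mem_ind with
  | zero => simp
  | add x y _ _ _ hx hy => rw [map_add]; exact add_mem hx hy
  | smul a x _ _ hx => rw [map_smul]; exact Submodule.smul_mem _ _ hx
  | hom a b g s hab hg hs =>
    rw [rot_cons L hg hs, ← hab, add_comm]
    exact DGMod.units_smul_mem _ _ (rmul_mem L hs hg)

theorem rot_d {X Z : C.Obj} (L : List C.Obj) (s : C.tens X (Z :: L) X) :
    rot L ((C.tens X (Z :: L) X).d s) = (C.tens Z L Z).d (rot L s) := by
  induction s using cons_hom_ind with
  | zero => simp
  | add x y hx hy => simp only [map_add, hx, hy]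
  | hom a b g s hg hs =>
    rw [d_cons _ hg, rot_cons L hg hs, map_add, rot_cons L (DGMod.d_mem _ hg) hs]
    simp only [Units.smul_def, map_zsmul]
    rw [d_rmul L _ hs, rot_cons L hg (DGMod.d_mem _ hs)]
    simp only [Units.smul_def, smul_add, smul_smul, add_mul, mul_add, one_mul, mul_one,
      Int.negOnePow_add, Units.val_mul]
    rw [add_comm]
    congr 2
    rw [mul_left_comm, ← Units.val_mul, Int.units_mul_self]
    simp

theorem cycIncl_lof (X : C.Obj) (L : List C.Obj) (s : C.tens X L X) :
    cycIncl X (DirectSum.lof k _ (fun L => (C.tens X L X).carrier) L s) = cycOf X L s := by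
  simp [cycIncl]

theorem cycDelta_cycOf (X : C.Obj) (L : List C.Obj) (s : C.tens X L X) :
    C.cycDelta (cycOf X L s) = cycIncl X (barD L s) + cycRot X L s := by
  rw [cycDelta, cycOf, DirectSum.toModule_lof]; rfl

/-- The last summand of the cyclic bar differential, on the sum of tensor products. -/
noncomputable def cycRotT (X : C.Obj) : C.Bar X X →ₗ[k] C.Cyc :=
  DirectSum.toModule k _ _ fun L => cycRot X L

theorem cycDelta_cycIncl (X : C.Obj) (x : C.Bar X X) :
    C.cycDelta (cycIncl X x) = cycIncl X (barDT X X x) + cycRotT X x := by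
  induction x using DirectSum.induction_on with
  | zero => simp
  | add x y hx hy => simp only [map_add, hx, hy]; abel
  | of L s =>
    change C.cycDelta (cycIncl X (DirectSum.lof k _ (fun L => (C.tens X L X).carrier) L s)) =
      cycIncl X (barDT X X (DirectSum.lof k _ (fun L => (C.tens X L X).carrier) L s))
        + cycRotT X (DirectSum.lof k _ (fun L => (C.tens X L X).carrier) L s)
    rw [cycIncl_lof, cycDelta_cycOf, barDT, DirectSum.toModule_lof, cycRotT,
      DirectSum.toModule_lof]

theorem cycRotT_barCons {X Z : C.Obj} {f : C.Hom Z X} {i n : ℤ} {m : ℕ} {x : C.Bar X Z}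
    (hf : f ∈ (C.Hom Z X).gr i) (hx : x ∈ barGr X Z m n) :
    cycRotT X (barCons f x)
      = (i * n).negOnePow • cycIncl Z (DirectSum.lmap (fun L => (rmul L).flip f) x) := by
  induction hx using Submodule.span_induction with
  | zero => simp
  | add x y _ _ hx hy => simp only [map_add, hx, hy, smul_add]
  | smul a x _ hx => rw [map_smul, map_smul, map_smul, map_smul, hx, smul_comm]
  | mem x hx =>
    obtain ⟨L, s, hL, hs, rfl⟩ := hx
    rw [barCons_lof, cycRotT, DirectSum.toModule_lof, DirectSum.lmap_lof, cycIncl_lof]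
    simp only [cycRot, LinearMap.comp_apply, LinearMap.flip_apply]
    rw [rot_cons L hf hs, Units.smul_def, Units.smul_def, map_zsmul]

@[simp] theorem cycRot_nil (X : C.Obj) (s : C.tens X [] X) : cycRot X [] s = 0 := rfl

theorem cycRot_lmul {X Z : C.Obj} {f : C.Hom Z X} {i n : ℤ} (hf : f ∈ (C.Hom Z X).gr i) :
    ∀ (L : List C.Obj) {s : C.tens X L Z}, s ∈ (C.tens X L Z).gr n →
    cycRot X L (lmul L f s) = (i * n).negOnePow • cycRot Z L (rmul L s f)
  | [], _, _ => by rw [cycRot_nil, cycRot_nil, smul_zero]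
  | W :: L, s, hs => by
    induction s, hs using cons_mem_ind with
    | zero => simp
    | add x y _ _ _ hx hy => simp only [map_add, hx, hy, smul_add, LinearMap.add_apply]
    | smul a x _ _ hx =>
      simp only [map_smul, hx, LinearMap.smul_apply]
      rw [smul_comm a]
    | hom a b g s hab hg hs =>
      subst hab
      rw [lmul_cons, rmul_cons]
      simp only [cycRot, LinearMap.comp_apply]
      rw [rot_cons L (C.comp_mem hf hg) hs, rot_cons L hg (rmul_mem L hs hf), rmul_rmul]
      simp only [Units.smul_def, map_zsmul, smul_smul, ← Units.val_mul, ← Int.negOnePow_add]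
      congr 2
      rw [Int.negOnePow_eq_iff]
      exact ⟨- (a * i), by ring⟩

theorem cycDelta_cycDelta (x : C.Cyc) : C.cycDelta (C.cycDelta x) = 0 := by
  induction x using DirectSum.induction_on with
  | zero => simp
  | add x y hx hy => simp only [map_add, hx, hy, add_zero]
  | of p s =>
    obtain ⟨X, L⟩ := p
    change C.cycDelta (C.cycDelta (cycOf X L s)) = 0
    rw [cycDelta_cycOf, map_add, cycDelta_cycIncl, barD_barD, map_zero, zero_add]
    cases L with
    | nil => simp [cycRot]
    | cons Z L =>
      induction s using cons_hom_ind with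
      | zero => simp
      | add x y hx hy =>
        simp only [map_add]
        rw [add_add_add_comm, hx, hy, add_zero]
      | hom i j f s hf hs =>
        have e : cycRot X (Z :: L) (cons f s) = (i * j).negOnePow • cycOf Z L (rmul L s f) := by
          simp only [cycRot, LinearMap.comp_apply]
          rw [rot_cons L hf hs, Units.smul_def, Units.smul_def, map_zsmul]
        have e2 : cycRotT X (barCons f (barD L s)) = (i * j).negOnePow •
            cycIncl Z (DirectSum.lmap (fun L => (rmul L).flip f) (barD L s)) := by
          cases L with
          | nil => simp
          | cons W L => exact cycRotT_barCons hf (barD_mem (m := L.length) _ (by simp) hs)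
        rw [e, Units.smul_def, map_zsmul, cycDelta_cycOf, barD_cons, map_sub, map_neg, e2,
          barD_rmul, cycRotT, DirectSum.toModule_lof, cycRot_lmul hf L hs]
        simp only [Units.smul_def, smul_add]
        abel

variable (C) in
/-- The sum of all `Σ^r (X₁ C X₂ ⊗ ⋯ ⊗ X_{r+1} C X₁)`, before composition enters the
differential. -/
noncomputable def cycInt : DGMod.{w, max u v} k :=
  DGMod.directSum fun p : C.Obj × List C.Obj => (C.tens p.1 p.2 p.1).shift p.2.length

variable (C) in
/-- The differential of `cycInt`. -/
noncomputable def cycD : C.Cyc →ₗ[k] C.Cyc :=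
  DirectSum.lmap fun p : C.Obj × List C.Obj => ((C.tens p.1 p.2 p.1).shift p.2.length).d

theorem cycD_cycOf (X : C.Obj) (L : List C.Obj) (s : C.tens X L X) :
    C.cycD (cycOf X L s) = (L.length : ℤ).negOnePow • cycOf X L ((C.tens X L X).d s) := by
  have := DirectSum.lmap_lof (R := k)
    (f := fun p : C.Obj × List C.Obj => ((C.tens p.1 p.2 p.1).shift p.2.length).d) (X, L) s
  rw [Units.smul_def, ← map_zsmul]
  exact this

theorem cycOf_mem {X : C.Obj} {L : List C.Obj} {n : ℤ} {s : C.tens X L X}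
    (hs : s ∈ (C.tens X L X).gr (n + L.length)) : cycOf X L s ∈ C.cycInt.gr n := by
  intro p
  by_cases h : (X, L) = p
  · subst h
    have : cycOf X L s (X, L) = s := DirectSum.of_eq_same
      (β := fun p : C.Obj × List C.Obj => (C.tens p.1 p.2 p.1).carrier) (X, L) s
    exact this.symm ▸ hs
  · have : cycOf X L s p = 0 := DirectSum.of_eq_of_ne
      (β := fun p : C.Obj × List C.Obj => (C.tens p.1 p.2 p.1).carrier) _ _ s (Ne.symm h)
    exact this.symm ▸ zero_mem _

theorem cycIncl_mem {X : C.Obj} {m : ℕ} {n : ℤ} {x : C.Bar X X}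
    (hx : x ∈ barGr X X m (n + m)) : cycIncl X x ∈ C.cycInt.gr n := by
  induction hx using Submodule.span_induction with
  | zero => rw [map_zero]; exact zero_mem _
  | add x y _ _ hx hy => rw [map_add]; exact add_mem hx hy
  | smul a x _ hx => rw [map_smul]; exact Submodule.smul_mem _ a hx
  | mem x hx =>
    obtain ⟨L, s, hL, hs, rfl⟩ := hx
    rw [cycIncl_lof]
    exact cycOf_mem (by rwa [hL])

theorem cycDelta_cycOf_mem {X : C.Obj} (L : List C.Obj) {n : ℤ} {s : C.tens X L X}
    (hs : s ∈ (C.tens X L X).gr (n + L.length)) : C.cycDelta (cycOf X L s) ∈ C.cycInt.gr (n + 1) := by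
  rw [cycDelta_cycOf]
  cases L with
  | nil =>
    have : cycIncl X (barD [] s) + cycRot X [] s = 0 := by simp [cycRot]
    rw [this]; exact zero_mem _
  | cons Z L =>
    have hn : n + ((Z :: L).length : ℤ) = n + 1 + L.length := by push_cast [List.length_cons]; ring
    rw [hn] at hs
    exact add_mem (cycIncl_mem (barD_mem _ (by simp) hs)) (cycOf_mem (rot_mem L hs))

theorem cycDelta_mem {n : ℤ} {x : C.Cyc} (hx : x ∈ C.cycInt.gr n) :
    C.cycDelta x ∈ C.cycInt.gr (n + 1) := by
  rw [← DirectSum.sum_support_of x, map_sum]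
  exact sum_mem fun p _ => cycDelta_cycOf_mem (X := p.1) p.2 (hx p)

theorem cycD_cycIncl {X : C.Obj} {m : ℕ} {n : ℤ} {x : C.Bar X X} (hx : x ∈ barGr X X m n) :
    C.cycD (cycIncl X x) = (m : ℤ).negOnePow • cycIncl X (barInt X X x) := by
  induction hx using Submodule.span_induction with
  | zero => simp only [map_zero, smul_zero]
  | add x y _ _ hx hy => simp only [map_add, smul_add, hx, hy]
  | smul a x _ hx => rw [map_smul, map_smul, map_smul, map_smul, hx, smul_comm]
  | mem x hx =>
    obtain ⟨L, s, rfl, hs, rfl⟩ := hx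
    rw [cycIncl_lof, cycD_cycOf, barInt, DirectSum.lmap_lof, cycIncl_lof]

theorem cycD_cycDelta (x : C.Cyc) :
    C.cycD (C.cycDelta x) + C.cycDelta (C.cycD x) = 0 := by
  induction x using DirectSum.induction_on with
  | zero => simp
  | add x y hx hy =>
    simp only [map_add]
    rw [add_add_add_comm, hx, hy, add_zero]
  | of p s =>
    obtain ⟨X, L⟩ := p
    change C.cycD (C.cycDelta (cycOf X L s)) + C.cycDelta (C.cycD (cycOf X L s)) = 0
    rw [cycD_cycOf, cycDelta_cycOf, Units.smul_def, map_zsmul, cycDelta_cycOf, barD_d]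
    cases L with
    | nil => simp
    | cons Z L =>
      induction s using DGMod.hom_ind with
      | zero => simp
      | add x y hx hy =>
        simp only [map_add, smul_add] at hx hy ⊢
        rw [← add_zero (0 : C.Cyc)]
        nth_rw 1 [← hx]
        rw [← hy]
        abel
      | hom n s hs =>
        rw [map_add, cycD_cycIncl (barD_mem (m := L.length) _ (by simp) hs)]
        simp only [cycRot, LinearMap.comp_apply]
        rw [cycD_cycOf, rot_d, List.length_cons, Nat.cast_succ, Int.negOnePow_succ]
        simp only [Units.smul_def, Units.val_neg, neg_smul, smul_add]
        abel

theorem cycTotal_d_d (x : C.Cyc) : (C.cycD + C.cycDelta) ((C.cycD + C.cycDelta) x) = 0 := by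
  have h : C.cycD (C.cycD x) = 0 := C.cycInt.d_d x
  simp only [LinearMap.add_apply, map_add, h, cycDelta_cycDelta, zero_add, add_zero]
  rw [add_comm]
  exact cycD_cycDelta x

end

variable (C) in
/-- The cyclic bar complex of `C`, that is
`⨁_{r ≥ 0} ⨁_{X₁, …, X_{r+1}} Σ^r (X₁ C X₂ ⊗ ⋯ ⊗ X_{r+1} C X₁)` with the differential
`f₁ ⊗ ⋯ ⊗ f_{r+1} ↦ (-1)^r ∑_{i=1}^{r+1} (-1)^(|f₁|+⋯+|f_{i-1}|) f₁ ⊗ ⋯ ⊗ d f_i ⊗ ⋯ ⊗ f_{r+1}`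
`+ ∑_{i=1}^r (-1)^i f₁ ⊗ ⋯ ⊗ f_i f_{i+1} ⊗ ⋯ ⊗ f_{r+1}`
`+ (-1)^(|f₁|(|f₂|+⋯+|f_{r+1}|)) f₂ ⊗ ⋯ ⊗ f_{r+1} f₁`, the last summand being absent if `r = 0`. -/
noncomputable def cyclicBar : DGMod.{w, max u v} k where
  carrier := C.Cyc
  grp := inferInstanceAs (AddCommGroup C.Cyc)
  mod := inferInstanceAs (Module k C.Cyc)
  gr := C.cycInt.gr
  internal := C.cycInt.internal
  d := C.cycD + C.cycDelta
  d_mem hx := Submodule.add_mem _ (C.cycInt.d_mem hx) (cycDelta_mem hx)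
  d_d x := cycTotal_d_d x

/-- The map `X C X₂ ⊗ ⋯ ⊗ X_m C Y → FX D FX₂ ⊗ ⋯ ⊗ FX_m D FY` induced by a dg functor. -/
noncomputable def tensMap {B : DGCat.{w, u', v'} k} (F : DGFunctor B C) {Y : B.Obj} :
    ∀ (L : List B.Obj) {X : B.Obj}, B.tens Y L X →ₗ[k] C.tens (F.obj Y) (L.map F.obj) (F.obj X)
  | [], _ => F.map
  | _ :: L, _ => consLift (LinearMap.compl₁₂ cons F.map (tensMap F L))

open scoped Classical in
/-- The map of cyclic bar complexes induced by a dg functor,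
`f₁ ⊗ ⋯ ⊗ f_{r+1} ↦ F f₁ ⊗ ⋯ ⊗ F f_{r+1}`. For the inclusion of a full subcategory it is the
natural inclusion. -/
noncomputable def cyclicBarMap {B : DGCat.{w, u', v'} k} (F : DGFunctor B C) :
    B.cyclicBar →ₗ[k] C.cyclicBar :=
  DirectSum.toModule k (B.Obj × List B.Obj) C.Cyc fun p =>
    cycOf (F.obj p.1) (p.2.map F.obj) ∘ₗ tensMap F p.2

variable (C)

/-! ### Twisted complexes and semi-orthogonal decompositions -/

/-- A finite formal direct sum of translates, `⨁ i, Σ^(shift i) (obj i)`. -/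
structure SuspObj where
  n : ℕ
  shift : Fin n → ℤ
  obj : Fin n → C.Obj

variable {C} in
/-- The complex of matrices of morphisms: an entry of a matrix of degree `l` from `Σ^a X` to `Σ^b Y`
has degree `l + b - a` in `C`, and its differential is multiplied by `(-1)^b`. -/
def suspHom (X Y : C.SuspObj) : DGMod.{w, v} k where
  carrier := ∀ i j, C.Hom (X.obj i) (Y.obj j)
  gr l :=
    { carrier := {f | ∀ i j, f i j ∈ (C.Hom (X.obj i) (Y.obj j)).gr (l + Y.shift j - X.shift i)}
      zero_mem' := fun _ _ => zero_mem _
      add_mem' := fun hf hg i j => add_mem (hf i j) (hg i j)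
      smul_mem' := fun a _ hf i j => Submodule.smul_mem _ a (hf i j) }
  internal := by
    refine DGMod.isInternal_of _ (∑ i, ∑ j, ((C.Hom (X.obj i) (Y.obj j)).homLift fun n =>
      DirectSum.lof k ℤ (fun _ => ∀ i j, C.Hom (X.obj i) (Y.obj j)) (n - Y.shift j + X.shift i) ∘ₗ
        LinearMap.single k (fun i => ∀ j, (C.Hom (X.obj i) (Y.obj j)).carrier) i ∘ₗ
        LinearMap.single k (fun j => (C.Hom (X.obj i) (Y.obj j)).carrier) j ∘ₗ
        Submodule.subtype _) ∘ₗ LinearMap.proj j ∘ₗ LinearMap.proj i) ?_ ?_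
    · intro l f hf
      have hsum : ∑ i, ∑ j, LinearMap.single k (fun i => ∀ j, (C.Hom (X.obj i) (Y.obj j)).carrier) i
          (LinearMap.single k (fun j => (C.Hom (X.obj i) (Y.obj j)).carrier) j (f i j)) = f := by
        simp only [← map_sum]
        simp [Finset.univ_sum_single]
      conv_rhs => rw [← hsum]
      simp only [LinearMap.sum_apply, map_sum]
      refine Finset.sum_congr rfl fun i _ => Finset.sum_congr rfl fun j _ => ?_
      simp only [LinearMap.comp_apply, LinearMap.proj_apply]
      rw [DGMod.homLift_apply _ _ (hf i j)]
      simp only [LinearMap.comp_apply, Submodule.subtype_apply]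
      rw [show l + Y.shift j - X.shift i - Y.shift j + X.shift i = l by ring]
    · rw [eq_top_iff]
      rintro f -
      have hsum : ∑ i, ∑ j, LinearMap.single k (fun i => ∀ j, (C.Hom (X.obj i) (Y.obj j)).carrier) i
          (LinearMap.single k (fun j => (C.Hom (X.obj i) (Y.obj j)).carrier) j (f i j)) = f := by
        simp only [← map_sum]
        simp [Finset.univ_sum_single]
      rw [← hsum]
      refine sum_mem fun i _ => sum_mem fun j _ => ?_
      generalize f i j = x
      induction x using DGMod.hom_ind with
      | zero => simp
      | add x y hx hy => simp only [map_add]; exact add_mem hx hy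
      | hom n x hx =>
        refine Submodule.mem_iSup_of_mem (n - Y.shift j + X.shift i) ?_
        intro i' j'
        by_cases hi : i' = i
        · subst hi
          by_cases hj : j' = j
          · subst hj
            rw [show n - Y.shift j' + X.shift i' + Y.shift j' - X.shift i' = n by ring]
            simpa using hx
          · simp [hj]
        · simp [hi]
  d := LinearMap.pi fun i => LinearMap.pi fun j =>
    (Y.shift j).negOnePow • ((C.Hom (X.obj i) (Y.obj j)).d ∘ₗ LinearMap.proj j ∘ₗ LinearMap.proj i)
  d_mem := by
    intro l f hf i j
    have h := (C.Hom (X.obj i) (Y.obj j)).d_mem (hf i j)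
    rw [show l + Y.shift j - X.shift i + 1 = l + 1 + Y.shift j - X.shift i by ring] at h
    exact DGMod.units_smul_mem _ _ h
  d_d := by
    intro f
    funext i j
    simp only [LinearMap.pi_apply, LinearMap.smul_apply, LinearMap.comp_apply,
      LinearMap.proj_apply, Units.smul_def, map_zsmul, DGMod.d_d, smul_zero]
    rfl

/-- The additive suspended envelope of a dg category. -/
def susp : DGCat.{w, u, v} k where
  Obj := C.SuspObj
  Hom := suspHom
  id X := fun i j => if h : i = j then h ▸ C.id (X.obj i) else 0
  comp {X Y Z} := LinearMap.mk₂ k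
    (fun g f i l => ∑ j, C.comp (g j l) (f i j))
    (by
      intro g g' f
      funext i l
      change ∑ j, C.comp (g j l + g' j l) (f i j)
        = ∑ j, C.comp (g j l) (f i j) + ∑ j, C.comp (g' j l) (f i j)
      simp [Finset.sum_add_distrib])
    (by
      intro a g f
      funext i l
      change ∑ j, C.comp (a • g j l) (f i j) = a • ∑ j, C.comp (g j l) (f i j)
      simp [Finset.smul_sum])
    (by
      intro g f f'
      funext i l
      change ∑ j, C.comp (g j l) (f i j + f' i j)
        = ∑ j, C.comp (g j l) (f i j) + ∑ j, C.comp (g j l) (f' i j)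
      simp [Finset.sum_add_distrib])
    (by
      intro a g f
      funext i l
      change ∑ j, C.comp (g j l) (a • f i j) = a • ∑ j, C.comp (g j l) (f i j)
      simp [Finset.smul_sum])
  id_mem X := by
    intro i j
    by_cases h : i = j
    · subst h
      simpa using C.id_mem (X.obj i)
    · simp [h]
  comp_mem {X Y Z a b g f} hg hf := by
    intro i l
    change ∑ j, C.comp (g j l) (f i j) ∈ _
    refine Submodule.sum_mem _ fun j _ => ?_
    have := C.comp_mem (hg j l) (hf i j)
    rwa [show a + Z.shift l - Y.shift j + (b + Y.shift j - X.shift i)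
      = a + b + Z.shift l - X.shift i by ring] at this
  id_comp {X Y} f := by
    funext i l
    change ∑ j, C.comp (if h : j = l then h ▸ C.id (Y.obj j) else 0) (f i j) = f i l
    rw [Finset.sum_eq_single l]
    · simp [C.id_comp]
    · intro j _ hj; simp [hj]
    · simp
  comp_id {X Y} f := by
    funext i l
    change ∑ j, C.comp (f j l) (if h : i = j then h ▸ C.id (X.obj i) else 0) = f i l
    rw [Finset.sum_eq_single i]
    · simp [C.comp_id]
    · intro j _ hj; simp [hj.symm]
    · simp
  assoc {W X Y Z} h g f := by
    funext i l
    change ∑ j, C.comp (∑ m, C.comp (h m l) (g j m)) (f i j)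
      = ∑ m, C.comp (h m l) (∑ j, C.comp (g j m) (f i j))
    simp only [map_sum, LinearMap.sum_apply, C.assoc]
    exact Finset.sum_comm
  leibniz {X Y Z a g} f hg := by
    funext i l
    change (Z.shift l).negOnePow • (C.Hom _ _).d (∑ j, C.comp (g j l) (f i j))
      = ∑ j, C.comp ((Z.shift l).negOnePow • (C.Hom _ _).d (g j l)) (f i j)
        + a.negOnePow • ∑ j, C.comp (g j l) ((Y.shift j).negOnePow • (C.Hom _ _).d (f i j))
    rw [map_sum, Finset.smul_sum, Finset.smul_sum, ← Finset.sum_add_distrib]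
    refine Finset.sum_congr rfl fun j _ => ?_
    rw [C.leibniz _ (hg j l), smul_add]
    simp only [Units.smul_def, map_zsmul, LinearMap.smul_apply]
    congr 1
    simp only [smul_smul, ← Units.val_mul, ← Int.negOnePow_add]
    congr 2
    rw [Int.negOnePow_eq_iff]
    exact ⟨Z.shift l - Y.shift j, by ring⟩

/-- An object with a Maurer–Cartan endomorphism. -/
structure TwObj where
  obj : C.Obj
  α : C.Hom obj obj
  α_mem : α ∈ (C.Hom obj obj).gr 1
  mc : (C.Hom obj obj).d α + C.comp α α = 0

variable {C} in
/-- The twisted differential `f ↦ d f + β f - (-1)^|f| f α` on morphisms from `tw_α X` to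
`tw_β Y`. -/
noncomputable def twD (X Y : C.TwObj) : C.Hom X.obj Y.obj →ₗ[k] C.Hom X.obj Y.obj :=
  (C.Hom X.obj Y.obj).d + C.comp Y.α - C.comp.flip X.α ∘ₗ (C.Hom X.obj Y.obj).sgn

variable {C} in
theorem twD_apply {X Y : C.TwObj} {n : ℤ} {f : C.Hom X.obj Y.obj}
    (hf : f ∈ (C.Hom X.obj Y.obj).gr n) : twD X Y f
      = (C.Hom X.obj Y.obj).d f + C.comp Y.α f - n.negOnePow • C.comp f X.α := by
  simp only [twD, LinearMap.add_apply, LinearMap.sub_apply, LinearMap.comp_apply,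
    LinearMap.flip_apply, DGMod.sgn_apply _ hf, Units.smul_def, map_zsmul]

variable {C} in
/-- The complex of morphisms from `tw_α X` to `tw_β Y`: the module `Hom X Y` with the
twisted differential. -/
noncomputable def twHom (X Y : C.TwObj) : DGMod.{w, v} k where
  carrier := C.Hom X.obj Y.obj
  gr := (C.Hom X.obj Y.obj).gr
  internal := (C.Hom X.obj Y.obj).internal
  d := twD X Y
  d_mem := by
    intro n f hf
    refine sub_mem (add_mem (DGMod.d_mem _ hf) ?_) (C.comp_mem (DGMod.sgn_mem _ hf) X.α_mem)
    rw [add_comm]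
    exact C.comp_mem Y.α_mem hf
  d_d := by
    intro f
    have hX := eq_neg_of_add_eq_zero_left X.mc
    have hY := eq_neg_of_add_eq_zero_left Y.mc
    induction f using DGMod.hom_ind with
    | zero => simp
    | add f g hf hg => simp only [map_add, hf, hg, add_zero]
    | hom n f hf =>
      have h1 : C.comp Y.α f ∈ (C.Hom X.obj Y.obj).gr (n + 1) := by
        rw [add_comm]; exact C.comp_mem Y.α_mem hf
      have h2 := C.comp_mem hf X.α_mem
      simp only [twD, LinearMap.sub_apply, LinearMap.add_apply, LinearMap.comp_apply,
        LinearMap.flip_apply, map_add, map_sub, DGMod.sgn_apply _ hf, Units.smul_def, map_zsmul,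
        DGMod.sgn_apply _ (DGMod.d_mem _ hf), DGMod.sgn_apply _ h1,
        DGMod.sgn_apply _ h2, DGMod.d_d, C.leibniz _ hf, C.leibniz _ Y.α_mem, hX, hY,
        Int.negOnePow_succ, Int.negOnePow_one, C.assoc, map_neg, LinearMap.neg_apply,
        Units.val_neg, neg_smul, smul_add, smul_sub, smul_neg, smul_smul, ← Units.val_mul,
        Int.units_mul_self, Units.val_one, one_smul, LinearMap.sub_apply, LinearMap.add_apply]
      abel

theorem tw_leibniz {X Y Z : C.TwObj} {i : ℤ} (g : C.Hom Y.obj Z.obj) (f : C.Hom X.obj Y.obj)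
    (hg : g ∈ (C.Hom Y.obj Z.obj).gr i) :
    twD X Z (C.comp g f) = C.comp (twD Y Z g) f + i.negOnePow • C.comp g (twD X Y f) := by
  induction f using DGMod.hom_ind with
  | zero => simp
  | add f f' hf hf' =>
    simp only [map_add, smul_add, hf, hf']
    abel
  | hom j f hf =>
    rw [twD_apply hg, twD_apply hf, twD_apply (C.comp_mem hg hf), C.leibniz _ hg]
    simp only [map_add, map_sub, LinearMap.add_apply, LinearMap.sub_apply, Units.smul_def,
      map_zsmul, LinearMap.smul_apply, C.assoc, smul_add, smul_sub, smul_smul,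
      Int.negOnePow_add, Units.val_mul]
    abel

/-- The twisted envelope of a dg category. -/
noncomputable def tw : DGCat.{w, max u v, v} k where
  Obj := C.TwObj
  Hom := twHom
  id X := C.id X.obj
  comp {X Y Z} := C.comp (X := X.obj) (Y := Y.obj) (Z := Z.obj)
  id_mem X := C.id_mem X.obj
  comp_mem := C.comp_mem
  id_comp := C.id_comp
  comp_id := C.comp_id
  assoc := C.assoc
  leibniz {X Y Z i g} f hg := by
    exact C.tw_leibniz g f hg

/-- The formal direct sum with one summand `X`. -/
def toSusp (X : C.Obj) : C.susp.Obj := ⟨1, fun _ => 0, fun _ => X⟩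

/-- The object `tw_0 X` of the twisted envelope. -/
def toTw (X : C.Obj) : C.tw.Obj :=
  ⟨X, 0, zero_mem _, by simp⟩

/-- `X ≃ Y`: there are closed morphisms of degree `0` that are mutually inverse up to homotopy. -/
def HomotopyEquivalent (X Y : C.Obj) : Prop :=
  ∃ f ∈ (C.Hom X Y).gr 0, ∃ g ∈ (C.Hom Y X).gr 0,
    (C.Hom X Y).d f = 0 ∧ (C.Hom Y X).d g = 0 ∧
    (∃ h ∈ (C.Hom X X).gr (-1), C.id X - C.comp g f = (C.Hom X X).d h) ∧
    (∃ h ∈ (C.Hom Y Y).gr (-1), C.id Y - C.comp f g = (C.Hom Y Y).d h)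

/-- The full subcategories on the sets `B γ` form a semi-orthogonal decomposition of `C`:
every object of `C` is homotopy equivalent, in the twisted envelope of the additive suspended
envelope, to some `tw_δ (⨁ γ, Z γ)` where `Z γ` is a finite direct sum of translates of objects of
`B γ`, empty for all but finitely many `γ`, and `δ` is strictly lower triangular for the order on
`Γ`; and morphism complexes from objects of `B γ` to objects of `B γ'` are contractible unless
`γ ≤ γ'`. All the summands of all the `Z γ` are listed in one family here, with `ℓ i` the index `γ`
of the `i`-th one. -/
structure IsSemiorthogonal {Γ : Type t} [PartialOrder Γ] (B : Γ → Set C.Obj) : Prop where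
  exists_twisted : ∀ Z : C.Obj, ∃ (T : C.susp.tw.Obj) (ℓ : Fin T.obj.n → Γ),
    (∀ i, T.obj.obj i ∈ B (ℓ i)) ∧ (∀ i j, ¬ ℓ i < ℓ j → T.α i j = 0) ∧
    C.susp.tw.HomotopyEquivalent (C.susp.toTw (C.toSusp Z)) T
  contractible : ∀ γ γ', ¬ γ ≤ γ' → ∀ Y ∈ B γ, ∀ Y' ∈ B γ', (C.Hom Y Y').Contractible

end DGCat

/-! Drinfeld's dg quotient reduces both parts to producing null-homotopies of identities. Let Q
(`dgQuot`) be obtained from `C` by freely adjoining to each X an endomorphism ε of degree -1 with dε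
= -1. A morphism of Q is a sum of words f₀ ε f₁ ε ⋯ ε f_m, so it lives in the module underlying the
bar construction, and the words whose intermediate objects lie in `B` form the quotient `dgQuotBy
B`. Closing up an endomorphism, f₀ ε f₁ ε ⋯ ε f_m ↦ ± f₁|⋯|f_m f₀, is a trace (`cycTrace`): it
anticommutes with the differentials (`cycDiff_cycTrace`), it is cyclic for multiplication by
morphisms of `C` (`cycTrace_barLmul`), and every cyclic word s is the trace of ε s
(`cycOf_eq_cycTrace`). Hence operators on Q that commute up to sign with multiplication by `C` on
both sides descend to the cyclic bar complex.

Suppose every X has a null-homotopy e of degree -1 with de = -1 in `dgQuotBy B`, with e = ε when X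
is in `B`. Replacing each ε by e (`barSubst`) pushes words into those over `B` and fixes the latter.
Since ε - e = d(-eε), this substitution is homotopic to the identity by a `C`-bilinear homotopy
(`barDer_barHomotopy`). Applying the trace gives an idempotent of the cyclic bar complex, homotopic
to the identity, with image the words over `B` (`exists_homotopy_of_contractions`). The side
conditions on the homotopy are then arranged formally (`exists_deformationRetract`).

For part (1), the null-homotopies e come from generation applied to the functor of morphisms in
`dgQuotBy B` out of X, which is contractible on `B` because ε is available there
(`Generates.isContractible`).

For part (2), take the union of all `B γ`. In the quotient by it, each object is equivalent to a
one-sided twisted complex of contractible objects, and such a complex is contractible by a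
nilpotence argument (`isContractible_tw_susp`). This retracts onto cyclic words in the union. In a
cyclic word which is not inside a single `B γ`, the indices cannot be weakly monotone all the way
around, so some tensor factor is contractible (`contractible_tens`). The composition part of the
differential shortens words, so the wordwise contractions can be corrected by a perturbation series
that is finite on each word (`exists_homotopy_of_contractible_words`). The two homotopies compose
(`exists_homotopy_trans`). -/

namespace DGMod

variable {k : Type w} [CommRing k] (M : DGMod.{w, v} k)

/-! ### Sign operators and the Leibniz rule without homogeneity assumptions -/

theorem sgnPow_mem (i : ℤ) {n : ℤ} {x : M} (hx : x ∈ M.gr n) : M.sgnPow i x ∈ M.gr n := by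
  rw [sgnPow_apply _ _ hx]; exact M.units_smul_mem _ hx

theorem sgnPow_sgnPow (i j : ℤ) (x : M) : M.sgnPow i (M.sgnPow j x) = M.sgnPow (i + j) x := by
  induction x using hom_ind with
  | hom n x hx =>
    rw [sgnPow_apply _ _ hx, sgnPow_apply _ _ hx, Units.smul_def, map_zsmul, sgnPow_apply _ _ hx,
      ← Units.smul_def, smul_smul, add_mul, Int.negOnePow_add, mul_comm]
  | zero => simp
  | add x y hx hy => simp only [map_add, hx, hy]

@[simp] theorem sgnPow_zero (x : M) : M.sgnPow 0 x = x := by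
  induction x using hom_ind with
  | hom n x hx => rw [sgnPow_apply _ _ hx]; simp
  | zero => simp
  | add x y hx hy => simp only [map_add, hx, hy]

theorem sgnPow_of_even {i : ℤ} (hi : Even i) (x : M) : M.sgnPow i x = x := by
  induction x using hom_ind with
  | hom n x hx => rw [sgnPow_apply _ _ hx, Int.negOnePow_even _ (hi.mul_right n), one_smul]
  | zero => simp
  | add x y hx hy => simp only [map_add, hx, hy]

@[simp] theorem sgn_sgn (x : M) : M.sgn (M.sgn x) = x := by
  rw [sgn, sgnPow_sgnPow, sgnPow_of_even _ (by decide)]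

theorem sgnPow_d (i : ℤ) (x : M) :
    M.sgnPow i (M.d x) = i.negOnePow • M.d (M.sgnPow i x) := by
  induction x using hom_ind with
  | hom n x hx =>
    rw [sgnPow_apply _ _ hx, sgnPow_apply _ _ (M.d_mem hx), mul_add, mul_one, Int.negOnePow_add,
      mul_comm, Units.smul_def, Units.smul_def, Units.smul_def, map_zsmul, smul_smul,
        ← Units.val_mul]
  | zero => simp
  | add x y hx hy => simp only [map_add, hx, hy, smul_add]

end DGMod

namespace DGCat

variable {k : Type w} [CommRing k] {C : DGCat.{w, u, v} k}

theorem sgnPow_comp (i : ℤ) {X Y Z : C.Obj} (g : C.Hom Y Z) (f : C.Hom X Y) :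
    (C.Hom X Z).sgnPow i (C.comp g f)
      = C.comp ((C.Hom Y Z).sgnPow i g) ((C.Hom X Y).sgnPow i f) := by
  induction g using DGMod.hom_ind with
  | zero => simp
  | add x y hx hy => simp only [map_add, LinearMap.add_apply, hx, hy]
  | hom n g hg =>
    induction f using DGMod.hom_ind with
    | zero => simp
    | add x y hx hy => simp only [map_add, hx, hy]
    | hom m f hf =>
      rw [DGMod.sgnPow_apply _ _ hg, DGMod.sgnPow_apply _ _ hf,
        DGMod.sgnPow_apply _ _ (C.comp_mem hg hf), mul_add, Int.negOnePow_add]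
      simp only [Units.smul_def, map_zsmul, LinearMap.smul_apply, smul_smul, Units.val_mul]
      rw [mul_comm]

@[simp] theorem sgnPow_id (i : ℤ) (X : C.Obj) : (C.Hom X X).sgnPow i (C.id X) = C.id X := by
  rw [DGMod.sgnPow_apply _ _ (C.id_mem X)]; simp

@[simp] theorem d_id (X : C.Obj) : (C.Hom X X).d (C.id X) = 0 := by
  have h := C.leibniz (C.id X) (C.id_mem X)
  simpa [C.id_comp, C.comp_id] using h

theorem d_comp {X Y Z : C.Obj} (g : C.Hom Y Z) (f : C.Hom X Y) :
    (C.Hom X Z).d (C.comp g f)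
      = C.comp ((C.Hom Y Z).d g) f + C.comp ((C.Hom Y Z).sgn g) ((C.Hom X Y).d f) := by
  induction g using DGMod.hom_ind with
  | zero => simp
  | add x y hx hy => simp only [map_add, LinearMap.add_apply, hx, hy]; abel
  | hom n g hg =>
    rw [C.leibniz _ hg, DGMod.sgn_apply _ hg]
    simp [Units.smul_def]

/-! ### Linear maps out of the sum of tensor products -/

section
open scoped Classical

/-- The inclusion of a summand of `Bar Y X`. -/
noncomputable def barOf {Y X : C.Obj} (L : List C.Obj) : C.tens Y L X →ₗ[k] C.Bar Y X :=
  DirectSum.lof k _ (fun L => (C.tens Y L X).carrier) L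

@[simp] theorem barCons_barOf {X Y Z : C.Obj} (f : C.Hom Z X) (L : List C.Obj)
    (s : C.tens Y L Z) : barCons f (barOf L s) = barOf (Z :: L) (cons f s) :=
  barCons_lof f L s

theorem bar_of_ind {Y X : C.Obj} {p : C.Bar Y X → Prop} (zero : p 0)
    (add : ∀ x y, p x → p y → p (x + y)) (of : ∀ L s, p (barOf L s)) (x : C.Bar Y X) : p x :=
  DirectSum.induction_on x zero of add

/-- In the dg quotient, `barOf [] f` is the morphism f and `barCons f x` is the composite f ε x, so
this is induction on the number of ε's. Removing f and ε changes the target object, hence the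
predicate ranges over all X. -/
theorem bar_ind {Y : C.Obj} {p : ∀ {X : C.Obj}, C.Bar Y X → Prop}
    (zero : ∀ X, p (0 : C.Bar Y X))
    (add : ∀ {X} (x y : C.Bar Y X), p x → p y → p (x + y))
    (nil : ∀ {X} (f : C.Hom Y X), p (barOf [] f : C.Bar Y X))
    (cons : ∀ {X Z} (f : C.Hom Z X) (x : C.Bar Y Z), p x → p (barCons f x : C.Bar Y X))
    {X : C.Obj} (x : C.Bar Y X) : p x := by
  have key : ∀ (L : List C.Obj) {X : C.Obj} (s : C.tens Y L X), p (barOf L s) := by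
    intro L
    induction L with
    | nil => exact fun s => nil s
    | cons Z L ih =>
      intro X s
      induction s using cons_ind with
      | zero => rw [map_zero]; exact zero X
      | add x y hx hy => rw [map_add]; exact add _ _ hx hy
      | cons f s => rw [← barCons_barOf]; exact cons f _ (ih s)
  exact bar_of_ind (zero X) add (fun L s => key L s) x

section Rec

variable {Y : C.Obj} {A : C.Obj → Type t} [∀ X, AddCommGroup (A X)] [∀ X, Module k (A X)]
  (n : ∀ X, C.Hom Y X →ₗ[k] A X)
  (c : ∀ X Z, C.Hom Z X →ₗ[k] (C.Bar Y Z × A Z) →ₗ[k] A X)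

/-- Recursion on the number of factors. -/
noncomputable def tensRec : ∀ (L : List C.Obj) (X : C.Obj), C.tens Y L X →ₗ[k] A X
  | [], X => n X
  | Z :: L, X => consLift (LinearMap.compl₂ (c X Z) (LinearMap.prod (barOf L) (tensRec L Z)))

/-- The linear maps `r` with `r f = n f` and `r (f ⊗ x) = c f (x, r x)`. -/
noncomputable def barRec (X : C.Obj) : C.Bar Y X →ₗ[k] A X :=
  DirectSum.toModule k _ _ fun L => tensRec n c L X

theorem barRec_barOf {X : C.Obj} (L : List C.Obj) (s : C.tens Y L X) :
    barRec n c X (barOf L s) = tensRec n c L X s := by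
  rw [barRec, barOf, DirectSum.toModule_lof]

@[simp] theorem barRec_nil {X : C.Obj} (f : C.Hom Y X) :
    barRec n c X (barOf [] f) = n X f := barRec_barOf n c [] f

@[simp] theorem barRec_cons {X Z : C.Obj} (f : C.Hom Z X) (x : C.Bar Y Z) :
    barRec n c X (barCons f x) = c X Z f (x, barRec n c Z x) := by
  induction x using bar_of_ind with
  | zero => simp only [map_zero]; exact (map_zero _).symm
  | add x y hx hy => simp only [map_add, hx, hy, ← Prod.mk_add_mk]
  | of L s => rw [barCons_barOf, barRec_barOf, barRec_barOf]; simp [tensRec]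

end Rec

/-- `f ↦ (f₁ ⊗ ⋯ ⊗ f_m ↦ f f₁ ⊗ ⋯ ⊗ f_m)`, on all summands. -/
noncomputable def barLmul {X Y Z : C.Obj} : C.Hom Z X →ₗ[k] C.Bar Y Z →ₗ[k] C.Bar Y X :=
  LinearMap.flip <| DirectSum.toModule k _ _ fun L => LinearMap.flip <|
    LinearMap.compr₂ (lmul L) (barOf L)

theorem barLmul_barOf {X Y Z : C.Obj} (f : C.Hom Z X) (L : List C.Obj) (s : C.tens Y L Z) :
    barLmul f (barOf L s) = barOf L (lmul L f s) := by
  simp [barLmul, barOf]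

@[simp] theorem barLmul_nil {X Y Z : C.Obj} (f : C.Hom Z X) (g : C.Hom Y Z) :
    barLmul f (barOf [] g) = barOf [] (C.comp f g) := barLmul_barOf f [] g

@[simp] theorem barLmul_barCons {X Y Z W : C.Obj} (f : C.Hom Z X) (g : C.Hom W Z)
    (x : C.Bar Y W) : barLmul f (barCons g x) = barCons (C.comp f g) x := by
  induction x using bar_of_ind with
  | zero => simp
  | add x y hx hy => simp only [map_add, hx, hy]
  | of L s => rw [barCons_barOf, barCons_barOf, barLmul_barOf, lmul_cons]

/-- The product `(f₀ ⊗ ⋯ ⊗ f_m) (g₀ ⊗ ⋯ ⊗ g_n) = f₀ ⊗ ⋯ ⊗ f_m g₀ ⊗ ⋯ ⊗ g_n`. -/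
noncomputable def barMul {X Y W : C.Obj} : C.Bar Y X →ₗ[k] C.Bar W Y →ₗ[k] C.Bar W X :=
  barRec (A := fun X => C.Bar W Y →ₗ[k] C.Bar W X) (fun _ => barLmul)
    (fun _ _ => (LinearMap.llcomp k _ _ _ ∘ₗ barCons).compl₂ (LinearMap.snd k _ _)) X

@[simp] theorem barMul_nil {X Y W : C.Obj} (f : C.Hom Y X) (x : C.Bar W Y) :
    barMul (barOf [] f) x = barLmul f x := by
  rw [barMul, barRec_nil]

@[simp] theorem barMul_barCons {X Y Z W : C.Obj} (f : C.Hom Z X) (x : C.Bar Y Z)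
    (y : C.Bar W Y) : barMul (barCons f x) y = barCons f (barMul x y) := by
  rw [barMul, barRec_cons]; rfl

/-- The operator `x ↦ (-1)^|x| x`, where `|f₀ ⊗ ⋯ ⊗ f_m| = |f₀| + ⋯ + |f_m| - m`. -/
noncomputable def barSgn {X Y : C.Obj} : C.Bar Y X →ₗ[k] C.Bar Y X :=
  barRec (fun X => barOf [] ∘ₗ (C.Hom Y X).sgn)
    (fun X Z => -((barCons ∘ₗ (C.Hom Z X).sgn).compl₂ (LinearMap.snd k _ _))) X

@[simp] theorem barSgn_nil {X Y : C.Obj} (f : C.Hom Y X) :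
    barSgn (barOf [] f) = barOf [] ((C.Hom Y X).sgn f) := by
  rw [barSgn, barRec_nil]; rfl

@[simp] theorem barSgn_barCons {X Y Z : C.Obj} (f : C.Hom Z X) (x : C.Bar Y Z) :
    barSgn (barCons f x) = - barCons ((C.Hom Z X).sgn f) (barSgn x) := by
  rw [barSgn, barRec_cons]; rfl

/-- The derivation with `f ↦ d f` and `1 ⊗ 1 ↦ -1`. -/
noncomputable def barDer {X Y : C.Obj} : C.Bar Y X →ₗ[k] C.Bar Y X :=
  barRec (fun X => barOf [] ∘ₗ (C.Hom Y X).d)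
    (fun X Z => (barCons ∘ₗ (C.Hom Z X).d - barLmul ∘ₗ (C.Hom Z X).sgn).compl₂ (LinearMap.fst k _ _)
      - (barCons ∘ₗ (C.Hom Z X).sgn).compl₂ (LinearMap.snd k _ _)) X

@[simp] theorem barDer_nil {X Y : C.Obj} (f : C.Hom Y X) :
    barDer (barOf [] f) = barOf [] ((C.Hom Y X).d f) := by
  rw [barDer, barRec_nil]; rfl

@[simp] theorem barDer_barCons {X Y Z : C.Obj} (f : C.Hom Z X) (x : C.Bar Y Z) :
    barDer (barCons f x) = barCons ((C.Hom Z X).d f) x - barLmul ((C.Hom Z X).sgn f) x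
      - barCons ((C.Hom Z X).sgn f) (barDer x) := by
  rw [barDer, barRec_cons]; rfl

/-! ### Algebra -/

theorem barLmul_barLmul {X Y Z W : C.Obj} (f : C.Hom Z X) (g : C.Hom W Z) (x : C.Bar Y W) :
    barLmul f (barLmul g x) = barLmul (C.comp f g) x := by
  induction x using bar_ind with
  | zero => simp
  | add x y hx hy => simp only [map_add, hx, hy]
  | nil h => simp [C.assoc]
  | cons h x _ => simp [C.assoc]

@[simp] theorem barLmul_id {X Y : C.Obj} (x : C.Bar Y X) : barLmul (C.id X) x = x := by
  induction x using bar_ind with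
  | zero => simp
  | add x y hx hy => simp only [map_add, hx, hy]
  | nil h => simp [C.id_comp]
  | cons h x _ => simp [C.id_comp]

theorem barMul_barLmul {X Y Z W : C.Obj} (f : C.Hom Z X) (x : C.Bar Y Z) (y : C.Bar W Y) :
    barMul (barLmul f x) y = barLmul f (barMul x y) := by
  induction x using bar_ind with
  | zero => simp
  | add x y hx hy => simp only [map_add, hx, hy, LinearMap.add_apply]
  | nil h => simp [barLmul_barLmul]
  | cons h x _ => simp

theorem barMul_assoc {X Y W V : C.Obj} (x : C.Bar Y X) (y : C.Bar W Y) (z : C.Bar V W) :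
    barMul (barMul x y) z = barMul x (barMul y z) := by
  induction x using bar_ind with
  | zero => simp
  | add x y hx hy => simp only [map_add, hx, hy, LinearMap.add_apply]
  | nil h => simp [barMul_barLmul]
  | cons h x ih => simp [ih]

@[simp] theorem barMul_id {X Y : C.Obj} (x : C.Bar Y X) : barMul x (barOf [] (C.id Y)) = x := by
  induction x using bar_ind with
  | zero => simp
  | add x y hx hy => simp only [map_add, hx, hy, LinearMap.add_apply]
  | nil h => simp [C.comp_id]
  | cons h x ih => simp [ih]

theorem barDer_barLmul {X Y Z : C.Obj} (f : C.Hom Z X) (x : C.Bar Y Z) :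
    barDer (barLmul f x) = barLmul ((C.Hom Z X).d f) x
      + barLmul ((C.Hom Z X).sgn f) (barDer x) := by
  induction x using bar_ind with
  | zero => simp
  | add x y hx hy => simp only [map_add, hx, hy]; abel
  | nil h =>
    simp only [barLmul_nil, barDer_nil, d_comp]
    exact map_add (barOf []) _ _
  | cons h x ih =>
    simp [d_comp, sgnPow_comp, barLmul_barLmul]
    abel

/-- The Leibniz rule of the dg quotient; `barSgn` counts each ε with degree -1. -/
theorem barDer_barMul {X Y W : C.Obj} (x : C.Bar Y X) (y : C.Bar W Y) :
    barDer (barMul x y) = barMul (barDer x) y + barMul (barSgn x) (barDer y) := by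
  induction x using bar_ind with
  | zero => simp
  | add x y hx hy => simp only [map_add, hx, hy, LinearMap.add_apply]; abel
  | nil h => simp [barDer_barLmul]
  | cons h x ih =>
    simp only [barMul_barCons, barDer_barCons, ih, barSgn_barCons, map_sub, LinearMap.sub_apply,
      barMul_barLmul, map_neg, LinearMap.neg_apply, map_add]
    abel

/-- Consistent because dε = -1 is closed: in d²(f ε x) the terms in which ε has been removed cancel
in pairs. -/
theorem barDer_barDer {X Y : C.Obj} (x : C.Bar Y X) : barDer (barDer x) = 0 := by
  induction x using bar_ind with
  | zero => simp
  | add x y hx hy => simp only [map_add, hx, hy, add_zero]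
  | nil h =>
    simp only [barDer_nil, DGMod.d_d]
    exact map_zero (barOf [])
  | cons h x ih =>
    simp only [barDer_barCons, map_sub, barDer_barLmul, ih, DGMod.d_d, DGMod.sgn_d, map_neg,
      LinearMap.neg_apply, DGMod.sgn_sgn, map_zero, LinearMap.zero_apply]
    abel

end

end DGCat

/-! ### The dg quotient by a full subcategory -/

namespace DGMod

variable {k : Type w} [CommRing k]

/-- The subcomplex on a submodule that is stable under the differential and spanned by homogeneous
elements. -/
def sub (M : DGMod.{w, v} k) (S : Submodule k M) (hd : ∀ x ∈ S, M.d x ∈ S)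
    (hS : S ≤ ⨆ n, S ⊓ M.gr n) : DGMod.{w, v} k where
  carrier := S
  gr n := (M.gr n).comap S.subtype
  internal := by
    constructor
    · have key : S.subtype ∘ₗ DirectSum.coeLinearMap (fun n => (M.gr n).comap S.subtype)
          = DirectSum.coeLinearMap M.gr ∘ₗ DirectSum.lmap
            (fun n => (S.subtype.restrict (p := (M.gr n).comap S.subtype) (q := M.gr n)
              fun _ hx => hx)) := by
        ext n x : 2
        simp
      have hinj : Function.Injective (DirectSum.lmap
            (fun n => (S.subtype.restrict (p := (M.gr n).comap S.subtype) (q := M.gr n)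
              fun _ hx => hx))) := by
        intro x y hxy
        ext n
        have := congrArg (fun z => ((z n : M.gr n) : M)) hxy
        simpa using this
      have : Function.Injective (S.subtype ∘ₗ
          DirectSum.coeLinearMap (fun n => (M.gr n).comap S.subtype)) := by
        rw [key]
        exact M.internal.1.comp hinj
      exact Function.Injective.of_comp (f := S.subtype) this
    · intro x
      have : x ∈ LinearMap.range
          (DirectSum.coeLinearMap (fun n => (M.gr n).comap S.subtype)) := by
        rw [DirectSum.range_coeLinearMap]
        obtain ⟨x, hx⟩ := x
        have h2 := hS hx
        have : ∀ y ∈ ⨆ n, S ⊓ M.gr n, ∀ hy : y ∈ S,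
            (⟨y, hy⟩ : S) ∈ ⨆ n, (M.gr n).comap S.subtype := by
          intro y hy
          induction hy using Submodule.iSup_induction' with
          | mem n y hy => exact fun h => Submodule.mem_iSup_of_mem n hy.2
          | zero => exact fun _ => zero_mem _
          | add y z hy hz ihy ihz =>
            intro h
            have hle : ⨆ n, S ⊓ M.gr n ≤ S := iSup_le fun _ => inf_le_left
            exact add_mem (ihy (hle hy)) (ihz (hle hz))
        exact this x h2 hx
      exact this
  d := M.d.restrict hd
  d_mem := M.d_mem
  d_d x := Subtype.ext (M.d_d x.1)

end DGMod

namespace DGCat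

variable {k : Type w} [CommRing k]

/-- The dg subcategory with the same objects and the given modules of morphisms. -/
def sub (Q : DGCat.{w, u, v} k) (S : ∀ X Y, Submodule k (Q.Hom X Y))
    (hd : ∀ X Y, ∀ x ∈ S X Y, (Q.Hom X Y).d x ∈ S X Y)
    (hS : ∀ X Y, S X Y ≤ ⨆ n, S X Y ⊓ (Q.Hom X Y).gr n)
    (hid : ∀ X, Q.id X ∈ S X X)
    (hcomp : ∀ X Y Z, ∀ g ∈ S Y Z, ∀ f ∈ S X Y, Q.comp g f ∈ S X Z) : DGCat.{w, u, v} k where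
  Obj := Q.Obj
  Hom X Y := (Q.Hom X Y).sub (S X Y) (hd X Y) (hS X Y)
  id X := ⟨Q.id X, hid X⟩
  comp {X Y Z} := LinearMap.mk₂ k (fun (g : S Y Z) (f : S X Y) =>
      (⟨Q.comp g.1 f.1, hcomp X Y Z g.1 g.2 f.1 f.2⟩ : S X Z))
    (fun g g' f => Subtype.ext (LinearMap.map_add₂ Q.comp g.1 g'.1 f.1))
    (fun a g f => Subtype.ext (LinearMap.map_smul₂ Q.comp a g.1 f.1))
    (fun g f f' => Subtype.ext (map_add (Q.comp g.1) f.1 f'.1))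
    (fun a g f => Subtype.ext (map_smul (Q.comp g.1) a f.1))
  id_mem X := Q.id_mem X
  comp_mem hg hf := Q.comp_mem hg hf
  id_comp f := Subtype.ext (Q.id_comp f.1)
  comp_id f := Subtype.ext (Q.comp_id f.1)
  assoc h g f := Subtype.ext (Q.assoc h.1 g.1 f.1)
  leibniz f hg := by
    refine Subtype.ext ((Q.leibniz f.1 hg).trans ?_)
    rw [Units.smul_def, Units.smul_def]
    rfl

variable {C : DGCat.{w, u, v} k}

section
open scoped Classical

variable (C) in
/-- The complex of morphisms from `Y` to `X` in the dg quotient: the sum of all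
`X C X₂ ⊗ ⋯ ⊗ X_m C Y` with the differential `barDer`. -/
noncomputable def barGrading (Y X : C.Obj) : DGMod.{w, max u v} k :=
  DGMod.directSum fun L : List C.Obj => (C.tens Y L X).shift L.length

theorem barOf_mem {Y X : C.Obj} {L : List C.Obj} {n : ℤ} {s : C.tens Y L X}
    (hs : s ∈ (C.tens Y L X).gr (n + L.length)) : barOf L s ∈ (C.barGrading Y X).gr n := by
  intro p
  by_cases h : L = p
  · subst h
    have : barOf L s L = s := DirectSum.of_eq_same
      (β := fun L : List C.Obj => (C.tens Y L X).carrier) L s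
    exact this.symm ▸ hs
  · have : barOf L s p = 0 := DirectSum.of_eq_of_ne
      (β := fun L : List C.Obj => (C.tens Y L X).carrier) _ _ s (Ne.symm h)
    exact this.symm ▸ zero_mem _

theorem barOf_nil_mem {X Y : C.Obj} {n : ℤ} {f : C.Hom Y X} (hf : f ∈ (C.Hom Y X).gr n) :
    (barOf [] f : C.Bar Y X) ∈ (C.barGrading Y X).gr n :=
  barOf_mem (L := []) (by rw [List.length_nil, Nat.cast_zero, add_zero]; exact hf)

/-- The -1 is the degree of the ε between f and x. -/
theorem barCons_mem_grading {X Y Z : C.Obj} {i n : ℤ} {f : C.Hom Z X} {x : C.Bar Y Z}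
    (hf : f ∈ (C.Hom Z X).gr i) (hx : x ∈ (C.barGrading Y Z).gr n) :
    barCons f x ∈ (C.barGrading Y X).gr (i + n - 1) := by
  rw [← DirectSum.sum_support_of x, map_sum]
  refine sum_mem fun L _ => ?_
  change barCons f (barOf L (x L)) ∈ _
  rw [barCons_barOf]
  refine barOf_mem ?_
  have := cons_mem (Y := Y) hf (hx L)
  rw [List.length_cons]
  push_cast
  rwa [show i + n - 1 + ((L.length : ℤ) + 1) = i + (n + L.length) by ring]

theorem bar_mem_ind {Y : C.Obj}
    {p : ∀ {X : C.Obj} {n : ℤ} (x : C.Bar Y X), x ∈ (C.barGrading Y X).gr n → Prop}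
    (zero : ∀ {X n} h, p (X := X) (n := n) 0 h)
    (add : ∀ {X n} (x y : C.Bar Y X) hx hy h, p (n := n) x hx → p (n := n) y hy →
      p (n := n) (x + y) h)
    (smul : ∀ {X n} (a : k) (x : C.Bar Y X) hx h, p (n := n) x hx → p (n := n) (a • x) h)
    (nil : ∀ {X n} (f : C.Hom Y X) (_ : f ∈ (C.Hom Y X).gr n) h, p (n := n) (barOf [] f) h)
    (cons : ∀ {X Z i n} (f : C.Hom Z X) (x : C.Bar Y Z) (_ : f ∈ (C.Hom Z X).gr i)
      (hx : x ∈ (C.barGrading Y Z).gr n) h, p x hx → p (n := i + n - 1) (barCons f x) h)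
    {X : C.Obj} {n : ℤ} (x : C.Bar Y X) (hx : x ∈ (C.barGrading Y X).gr n) : p x hx := by
  -- The predicate depends on the proof of membership, so that proof is carried along existentially.
  have key : ∀ (L : List C.Obj) {X : C.Obj} {n : ℤ} (s : C.tens Y L X),
      s ∈ (C.tens Y L X).gr (n + L.length) → ∃ h, p (n := n) (barOf L s) h := by
    intro L
    induction L with
    | nil =>
      intro X n s hs
      rw [List.length_nil, Nat.cast_zero, add_zero] at hs
      exact ⟨_, nil s hs (barOf_nil_mem hs)⟩
    | cons Z L ih =>
      intro X n s hs
      induction s, hs using cons_mem_ind with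
      | zero => rw [map_zero]; exact ⟨_, zero (zero_mem _)⟩
      | add x y _ _ _ hx hy =>
        obtain ⟨_, hx⟩ := hx
        obtain ⟨_, hy⟩ := hy
        rw [map_add]
        exact ⟨_, add _ _ _ _ (add_mem ‹_› ‹_›) hx hy⟩
      | smul a x _ _ hx =>
        obtain ⟨_, hx⟩ := hx
        rw [map_smul]
        exact ⟨_, smul _ _ _ (Submodule.smul_mem _ a ‹_›) hx⟩
      | hom i j f s hij hf hs =>
        have e : n = i + (j - L.length) - 1 := by
          rw [List.length_cons] at hij; push_cast at hij; linarith
        have hs' : s ∈ (C.tens Y L Z).gr (j - L.length + L.length) := by simpa using hs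
        obtain ⟨_, h⟩ := ih s hs'
        rw [← barCons_barOf, e]
        exact ⟨_, cons f _ hf _ (barCons_mem_grading hf ‹_›) h⟩
  have : ∃ h, p (n := n) x h := by
    rw [← DirectSum.sum_support_of x]
    refine Finset.sum_induction _ (fun y => ∃ h, p (n := n) y h) ?_ ⟨_, zero (zero_mem _)⟩
      fun L _ => key L _ (hx L)
    rintro x y ⟨_, hx⟩ ⟨_, hy⟩
    exact ⟨_, add _ _ _ _ (add_mem ‹_› ‹_›) hx hy⟩
  exact this.2

theorem barLmul_mem {X Y Z : C.Obj} {i n : ℤ} {f : C.Hom Z X} {x : C.Bar Y Z}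
    (hf : f ∈ (C.Hom Z X).gr i) (hx : x ∈ (C.barGrading Y Z).gr n) :
    barLmul f x ∈ (C.barGrading Y X).gr (i + n) := by
  rw [← DirectSum.sum_support_of x, map_sum]
  refine sum_mem fun L _ => ?_
  change barLmul f (barOf L (x L)) ∈ _
  rw [barLmul_barOf]
  refine barOf_mem ?_
  have := lmul_mem (Y := Y) L hf (hx L)
  rwa [← add_assoc] at this

theorem barMul_mem {X Y W : C.Obj} {m n : ℤ} {x : C.Bar Y X} {y : C.Bar W Y}
    (hx : x ∈ (C.barGrading Y X).gr m) (hy : y ∈ (C.barGrading W Y).gr n) :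
    barMul x y ∈ (C.barGrading W X).gr (m + n) := by
  induction x, hx using bar_mem_ind with
  | zero => rw [map_zero]; exact zero_mem _
  | add x y _ _ _ hx hy => rw [map_add]; exact add_mem hx hy
  | smul a x _ _ hx => rw [map_smul]; exact Submodule.smul_mem _ a hx
  | nil f hf => rw [barMul_nil]; exact barLmul_mem hf hy
  | @cons _ _ i m f x hf _ _ ih =>
    rw [barMul_barCons, show i + m - 1 + n = i + (m + n) - 1 by ring]
    exact barCons_mem_grading hf ih

theorem barSgn_apply {X Y : C.Obj} {n : ℤ} {x : C.Bar Y X}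
    (hx : x ∈ (C.barGrading Y X).gr n) : barSgn x = n.negOnePow • x := by
  induction x, hx using bar_mem_ind with
  | zero => rw [map_zero, smul_zero]
  | add x y _ _ _ hx hy => rw [map_add, smul_add, hx, hy]
  | smul a x _ _ hx => rw [map_smul, hx, smul_comm]
  | nil f hf =>
    rw [barSgn_nil, DGMod.sgn_apply _ hf, Units.smul_def, Units.smul_def]
    exact map_zsmul (barOf []) _ _
  | @cons _ _ i m f x hf _ _ ih =>
    rw [barSgn_barCons, DGMod.sgn_apply _ hf, ih, show i + m - 1 = i + m + 1 - 2 * 1 by ring,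
      Int.negOnePow_sub, Int.negOnePow_two_mul, Int.negOnePow_succ, Int.negOnePow_add]
    simp [Units.smul_def, smul_smul]

theorem barDer_mem {X Y : C.Obj} {n : ℤ} {x : C.Bar Y X}
    (hx : x ∈ (C.barGrading Y X).gr n) : barDer x ∈ (C.barGrading Y X).gr (n + 1) := by
  induction x, hx using bar_mem_ind with
  | zero => rw [map_zero]; exact zero_mem _
  | add x y _ _ _ hx hy => rw [map_add]; exact add_mem hx hy
  | smul a x _ _ hx => rw [map_smul]; exact Submodule.smul_mem _ a hx
  | nil f hf => rw [barDer_nil]; exact barOf_nil_mem (DGMod.d_mem _ hf)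
  | @cons _ _ i m f x hf hx _ ih =>
    rw [barDer_barCons]
    refine sub_mem (sub_mem ?_ ?_) ?_
    · have := barCons_mem_grading (DGMod.d_mem _ hf) hx
      rwa [show i + 1 + m - 1 = i + m - 1 + 1 by ring] at this
    · have := barLmul_mem (DGMod.sgn_mem _ hf) hx
      rwa [show i + m = i + m - 1 + 1 by ring] at this
    · have := barCons_mem_grading (DGMod.sgn_mem _ hf) ih
      rwa [show i + (m + 1) - 1 = i + m - 1 + 1 by ring] at this

variable (C) in
/-- The dg quotient of `C` by all of its objects: the dg category obtained by adjoining to `C`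
freely, for each object, an endomorphism (namely `1 ⊗ 1`) of degree `-1` with differential `-1`. -/
noncomputable def dgQuot : DGCat.{w, u, max u v} k where
  Obj := C.Obj
  Hom Y X :=
    { carrier := C.Bar Y X
      grp := inferInstanceAs (AddCommGroup (C.Bar Y X))
      mod := inferInstanceAs (Module k (C.Bar Y X))
      gr := (C.barGrading Y X).gr
      internal := (C.barGrading Y X).internal
      d := barDer
      d_mem := barDer_mem
      d_d := barDer_barDer }
  id X := (barOf [] (C.id X) : C.Bar X X)
  comp {X Y Z} := barMul (X := Z) (Y := Y) (W := X)
  id_mem X := barOf_nil_mem (C.id_mem X)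
  comp_mem hg hf := barMul_mem hg hf
  id_comp {X Y} f := (barMul_nil (C.id Y) _).trans (barLmul_id _)
  comp_id f := barMul_id _
  assoc h g f := barMul_assoc _ _ _
  leibniz {X Y Z i g} f hg := by
    refine (barDer_barMul g f).trans ?_
    rw [barSgn_apply hg, Units.smul_def, map_zsmul]
    rfl

/-- The span of the summands of `Bar Y X` for which the intermediate objects lie in `B`. -/
noncomputable def barSub (B : Set C.Obj) (Y X : C.Obj) : Submodule k (C.Bar Y X) :=
  Submodule.span k {x | ∃ (L : List C.Obj) (s : C.tens Y L X), (∀ Z ∈ L, Z ∈ B) ∧ x = barOf L s}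

variable {B : Set C.Obj}

theorem barOf_mem_barSub {Y X : C.Obj} {L : List C.Obj} (hL : ∀ Z ∈ L, Z ∈ B)
    (s : C.tens Y L X) : barOf L s ∈ barSub B Y X :=
  Submodule.subset_span ⟨L, s, hL, rfl⟩

theorem barOf_nil_mem_barSub {Y X : C.Obj} (f : C.Hom Y X) :
    (barOf [] f : C.Bar Y X) ∈ barSub B Y X :=
  barOf_mem_barSub (L := []) (by simp) f

theorem barCons_mem_barSub {X Y Z : C.Obj} (hZ : Z ∈ B) (f : C.Hom Z X) {x : C.Bar Y Z}
    (hx : x ∈ barSub B Y Z) : barCons f x ∈ barSub B Y X := by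
  induction hx using Submodule.span_induction with
  | zero => simp
  | add x y _ _ hx hy => rw [map_add]; exact add_mem hx hy
  | smul a x _ hx => rw [map_smul]; exact Submodule.smul_mem _ _ hx
  | mem x hx =>
    obtain ⟨L, s, hL, rfl⟩ := hx
    rw [barCons_barOf]
    exact barOf_mem_barSub (by simpa using ⟨hZ, hL⟩) _

theorem barSub_ind {Y : C.Obj} {p : ∀ {X : C.Obj} (x : C.Bar Y X), x ∈ barSub B Y X → Prop}
    (zero : ∀ {X} h, p (X := X) 0 h)
    (add : ∀ {X} (x y : C.Bar Y X) hx hy h, p x hx → p y hy → p (x + y) h)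
    (smul : ∀ {X} (a : k) (x : C.Bar Y X) hx h, p x hx → p (a • x) h)
    (nil : ∀ {X} (f : C.Hom Y X) h, p (barOf [] f) h)
    (cons : ∀ {X Z} (f : C.Hom Z X) (x : C.Bar Y Z) (_ : Z ∈ B) (hx : x ∈ barSub B Y Z) h,
      p x hx → p (barCons f x) h)
    {X : C.Obj} (x : C.Bar Y X) (hx : x ∈ barSub B Y X) : p x hx := by
  have key : ∀ (L : List C.Obj), (∀ Z ∈ L, Z ∈ B) → ∀ {X : C.Obj} (s : C.tens Y L X),
      ∃ h, p (barOf L s) h := by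
    intro L hL
    induction L with
    | nil => exact fun s => ⟨_, nil s (barOf_nil_mem_barSub _)⟩
    | cons Z L ih =>
      intro X s
      simp only [List.forall_mem_cons] at hL
      induction s using cons_ind with
      | zero => rw [map_zero]; exact ⟨_, zero (zero_mem _)⟩
      | add x y hx hy =>
        obtain ⟨_, hx⟩ := hx
        obtain ⟨_, hy⟩ := hy
        rw [map_add]
        exact ⟨_, add _ _ _ _ (add_mem ‹_› ‹_›) hx hy⟩
      | cons f s =>
        obtain ⟨_, h⟩ := ih hL.2 s
        rw [← barCons_barOf]
        exact ⟨_, cons f _ hL.1 _ (barCons_mem_barSub hL.1 _ ‹_›) h⟩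
  induction hx using Submodule.span_induction with
  | zero => exact zero _
  | add x y _ _ hx hy => exact add _ _ _ _ _ hx hy
  | smul a x _ hx => exact smul _ _ _ _ hx
  | mem x hx =>
    obtain ⟨L, s, hL, rfl⟩ := hx
    exact (key L hL s).2

theorem barLmul_mem_barSub {X Y Z : C.Obj} (f : C.Hom Z X) {x : C.Bar Y Z}
    (hx : x ∈ barSub B Y Z) : barLmul f x ∈ barSub B Y X := by
  induction x, hx using barSub_ind with
  | zero => simp
  | add x y _ _ _ hx hy => rw [map_add]; exact add_mem (hx f) (hy f)
  | smul a x _ _ hx => rw [map_smul]; exact Submodule.smul_mem _ _ (hx f)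
  | nil g => rw [barLmul_nil]; exact barOf_nil_mem_barSub _
  | cons g x hZ hx => rw [barLmul_barCons]; exact barCons_mem_barSub hZ _ hx

theorem barMul_mem_barSub {X Y W : C.Obj} {x : C.Bar Y X} {y : C.Bar W Y}
    (hx : x ∈ barSub B Y X) (hy : y ∈ barSub B W Y) : barMul x y ∈ barSub B W X := by
  induction x, hx using barSub_ind with
  | zero => simp
  | add x y _ _ _ hx hy => rw [map_add]; exact add_mem hx hy
  | smul a x _ _ hx => rw [map_smul]; exact Submodule.smul_mem _ _ hx
  | nil g => rw [barMul_nil]; exact barLmul_mem_barSub g hy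
  | cons g x hZ hx _ ih => rw [barMul_barCons]; exact barCons_mem_barSub hZ _ ih

theorem barDer_mem_barSub {X Y : C.Obj} {x : C.Bar Y X} (hx : x ∈ barSub B Y X) :
    barDer x ∈ barSub B Y X := by
  induction x, hx using barSub_ind with
  | zero => simp
  | add x y _ _ _ hx hy => rw [map_add]; exact add_mem hx hy
  | smul a x _ _ hx => rw [map_smul]; exact Submodule.smul_mem _ _ hx
  | nil g => rw [barDer_nil]; exact barOf_nil_mem_barSub _
  | cons g x hZ hx _ ih =>
    rw [barDer_barCons]
    exact sub_mem (sub_mem (barCons_mem_barSub hZ _ hx) (barLmul_mem_barSub _ hx))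
      (barCons_mem_barSub hZ _ ih)

theorem barSub_le_iSup (Y X : C.Obj) :
    barSub B Y X ≤ ⨆ n, barSub B Y X ⊓ (C.barGrading Y X).gr n := by
  refine Submodule.span_le.mpr ?_
  rintro x ⟨L, s, hL, rfl⟩
  change barOf L s ∈ ⨆ n, barSub B Y X ⊓ (C.barGrading Y X).gr n
  induction s using DGMod.hom_ind with
  | zero => simp
  | add x y hx hy => rw [map_add]; exact add_mem hx hy
  | hom n s hs =>
    exact Submodule.mem_iSup_of_mem (n - L.length)
      ⟨barOf_mem_barSub hL s, barOf_mem (by simpa using hs)⟩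

variable (C) in
/-- The dg quotient of `C` by the full subcategory on `B`. -/
noncomputable def dgQuotBy (B : Set C.Obj) : DGCat.{w, u, max u v} k :=
  C.dgQuot.sub (fun Y X => barSub (C := C) B Y X)
    (fun _ _ _ => barDer_mem_barSub) (barSub_le_iSup (C := C))
    (fun X => barOf_nil_mem_barSub (C.id X)) (fun _ _ _ _ hg _ hf => barMul_mem_barSub hg hf)

variable (C) in
/-- The dg functor from `C` to its dg quotient. -/
noncomputable def toDGQuotBy (B : Set C.Obj) : DGFunctor C (C.dgQuotBy B) where
  obj X := X
  map {X Y : C.Obj} := LinearMap.codRestrict (barSub B X Y) (barOf (Y := X) (X := Y) [])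
    barOf_nil_mem_barSub
  map_mem hf := barOf_nil_mem hf
  map_d f := Subtype.ext (barDer_nil f).symm
  map_id _ := rfl
  map_comp g f := Subtype.ext
    ((barLmul_nil g f).symm.trans (barMul_nil (W := _) g (barOf [] f)).symm)

end

end DGCat

namespace DGCat

variable {k : Type w} [CommRing k] {C : DGCat.{w, u, v} k}

section
open scoped Classical

/-! ### The trace -/

/-- The sign `(-1)^(∑ (m - i) |f_i|)` on `f₀ ⊗ ⋯ ⊗ f_m`. -/
noncomputable def signTens {Y : C.Obj} : ∀ (L : List C.Obj) {X : C.Obj},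
    C.tens Y L X →ₗ[k] C.tens Y L X
  | [], _ => LinearMap.id
  | Z :: L, X => consLift (LinearMap.compl₁₂ cons ((C.Hom Z X).sgnPow (L.length + 1)) (signTens L))

@[simp] theorem signTens_nil {X Y : C.Obj} (f : C.tens Y [] X) : signTens [] f = f := rfl

@[simp] theorem signTens_cons {X Y Z : C.Obj} (L : List C.Obj) (f : C.Hom Z X)
    (s : C.tens Y L Z) : signTens (Z :: L) (cons f s)
      = cons ((C.Hom Z X).sgnPow (L.length + 1) f) (signTens L s) := by
  simp [signTens]

theorem signTens_signTens {Y : C.Obj} : ∀ (L : List C.Obj) {X : C.Obj} (s : C.tens Y L X),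
    signTens L (signTens L s) = s
  | [], _, _ => rfl
  | Z :: L, X, s => by
    induction s using cons_ind with
    | zero => simp
    | add x y hx hy => simp only [map_add, hx, hy]
    | cons f s =>
      rw [signTens_cons, signTens_cons, signTens_signTens L s, DGMod.sgnPow_sgnPow,
        DGMod.sgnPow_of_even _ ⟨_, rfl⟩]

theorem signTens_mem {Y : C.Obj} : ∀ (L : List C.Obj) {X : C.Obj} {n : ℤ} {s : C.tens Y L X},
    s ∈ (C.tens Y L X).gr n → signTens L s ∈ (C.tens Y L X).gr n
  | [], _, _, _, h => h
  | Z :: L, X, n, s, h => by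
    induction s, h using cons_mem_ind with
    | zero => simp
    | add x y _ _ _ hx hy => rw [map_add]; exact add_mem hx hy
    | smul a x _ _ hx => rw [map_smul]; exact Submodule.smul_mem _ _ hx
    | hom i j f s hij hf hs =>
      rw [signTens_cons, ← hij]
      exact cons_mem (DGMod.sgnPow_mem _ _ hf) (signTens_mem L hs)

theorem signTens_lmul {X Y Z : C.Obj} (f : C.Hom Z X) : ∀ (L : List C.Obj) (s : C.tens Y L Z),
    signTens L (lmul L f s) = lmul L ((C.Hom Z X).sgnPow L.length f) (signTens L s)
  | [], s => by
    rw [signTens_nil, signTens_nil, List.length_nil, Nat.cast_zero, DGMod.sgnPow_zero]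
  | W :: L, s => by
    induction s using cons_ind with
    | zero => simp
    | add x y hx hy => simp only [map_add, hx, hy]
    | cons g s => simp [sgnPow_comp]

theorem signTens_rmul {Y Y' : C.Obj} (f : C.Hom Y' Y) : ∀ (L : List C.Obj) {X : C.Obj}
    (s : C.tens Y L X), signTens L (rmul L s f) = rmul L (signTens L s) f
  | [], _, _ => rfl
  | W :: L, _, s => by
    induction s using cons_ind with
    | zero => simp
    | add x y hx hy => simp only [map_add, hx, hy, LinearMap.add_apply]
    | cons g s => simp [signTens_rmul f L s]

/-- The operator `signTens` on all summands. -/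
noncomputable def barSign {X Y : C.Obj} : C.Bar Y X →ₗ[k] C.Bar Y X :=
  DirectSum.lmap fun L => signTens L

theorem barSign_barOf {X Y : C.Obj} (L : List C.Obj) (s : C.tens Y L X) :
    barSign (barOf L s) = barOf L (signTens L s) := by
  rw [barSign, barOf, DirectSum.lmap_lof]

/-- The span of the summands of `Bar Y X` with `m` factors. -/
noncomputable def barLen (Y X : C.Obj) (m : ℕ) : Submodule k (C.Bar Y X) :=
  Submodule.span k {x | ∃ (L : List C.Obj) (s : C.tens Y L X), L.length + 1 = m ∧ x = barOf L s}

theorem barOf_mem_barLen {Y X : C.Obj} (L : List C.Obj) (s : C.tens Y L X) :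
    barOf L s ∈ barLen Y X (L.length + 1) :=
  Submodule.subset_span ⟨L, s, rfl, rfl⟩

theorem barCons_mem_barLen {Y X Z : C.Obj} {m : ℕ} (f : C.Hom Z X) {x : C.Bar Y Z}
    (hx : x ∈ barLen Y Z m) : barCons f x ∈ barLen Y X (m + 1) := by
  induction hx using Submodule.span_induction with
  | zero => simp
  | add x y _ _ hx hy => rw [map_add]; exact add_mem hx hy
  | smul a x _ hx => rw [map_smul]; exact Submodule.smul_mem _ _ hx
  | mem x hx =>
    obtain ⟨L, s, rfl, rfl⟩ := hx
    rw [barCons_barOf]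
    exact barOf_mem_barLen (Z :: L) _

theorem barSign_barCons {Y X Z : C.Obj} {m : ℕ} (f : C.Hom Z X) {x : C.Bar Y Z}
    (hx : x ∈ barLen Y Z m) :
    barSign (barCons f x) = barCons ((C.Hom Z X).sgnPow m f) (barSign x) := by
  induction hx using Submodule.span_induction with
  | zero => simp
  | add x y _ _ hx hy => simp only [map_add, hx, hy]
  | smul a x _ hx => simp only [map_smul, hx]
  | mem x hx =>
    obtain ⟨L, s, rfl, rfl⟩ := hx
    rw [barCons_barOf, barSign_barOf, signTens_cons, barSign_barOf, barCons_barOf]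
    simp

/-- The sign of `signTens` is the Koszul sign for moving all ε's to the front: f_i passes the m - i
of them to its right. Conjugation by it turns the two parts of `barDer`, differentiating a factor
and deleting an ε, into the differential of the m-fold translate and the bar differential with its
signs (-1)^i. The length of y is recorded because the exponent in `barSign_barCons` depends on it.
-/
theorem exists_barDer_barOf {Y : C.Obj} : ∀ (L : List C.Obj) {X : C.Obj} (s : C.tens Y L X),
    ∃ (a : C.tens Y L X) (y : C.Bar Y X), y ∈ barLen Y X L.length ∧
      barDer (barOf L s) = barOf L a + y ∧
      signTens L a = (L.length : ℤ).negOnePow • (C.tens Y L X).d (signTens L s) ∧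
      barSign y = barD L (signTens L s)
  | [], X, s => ⟨(C.tens Y [] X).d s, 0, zero_mem _, by rw [add_zero]; exact barDer_nil s,
      by simp, by rw [map_zero, barD_nil]⟩
  | Z :: L, X, s => by
    induction s using cons_ind with
    | zero => exact ⟨0, 0, zero_mem _, by simp, by simp, by simp⟩
    | add x y hx hy =>
      obtain ⟨a, z, hz, h1, h2, h3⟩ := hx
      obtain ⟨a', z', hz', h1', h2', h3'⟩ := hy
      refine ⟨a + a', z + z', add_mem hz hz', ?_, ?_, ?_⟩
      · simp only [map_add, h1, h1']; abel
      · simp only [map_add, h2, h2', smul_add]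
      · simp only [map_add, h3, h3']
    | cons f s =>
      obtain ⟨a, y, hy, h1, h2, h3⟩ := exists_barDer_barOf L s
      refine ⟨cons ((C.Hom Z X).d f) s - cons ((C.Hom Z X).sgn f) a,
        - barOf L (lmul L ((C.Hom Z X).sgn f) s) - barCons ((C.Hom Z X).sgn f) y,
        sub_mem (neg_mem (barOf_mem_barLen _ _)) (barCons_mem_barLen _ hy), ?_, ?_, ?_⟩
      · rw [← barCons_barOf, barDer_barCons, h1, barLmul_barOf, map_add, map_sub, barCons_barOf,
          barCons_barOf]
        abel
      · have hd : ∀ (g : C.Hom Z X) (t : C.tens Y L Z), (C.tens Y (Z :: L) X).d (cons g t)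
            = cons ((C.Hom Z X).d g) t + cons ((C.Hom Z X).sgn g) ((C.tens Y L Z).d t) :=
          fun _ _ => rfl
        rw [map_sub, signTens_cons, signTens_cons, h2, signTens_cons, hd, DGMod.sgnPow_d]
        simp only [List.length_cons, Nat.cast_add, Nat.cast_one, Int.negOnePow_succ,
          Units.smul_def, Units.val_neg, neg_smul, map_neg, map_zsmul, LinearMap.neg_apply,
          LinearMap.smul_apply, smul_add, DGMod.sgn, DGMod.sgnPow_sgnPow]
        rw [add_comm (1 : ℤ)]
        abel
      · rw [signTens_cons, barD_cons, map_sub, map_neg, barSign_barOf, signTens_lmul,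
          barSign_barCons _ hy, h3, DGMod.sgn, DGMod.sgnPow_sgnPow]
        rfl

/-- The trace `f₀ ⊗ ⋯ ⊗ f_m ↦ ± f₁ ⊗ ⋯ ⊗ f_m f₀` from the endomorphisms in the dg quotient to
the cyclic bar complex. -/
noncomputable def cycTrace (X : C.Obj) : C.Bar X X →ₗ[k] C.Cyc := cycRotT X ∘ₗ barSign

/-- The map `f₀ ⊗ ⋯ ⊗ f_m ↦ ± f₀ ⊗ ⋯ ⊗ f_m` to the cyclic bar complex. -/
noncomputable def cycClose (X : C.Obj) : C.Bar X X →ₗ[k] C.Cyc := cycIncl X ∘ₗ barSign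

theorem cycRotT_barOf (X : C.Obj) (L : List C.Obj) (s : C.tens X L X) :
    cycRotT X (barOf L s) = cycRot X L s := by
  rw [cycRotT, barOf, DirectSum.toModule_lof]

theorem cycTrace_barOf (X : C.Obj) (L : List C.Obj) (s : C.tens X L X) :
    cycTrace X (barOf L s) = cycRot X L (signTens L s) := by
  rw [cycTrace, LinearMap.comp_apply, barSign_barOf, cycRotT_barOf]

theorem cycClose_barOf (X : C.Obj) (L : List C.Obj) (s : C.tens X L X) :
    cycClose X (barOf L s) = cycOf X L (signTens L s) := by
  rw [cycClose, LinearMap.comp_apply, barSign_barOf]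
  exact cycIncl_lof X L _

theorem cycTrace_nil (X : C.Obj) (f : C.Hom X X) : cycTrace X (barOf [] f) = 0 :=
  (cycTrace_barOf X [] f).trans (cycRot_nil X f)

theorem barMul_barOf_nil {X Y W : C.Obj} (g : C.Hom W Y) (L : List C.Obj) (s : C.tens Y L X) :
    barMul (barOf L s) (barOf [] g) = barOf L (rmul L s g) := by
  induction L generalizing X with
  | nil => exact (barMul_nil _ _).trans (barLmul_nil _ _)
  | cons Z L ih =>
    induction s using cons_ind with
    | zero => simp
    | add x y hx hy => simp only [map_add, hx, hy, LinearMap.add_apply]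
    | cons f s => rw [← barCons_barOf, barMul_barCons, ih, barCons_barOf, rmul_cons]

/-- Closing up f ε x moves f to the far right; n - 1 is the degree of ε x, so the sign is the Koszul
sign. -/
theorem cycTrace_barCons {X Z : C.Obj} {i n : ℤ} {f : C.Hom Z X} {x : C.Bar X Z}
    (hf : f ∈ (C.Hom Z X).gr i) (hx : x ∈ (C.barGrading X Z).gr n) :
    cycTrace X (barCons f x)
      = (i * (n - 1)).negOnePow • cycClose Z (barMul x (barOf [] f)) := by
  rw [← DirectSum.sum_support_of x]
  simp only [map_sum, LinearMap.sum_apply, Finset.smul_sum]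
  refine Finset.sum_congr rfl fun L _ => ?_
  have hL : x L ∈ (C.tens X L Z).gr (n + L.length) := hx L
  change cycTrace X (barCons f (barOf L (x L)))
    = (i * (n - 1)).negOnePow • cycClose Z (barMul (barOf L (x L)) (barOf [] f))
  rw [barCons_barOf, barMul_barOf_nil, cycClose_barOf, signTens_rmul, cycTrace_barOf, signTens_cons,
    DGMod.sgnPow_apply _ _ hf]
  simp only [cycRot, LinearMap.comp_apply]
  rw [Units.smul_def, map_zsmul, LinearMap.smul_apply, map_zsmul, rot_cons L hf (signTens_mem L hL),
    map_zsmul, Units.smul_def, map_zsmul, smul_smul, ← Units.val_mul, ← Int.negOnePow_add,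
    Units.smul_def]
  congr 2
  rw [Int.negOnePow_eq_iff]
  exact ⟨i * (L.length + 1), by ring⟩

/-- Cyclicity of the trace for morphisms of `C`: both sides close up to the same cyclic word, by
associativity of composition. -/
theorem cycTrace_barLmul {X Z : C.Obj} {i n : ℤ} {f : C.Hom Z X} {x : C.Bar X Z}
    (hf : f ∈ (C.Hom Z X).gr i) (hx : x ∈ (C.barGrading X Z).gr n) :
    cycTrace X (barLmul f x) = (i * n).negOnePow • cycTrace Z (barMul x (barOf [] f)) := by
  induction x, hx using bar_mem_ind with
  | zero => simp
  | add x y _ _ _ hx hy => simp only [map_add, LinearMap.add_apply, smul_add, hx hf, hy hf]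
  | smul a x _ _ hx => rw [map_smul, map_smul, hx hf, map_smul, LinearMap.smul_apply, map_smul,
      smul_comm]
  | nil g hg => simp only [barLmul_nil, barMul_nil, cycTrace_nil, smul_zero]
  | @cons _ _ j m g x hg hx _ _ =>
    have h1 := barMul_mem hx (barOf_nil_mem hf)
    rw [barLmul_barCons, barMul_barCons, cycTrace_barCons (C.comp_mem hf hg) hx,
      cycTrace_barCons hg h1, barMul_assoc, barMul_nil, barLmul_nil, smul_smul,
      ← Int.negOnePow_add]
    congr 1
    rw [Int.negOnePow_eq_iff]
    exact ⟨- (j * i), by ring⟩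

theorem bar_hom_cases {Y X : C.Obj} {p : C.Bar Y X → Prop} (zero : p 0)
    (add : ∀ x y, p x → p y → p (x + y)) (nil : ∀ f : C.Hom Y X, p (barOf [] f))
    (cons : ∀ (Z : C.Obj) (i n : ℤ) (f : C.Hom Z X) (x : C.Bar Y Z), f ∈ (C.Hom Z X).gr i →
      x ∈ (C.barGrading Y Z).gr n → p (barCons f x)) (x : C.Bar Y X) : p x := by
  induction x using bar_of_ind with
  | zero => exact zero
  | add x y hx hy => exact add x y hx hy
  | of L s =>
    cases L with
    | nil => exact nil s
    | cons Z L =>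
      induction s using cons_hom_ind with
      | zero => rw [map_zero]; exact zero
      | add x y hx hy => rw [map_add]; exact add _ _ hx hy
      | hom i j f s hf hs =>
        rw [← barCons_barOf]
        exact cons Z i (j - L.length) f _ hf (barOf_mem (by simpa using hs))

variable (C) in
/-- The differential of the cyclic bar complex. -/
noncomputable def cycDiff : C.Cyc →ₗ[k] C.Cyc := C.cycD + C.cycDelta

theorem cycDiff_cycDiff (x : C.Cyc) : C.cycDiff (C.cycDiff x) = 0 := cycTotal_d_d x

/-- The bar differential accounts for every summand of the cyclic one except the wrap-around
summand, which is the trace. -/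
theorem cycDiff_cycClose (X : C.Obj) (x : C.Bar X X) :
    C.cycDiff (cycClose X x) = cycClose X (barDer x) + cycTrace X x := by
  induction x using bar_of_ind with
  | zero => simp
  | add x y hx hy =>
    simp only [map_add]
    rw [hx, hy, add_add_add_comm]
  | of L s =>
    obtain ⟨a, y, -, h1, h2, h3⟩ := exists_barDer_barOf L s
    rw [h1, map_add, cycClose_barOf, cycClose_barOf, h2, cycTrace_barOf, cycDiff,
      LinearMap.add_apply, cycD_cycOf,
      cycDelta_cycOf, cycClose, LinearMap.comp_apply, h3, Units.smul_def, Units.smul_def,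
      map_zsmul]
    abel

/-- The trace of f ε x is ± the closure of x f. In the differential of that closure, the wrap-around
term is the trace of x f; by cyclicity it matches the term of `barDer (barCons f x)` in which ε has
been deleted. The sign is there because the trace has degree 1. -/
theorem cycDiff_cycTrace (X : C.Obj) (x : C.Bar X X) :
    C.cycDiff (cycTrace X x) = - cycTrace X (barDer x) := by
  induction x using bar_hom_cases with
  | zero => simp
  | add x y hx hy => simp only [map_add, neg_add, hx, hy]
  | nil f => rw [barDer_nil, cycTrace_nil, cycTrace_nil, map_zero, neg_zero]
  | cons Z i m f x hf hx =>
    have h : barDer (barMul x (barOf [] f)) = barMul (barDer x) (barOf [] f)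
        + m.negOnePow • barMul x (barOf [] ((C.Hom Z X).d f)) := by
      rw [barDer_barMul, barDer_nil, barSgn_apply hx, Units.smul_def, map_zsmul]
      rfl
    have h2 : barDer (barCons f x) = barCons ((C.Hom Z X).d f) x - i.negOnePow • barLmul f x
        - i.negOnePow • barCons f (barDer x) := by
      rw [barDer_barCons, DGMod.sgn_apply _ hf]
      simp [Units.smul_def]
    rw [h2]
    simp only [Units.smul_def, map_sub, map_zsmul]
    rw [cycTrace_barCons hf hx, Units.smul_def, map_zsmul, cycDiff_cycClose, h,
      cycTrace_barCons (DGMod.d_mem _ hf) hx, cycTrace_barLmul hf hx,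
      cycTrace_barCons hf (barDer_mem hx), map_add]
    -- The Koszul signs for the three parts of `barDer (barCons f x)`: f differentiated, ε deleted,
    -- x differentiated.
    have e1 : (((i + 1) * (m - 1)).negOnePow : ℤˣ)
        = - ((i * (m - 1)).negOnePow * m.negOnePow) := by
      rw [← Int.negOnePow_add, ← Int.negOnePow_succ, Int.negOnePow_eq_iff]
      exact ⟨-1, by ring⟩
    have e2 : (i.negOnePow * (i * m).negOnePow : ℤˣ) = (i * (m - 1)).negOnePow := by
      rw [← Int.negOnePow_add, Int.negOnePow_eq_iff]
      exact ⟨i, by ring⟩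
    have e3 : (i.negOnePow * (i * (m + 1 - 1)).negOnePow : ℤˣ) = (i * (m - 1)).negOnePow := by
      rw [← Int.negOnePow_add, Int.negOnePow_eq_iff]
      exact ⟨i, by ring⟩
    simp only [Units.smul_def, map_zsmul, smul_smul, ← Units.val_mul, e1, e2, e3, smul_add]
    simp only [Units.val_neg, neg_smul]
    abel

end

end DGCat

namespace DGCat

variable {k : Type w} [CommRing k] {C : DGCat.{w, u, v} k}

section
open scoped Classical

/-! ### Change of the contractions in the dg quotient -/

/-- The map `f₀ ⊗ ⋯ ⊗ f_m ↦ f₀ e f₁ e ⋯ e f_m`. -/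
noncomputable def barSubst (e : ∀ X : C.Obj, C.Bar X X) {X Y : C.Obj} : C.Bar Y X →ₗ[k] C.Bar Y X :=
  barRec (fun X => barOf [] ∘ₗ (LinearMap.id (M := C.Hom Y X)))
    (fun _ Z => (barLmul.compl₂ (barMul (e Z))).compl₂ (LinearMap.snd k _ _)) X

@[simp] theorem barSubst_nil (e : ∀ X : C.Obj, C.Bar X X) {X Y : C.Obj} (f : C.Hom Y X) :
    barSubst e (barOf [] f) = barOf [] f := by
  rw [barSubst, barRec_nil]; rfl

@[simp] theorem barSubst_barCons (e : ∀ X : C.Obj, C.Bar X X) {X Y Z : C.Obj} (f : C.Hom Z X)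
    (x : C.Bar Y Z) : barSubst e (barCons f x) = barLmul f (barMul (e Z) (barSubst e x)) := by
  rw [barSubst, barRec_cons]; rfl

/-- The map `f₀ ⊗ ⋯ ⊗ f_m ↦ ∑ ± f₀ e ⋯ e f_{i-1} h f_i ⊗ ⋯ ⊗ f_m`. -/
noncomputable def barHomotopy (e h : ∀ X : C.Obj, C.Bar X X) {X Y : C.Obj} :
    C.Bar Y X →ₗ[k] C.Bar Y X :=
  barRec (fun _ => 0)
    (fun X Z => ((barLmul ∘ₗ (C.Hom Z X).sgn).compl₂ (barMul (h Z))).compl₂ (LinearMap.fst k _ _)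
      - ((barLmul ∘ₗ (C.Hom Z X).sgn).compl₂ (barMul (e Z))).compl₂ (LinearMap.snd k _ _)) X

variable {e h : ∀ X : C.Obj, C.Bar X X}

@[simp] theorem barHomotopy_nil {X Y : C.Obj} (f : C.Hom Y X) :
    barHomotopy e h (barOf [] f) = 0 := by
  rw [barHomotopy, barRec_nil]; rfl

@[simp] theorem barHomotopy_barCons {X Y Z : C.Obj} (f : C.Hom Z X)
    (x : C.Bar Y Z) : barHomotopy e h (barCons f x)
      = barLmul ((C.Hom Z X).sgn f) (barMul (h Z) x - barMul (e Z) (barHomotopy e h x)) := by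
  rw [barHomotopy, barRec_cons, map_sub]; rfl

/-- With `barHomotopy_barMul_nil` this is linearity over `C` on both sides, with the sign of an
operator of degree -1. It is what allows the homotopy to descend along the trace. -/
theorem barHomotopy_barLmul {X Y Z : C.Obj} (f : C.Hom Z X) (x : C.Bar Y Z) :
    barHomotopy e h (barLmul f x) = barLmul ((C.Hom Z X).sgn f) (barHomotopy e h x) := by
  induction x using bar_ind with
  | zero => simp
  | add x y hx hy => simp only [map_add, hx, hy]
  | nil g => simp
  | cons g x _ =>
    rw [barLmul_barCons, barHomotopy_barCons, barHomotopy_barCons, barLmul_barLmul, sgnPow_comp]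

theorem barHomotopy_barMul_nil {X Y W : C.Obj} (x : C.Bar Y X) (f : C.Hom W Y) :
    barHomotopy e h (barMul x (barOf [] f)) = barMul (barHomotopy e h x) (barOf [] f) := by
  induction x using bar_ind with
  | zero => simp
  | add x y hx hy => simp only [map_add, LinearMap.add_apply, hx, hy]
  | nil g => simp
  | cons g x ih =>
    rw [barMul_barCons, barHomotopy_barCons, barHomotopy_barCons, ih, barMul_barLmul,
      LinearMap.map_sub₂, barMul_assoc, barMul_assoc]

theorem barHomotopy_mem (he : ∀ X, e X ∈ (C.barGrading X X).gr (-1))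
    (hh : ∀ X, h X ∈ (C.barGrading X X).gr (-2)) {X Y : C.Obj} {n : ℤ} {x : C.Bar Y X}
    (hx : x ∈ (C.barGrading Y X).gr n) : barHomotopy e h x ∈ (C.barGrading Y X).gr (n - 1) := by
  induction x, hx using bar_mem_ind with
  | zero => rw [map_zero]; exact zero_mem _
  | add x y _ _ _ hx hy => rw [map_add]; exact add_mem hx hy
  | smul a x _ _ hx => rw [map_smul]; exact Submodule.smul_mem _ a hx
  | nil f hf => rw [barHomotopy_nil]; exact zero_mem _
  | @cons _ Z i m f x hf hx _ ih =>
    rw [barHomotopy_barCons, show i + m - 1 - 1 = i + (m - 2) by ring]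
    refine barLmul_mem (DGMod.sgn_mem _ hf) (sub_mem ?_ ?_)
    · have := barMul_mem (hh Z) hx
      rwa [show -2 + m = m - 2 by ring] at this
    · have := barMul_mem (he Z) ih
      rwa [show -1 + (m - 1) = m - 2 by ring] at this

variable (C) in
/-- The endomorphism `1 ⊗ 1` of `X` in the dg quotient. -/
noncomputable def barUnit (X : C.Obj) : C.Bar X X := barCons (C.id X) (barOf [] (C.id X))

theorem barMul_barUnit {X Y : C.Obj} (x : C.Bar Y X) :
    barMul (C.barUnit X) x = barCons (C.id X) x := by
  rw [barUnit, barMul_barCons, barMul_nil, barLmul_id]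

theorem barLmul_barUnit {X Y Z : C.Obj} (f : C.Hom Z X) (x : C.Bar Y Z) :
    barLmul f (barMul (C.barUnit Z) x) = barCons f x := by
  rw [barMul_barUnit, barLmul_barCons, C.comp_id]

theorem barUnit_mem (X : C.Obj) : C.barUnit X ∈ (C.barGrading X X).gr (-1) := by
  have := barCons_mem_grading (C.id_mem X) (barOf_nil_mem (C.id_mem X))
  rwa [show (0 : ℤ) + 0 - 1 = -1 by norm_num] at this

theorem barDer_barUnit (X : C.Obj) : barDer (C.barUnit X) = - barOf [] (C.id X) := by
  have : (barOf [] (0 : C.Hom X X) : C.Bar X X) = 0 := map_zero (barOf [])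
  simp [barUnit, C.id_comp, this]

/-- Write S = `barSubst e` and H = `barHomotopy e h`. H is the derivation relative to S on the left
and the identity on the right, H(ab) = H(a) b ± S(a) H(b), which vanishes on `C` and sends ε to h.
Both sides of the identity are derivations of this relative kind; they vanish on `C` and take the
value dh = ε - e at ε. The induction on words carries this out. -/
theorem barDer_barHomotopy (he : ∀ X, e X ∈ (C.barGrading X X).gr (-1))
    (hde : ∀ X, barDer (e X) = - barOf [] (C.id X))
    (hh : ∀ X, h X ∈ (C.barGrading X X).gr (-2))
    (hdh : ∀ X, barDer (h X) = C.barUnit X - e X) {X Y : C.Obj} (x : C.Bar Y X) :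
    barDer (barHomotopy e h x) + barHomotopy e h (barDer x) = x - barSubst e x := by
  have hs1 : ∀ X, barSgn (e X) = - e X := fun X => by
    rw [barSgn_apply (he X)]; simp
  have hs2 : ∀ X, barSgn (h X) = h X := fun X => by
    rw [barSgn_apply (hh X), show (-2 : ℤ) = 2 * (-1) by ring, Int.negOnePow_two_mul, one_smul]
  induction x using bar_ind with
  | zero => simp
  | add x y hx hy => simp only [map_add, add_sub_add_comm, ← hx, ← hy]; abel
  | nil f => simp
  | @cons X Z f x ih =>
    have e1 : barDer (barHomotopy e h x) = x - barSubst e x - barHomotopy e h (barDer x) :=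
      eq_sub_of_add_eq ih
    rw [barHomotopy_barCons, barDer_barLmul, barDer_barCons, barSubst_barCons]
    simp only [map_sub, barHomotopy_barLmul, barDer_barMul, hde, hdh, hs1, hs2, e1,
      barHomotopy_barCons, DGMod.sgn_d, DGMod.sgn_sgn, map_neg, LinearMap.neg_apply, barMul_nil,
      barLmul_id, LinearMap.sub_apply]
    simp only [map_add, map_neg, map_sub, barLmul_barUnit]
    abel

theorem barSubst_mem_barSub {B : Set C.Obj} (he : ∀ X, e X ∈ barSub B X X) {X Y : C.Obj}
    (x : C.Bar Y X) : barSubst e x ∈ barSub B Y X := by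
  induction x using bar_ind with
  | zero => simp
  | add x y hx hy => rw [map_add]; exact add_mem hx hy
  | nil f => rw [barSubst_nil]; exact barOf_nil_mem_barSub f
  | cons f x ih =>
    rw [barSubst_barCons]; exact barLmul_mem_barSub _ (barMul_mem_barSub (he _) ih)

theorem barSubst_eq_self {B : Set C.Obj} (he : ∀ X ∈ B, e X = C.barUnit X) {X Y : C.Obj}
    {x : C.Bar Y X} (hx : x ∈ barSub B Y X) : barSubst e x = x := by
  induction x, hx using barSub_ind with
  | zero => simp
  | add x y _ _ _ hx hy => rw [map_add, hx, hy]
  | smul a x _ _ hx => rw [map_smul, hx]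
  | nil f => exact barSubst_nil e f
  | cons f x hZ _ _ hx => rw [barSubst_barCons, he _ hZ, barLmul_barUnit, hx]

/-! ### Endomorphisms of the cyclic bar complex -/

/-- The map of cyclic bar complexes induced by endomorphisms of the modules of morphisms in the dg
quotient. -/
noncomputable def cycInduce (G : ∀ X : C.Obj, C.Bar X X →ₗ[k] C.Bar X X) : C.Cyc →ₗ[k] C.Cyc :=
  DirectSum.toModule k _ _ fun p => cycTrace p.1 ∘ₗ G p.1 ∘ₗ barCons (C.id p.1) ∘ₗ
    barOf p.2 ∘ₗ signTens p.2

theorem cycInduce_cycOf (G : ∀ X : C.Obj, C.Bar X X →ₗ[k] C.Bar X X) (X : C.Obj) (L : List C.Obj)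
    (s : C.tens X L X) : cycInduce G (cycOf X L s)
      = cycTrace X (G X (barCons (C.id X) (barOf L (signTens L s)))) := by
  rw [cycInduce, cycOf, DirectSum.toModule_lof]; rfl

theorem cycInduce_cycClose (G : ∀ X : C.Obj, C.Bar X X →ₗ[k] C.Bar X X) (X : C.Obj)
    (x : C.Bar X X) : cycInduce G (cycClose X x) = cycTrace X (G X (barCons (C.id X) x)) := by
  induction x using bar_of_ind with
  | zero => simp
  | add x y hx hy => simp only [map_add, hx, hy]
  | of L s => rw [cycClose_barOf, cycInduce_cycOf, signTens_signTens]

/-- `cycTrace_barCons` for the identity, whose degree 0 makes the sign trivial. -/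
theorem cycTrace_barCons_id (X : C.Obj) (x : C.Bar X X) :
    cycTrace X (barCons (C.id X) x) = cycClose X x := by
  have := DGMod.hom_ext (M := C.barGrading X X) (f := cycTrace X ∘ₗ barCons (C.id X))
    (g := cycClose X) (fun n x hx => by
      have := cycTrace_barCons (C.id_mem X) hx
      rw [zero_mul, Int.negOnePow_zero, one_smul] at this
      exact this.trans (congrArg (cycClose X) (barMul_id _)))
  exact LinearMap.congr_fun this x

theorem cycOf_eq_cycTrace (X : C.Obj) (L : List C.Obj) (s : C.tens X L X) :
    cycOf X L s = cycTrace X (barCons (C.id X) (barOf L (signTens L s))) := by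
  rw [cycTrace_barCons_id, cycClose_barOf, signTens_signTens]

/-- `cycInduce` is defined through the representatives ε s only. An arbitrary f ε x has, up to sign,
the same trace as ε x f, and the homotopy commutes with multiplication by f on either side, so the
induced operator is compatible with all traces. -/
theorem cycInduce_barHomotopy_cycTrace (he : ∀ X, e X ∈ (C.barGrading X X).gr (-1))
    (hh : ∀ X, h X ∈ (C.barGrading X X).gr (-2)) (X : C.Obj) (x : C.Bar X X) :
    cycInduce (fun _ => barHomotopy e h) (cycTrace X x) = cycTrace X (barHomotopy e h x) := by
  induction x using bar_hom_cases with
  | zero => simp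
  | add x y hx hy => simp only [map_add, hx, hy]
  | nil f => simp [cycTrace_nil]
  | cons Z i n f x hf hx =>
    have h1 : barCons (C.id Z) (barMul x (barOf [] f))
        = barMul (barCons (C.id Z) x) (barOf [] f) := by rw [barMul_barCons]
    have h2 : barHomotopy e h (barCons f x)
        = i.negOnePow • barLmul f (barHomotopy e h (barCons (C.id Z) x)) := by
      have : barCons f x = barLmul f (barCons (C.id Z) x) := by rw [barLmul_barCons, C.comp_id]
      rw [this, barHomotopy_barLmul, DGMod.sgn_apply _ hf]
      simp [Units.smul_def]
    have h3 : barHomotopy e h (barCons (C.id Z) x) ∈ (C.barGrading X Z).gr (n - 2) := by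
      have := barHomotopy_mem he hh (barCons_mem_grading (C.id_mem Z) hx)
      rwa [show 0 + n - 1 - 1 = n - 2 by ring] at this
    rw [cycTrace_barCons hf hx, Units.smul_def, map_zsmul, cycInduce_cycClose, h1,
      barHomotopy_barMul_nil, h2, Units.smul_def, map_zsmul, cycTrace_barLmul hf h3,
      Units.smul_def, smul_smul, ← Units.val_mul, ← Int.negOnePow_add]
    congr 2
    rw [Int.negOnePow_eq_iff]
    exact ⟨0, by ring⟩

end

end DGCat

/-! ### Deformation retracts from homotopies -/

namespace DGMod

variable {k : Type w} [CommRing k]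

/-- A graded injective map of graded modules reflects homogeneity. -/
theorem mem_gr_of_injective {M : DGMod.{w, v} k} {N : DGMod.{w, v'} k} {σ : N →ₗ[k] M}
    (hσ : Function.Injective σ) (hm : ∀ {n : ℤ} {y : N}, y ∈ N.gr n → σ y ∈ M.gr n) {n : ℤ} {y : N}
    (hy : σ y ∈ M.gr n) : y ∈ N.gr n := by
  classical
  -- The projections onto the parts of degree n, which σ intertwines.
  let P : M →ₗ[k] M := M.homLift fun m => if m = n then (M.gr m).subtype else 0
  let P' : N →ₗ[k] N := N.homLift fun m => if m = n then (N.gr m).subtype else 0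
  have hP' : ∀ x, P' x ∈ N.gr n := by
    intro x
    induction x using hom_ind with
    | zero => simp
    | add x y hx hy => rw [map_add]; exact add_mem hx hy
    | hom m x hx =>
      simp only [P', homLift_apply _ _ hx]
      split_ifs with h
      · exact h ▸ hx
      · simp
  have hPP : P ∘ₗ σ = σ ∘ₗ P' := by
    refine hom_ext fun m x hx => ?_
    simp only [P, P', LinearMap.comp_apply, homLift_apply _ _ hx, homLift_apply _ _ (hm hx)]
    split_ifs <;> simp
  have h1 : P (σ y) = σ y := by
    simp only [P, homLift_apply _ _ hy]
    simp
  have h2 : y = P' y := hσ (h1.symm.trans (LinearMap.congr_fun hPP y))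
  rw [h2]
  exact hP' y

/-- An injective chain map `σ` is the section of a deformation retract if the identity is
homotopic to a map which restricts to the identity on the image of `σ` and takes values there. -/
theorem exists_deformationRetract {M : DGMod.{w, v} k} {N : DGMod.{w, v'} k} (σ : N →ₗ[k] M)
    (hσ : Function.Injective σ) (hm : ∀ {n : ℤ} {y : N}, y ∈ N.gr n → σ y ∈ M.gr n)
    (hd : ∀ y, σ (N.d y) = M.d (σ y)) (h : M →ₗ[k] M)
    (hh : ∀ {n : ℤ} {x : M}, x ∈ M.gr n → h x ∈ M.gr (n - 1))
    (hr : ∀ x, x - (M.d (h x) + h (M.d x)) ∈ LinearMap.range σ)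
    (hf : ∀ y, M.d (h (σ y)) + h (M.d (σ y)) = 0) :
    ∃ R : DeformationRetract M N, R.σ = σ := by
  let p : M →ₗ[k] M := LinearMap.id - (M.d ∘ₗ h + h ∘ₗ M.d)
  have hp : ∀ x, p x = x - (M.d (h x) + h (M.d x)) := fun _ => rfl
  have hpσ : ∀ y, p (σ y) = σ y := fun y => by rw [hp, hf, sub_zero]
  have hpr : ∀ x, p x ∈ LinearMap.range σ := hr
  let π : M →ₗ[k] N := (LinearEquiv.ofInjective σ hσ).symm.toLinearMap ∘ₗ
    p.codRestrict (LinearMap.range σ) hpr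
  have hπ : ∀ x, σ (π x) = p x := fun x =>
    congrArg Subtype.val ((LinearEquiv.ofInjective σ hσ).apply_symm_apply ⟨p x, hpr x⟩)
  have hpp : ∀ x, p (p x) = p x := fun x => by
    obtain ⟨y, hy⟩ := hpr x
    rw [← hy, hpσ]
  have hpm : ∀ {n : ℤ} {x : M}, x ∈ M.gr n → p x ∈ M.gr n := by
    intro n x hx
    rw [hp]
    refine sub_mem hx (add_mem ?_ ?_)
    · simpa using M.d_mem (hh hx)
    · simpa using hh (M.d_mem hx)
  have hpd : ∀ x, p (M.d x) = M.d (p x) := fun x => by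
    simp only [hp, M.d_d, map_sub, map_add, map_zero, add_zero, zero_add]
  -- p is an idempotent chain map onto the image of σ. Conjugating h by the complementary idempotent
  -- q enforces the side conditions, since q σ = 0 and π q = 0, and the homotopy relation survives:
  -- d(qhq) + (qhq)d = q(dh + hd)q = q³ = q.
  let q : M →ₗ[k] M := LinearMap.id - p
  have hq : ∀ x, q x = x - p x := fun _ => rfl
  have hqσ : ∀ y, q (σ y) = 0 := fun y => by rw [hq, hpσ, sub_self]
  have hπq : ∀ x, π (q x) = 0 := fun x => hσ (by rw [hπ, hq, map_sub, hpp, sub_self, map_zero])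
  have hqd : ∀ x, q (M.d x) = M.d (q x) := fun x => by simp only [hq, hpd, map_sub]
  have hqq : ∀ x, q (q x) = q x := fun x => by
    rw [hq (q x), hq x, map_sub, hpp, sub_self, sub_zero]
  have hqm : ∀ {n : ℤ} {x : M}, x ∈ M.gr n → q x ∈ M.gr n := fun hx => sub_mem hx (hpm hx)
  have hdh : ∀ x, M.d (h x) + h (M.d x) = q x := fun x => by rw [hq, hp, sub_sub_cancel]
  exact ⟨{
    π := π
    σ := σ
    h := q ∘ₗ h ∘ₗ q
    π_mem := fun hx => mem_gr_of_injective hσ hm (by rw [hπ]; exact hpm hx)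
    σ_mem := hm
    h_mem := fun hx => hqm (hh (hqm hx))
    π_d := fun x => hσ (by rw [hπ, hd, hπ, hpd])
    σ_d := hd
    π_σ := fun y => hσ (by rw [hπ, hpσ])
    d_h := fun x => by
      simp only [LinearMap.comp_apply]
      rw [← hqd, hqd x, ← map_add, hdh, hqq, hqq, hπ, hq]
    h_σ := fun y => by simp only [LinearMap.comp_apply, hqσ, map_zero]
    π_h := fun x => hπq _ }, rfl⟩

end DGMod

/-! ### From contractions in the dg quotient to a homotopy of the cyclic bar complex -/

namespace DGCat

variable {k : Type w} [CommRing k] {C : DGCat.{w, u, v} k}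

section
open scoped Classical

/-- The span of the summands of the cyclic bar complex with indices in `W`. -/
noncomputable def cycSub (W : Set (C.Obj × List C.Obj)) : Submodule k C.Cyc :=
  Submodule.span k {x | ∃ (X : C.Obj) (L : List C.Obj) (s : C.tens X L X), (X, L) ∈ W ∧
    x = cycOf X L s}

/-- The cyclic words in the objects of `B`. -/
def wordsIn (B : Set C.Obj) : Set (C.Obj × List C.Obj) := {p | p.1 ∈ B ∧ ∀ Z ∈ p.2, Z ∈ B}

variable {B : Set C.Obj}

theorem cycOf_mem_cycSub {W : Set (C.Obj × List C.Obj)} {X : C.Obj} {L : List C.Obj}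
    (hW : (X, L) ∈ W) (s : C.tens X L X) : cycOf X L s ∈ cycSub W :=
  Submodule.subset_span ⟨X, L, s, hW, rfl⟩

theorem cycRot_mem_cycSub {X : C.Obj} {L : List C.Obj} (hL : ∀ Z ∈ L, Z ∈ B) (s : C.tens X L X) :
    cycRot X L s ∈ cycSub (wordsIn B) := by
  cases L with
  | nil => rw [cycRot_nil]; exact zero_mem _
  | cons Z L =>
    rw [List.forall_mem_cons] at hL
    exact cycOf_mem_cycSub hL _

/-- Closing up composes the last factor with the first at X, so X disappears from the word and only
the intermediate objects remain. This is why traces over an X outside `B` still give words over `B`.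
-/
theorem cycTrace_mem_cycSub {X : C.Obj} {x : C.Bar X X} (hx : x ∈ barSub B X X) :
    cycTrace X x ∈ cycSub (wordsIn B) := by
  induction hx using Submodule.span_induction with
  | zero => simp
  | add x y _ _ hx hy => rw [map_add]; exact add_mem hx hy
  | smul a x _ hx => rw [map_smul]; exact Submodule.smul_mem _ _ hx
  | mem x hx =>
    obtain ⟨L, s, hL, rfl⟩ := hx
    rw [cycTrace_barOf]
    exact cycRot_mem_cycSub hL _

/-- One factor is absorbed, so the translate Σ^m becomes Σ^(m-1) and the degree rises by 1. -/
theorem cycTrace_mem {X : C.Obj} {n : ℤ} {x : C.Bar X X} (hx : x ∈ (C.barGrading X X).gr n) :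
    cycTrace X x ∈ C.cycInt.gr (n + 1) := by
  rw [← DirectSum.sum_support_of x, map_sum]
  refine sum_mem fun L _ => ?_
  have hL : x L ∈ (C.tens X L X).gr (n + L.length) := hx L
  change cycTrace X (barOf L (x L)) ∈ _
  rw [cycTrace_barOf]
  generalize x L = s at hL
  cases L with
  | nil => rw [cycRot_nil]; exact zero_mem _
  | cons Z L =>
    refine cycOf_mem ?_
    rw [show n + 1 + (L.length : ℤ) = n + ((Z :: L).length : ℤ) by
      push_cast [List.length_cons]; ring]
    exact rot_mem L (signTens_mem _ hL)

theorem cyc_ind {p : C.Cyc → Prop} (zero : p 0) (add : ∀ x y, p x → p y → p (x + y))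
    (of : ∀ X L s, p (cycOf X L s)) (x : C.Cyc) : p x :=
  DirectSum.induction_on x zero (fun q s => of q.1 q.2 s) add

theorem cyc_mem_map {M : Type t} [AddCommGroup M] [Module k M] (S : Submodule k M)
    (h : C.Cyc →ₗ[k] M)
    {n : ℤ} (hS : ∀ X L s, s ∈ (C.tens X L X).gr (n + L.length) → h (cycOf X L s) ∈ S) {x : C.Cyc}
    (hx : x ∈ C.cycInt.gr n) : h x ∈ S := by
  rw [← DirectSum.sum_support_of x, map_sum]
  exact sum_mem fun p _ => hS p.1 p.2 _ (hx p)

/-- All cyclic words are traces, so the homotopy between the identity of the dg quotient and the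
substitution ε ↦ e descends. The substitution has values over `B`, and is the identity over `B`
because e = ε there. -/
theorem exists_homotopy_of_contractions {e : ∀ X : C.Obj, C.Bar X X}
    (he : ∀ X, e X ∈ (C.barGrading X X).gr (-1)) (hde : ∀ X, barDer (e X) = - barOf [] (C.id X))
    (heB : ∀ X, e X ∈ barSub B X X) (he' : ∀ X ∈ B, e X = C.barUnit X) :
    ∃ h : C.Cyc →ₗ[k] C.Cyc,
      (∀ {n : ℤ} {x : C.Cyc}, x ∈ C.cycInt.gr n → h x ∈ C.cycInt.gr (n - 1)) ∧
      (∀ x, x - (C.cycDiff (h x) + h (C.cycDiff x)) ∈ cycSub (wordsIn B)) ∧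
      ∀ x ∈ cycSub (wordsIn B), C.cycDiff (h x) + h (C.cycDiff x) = 0 := by
  -- η = -eε, so dη = -(de)ε + e(dε) = ε - e.
  let η : ∀ X : C.Obj, C.Bar X X := fun X => - barMul (e X) (C.barUnit X)
  have hη : ∀ X, η X ∈ (C.barGrading X X).gr (-2) := fun X =>
    neg_mem (barMul_mem (he X) (barUnit_mem X))
  have hdη : ∀ X, barDer (η X) = C.barUnit X - e X := fun X => by
    have h1 : barSgn (e X) = - e X := by rw [barSgn_apply (he X)]; simp
    simp only [η, map_neg, barDer_barMul, hde, barDer_barUnit, h1, LinearMap.neg_apply, barMul_nil,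
      barLmul_id, neg_neg, barMul_id]
    abel
  have key : ∀ X (x : C.Bar X X),
      C.cycDiff (- cycInduce (fun _ => barHomotopy e η) (cycTrace X x))
        + (- cycInduce (fun _ => barHomotopy e η) (C.cycDiff (cycTrace X x)))
        = cycTrace X x - cycTrace X (barSubst e x) := by
    intro X x
    rw [cycInduce_barHomotopy_cycTrace he hη, map_neg, cycDiff_cycTrace, cycDiff_cycTrace, map_neg,
      cycInduce_barHomotopy_cycTrace he hη, neg_neg, neg_neg, ← map_add,
      barDer_barHomotopy he hde hη hdη, map_sub]
  -- The minus sign compensates for the trace anticommuting with the differentials.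
  refine ⟨- cycInduce fun _ => barHomotopy e η, ?_, ?_, ?_⟩
  · intro n x hx
    refine cyc_mem_map _ _ (fun X L s hs => ?_) hx
    refine Submodule.neg_mem (C.cycInt.gr (n - 1))
      (x := cycInduce (fun _ => barHomotopy e η) (cycOf X L s)) ?_
    rw [cycInduce_cycOf]
    have := cycTrace_mem (barHomotopy_mem he hη
      (barCons_mem_grading (C.id_mem X) (barOf_mem (signTens_mem L hs))))
    rwa [show 0 + n - 1 - 1 + 1 = n - 1 by ring] at this
  · intro x
    induction x using cyc_ind with
    | zero => simp
    | add x y hx hy =>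
      convert add_mem hx hy using 1
      simp only [map_add]
      abel
    | of X L s =>
      rw [cycOf_eq_cycTrace]
      simp only [LinearMap.neg_apply]
      rw [key, sub_sub_cancel]
      exact cycTrace_mem_cycSub (barSubst_mem_barSub heB _)
  · intro x hx
    induction hx using Submodule.span_induction with
    | zero => simp
    | add x y _ _ hx hy =>
      simp only [map_add]
      rw [add_add_add_comm, hx, hy, add_zero]
    | smul a x _ hx => simp only [map_smul, ← smul_add, hx, smul_zero]
    | mem x hx =>
      obtain ⟨X, L, s, hW, rfl⟩ := hx
      rw [cycOf_eq_cycTrace]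
      simp only [LinearMap.neg_apply]
      rw [key, barSubst_eq_self he', sub_self]
      exact barCons_mem_barSub hW.1 _ (barOf_mem_barSub hW.2 _)

end

end DGCat

namespace DGCat

variable {k : Type w} [CommRing k] {C : DGCat.{w, u, v} k} {D : DGCat.{w, u', v'} k}

section
open scoped Classical

/-! ### Functoriality of the cyclic bar complex -/

section Functor

variable (F : DGFunctor D C)

@[simp] theorem tensMap_cons {X Y Z : D.Obj} (L : List D.Obj) (f : D.Hom Z X) (s : D.tens Y L Z) :
    tensMap F (Z :: L) (cons f s) = (cons (F.map f) (tensMap F L s) :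
      C.tens (F.obj Y) (F.obj Z :: L.map F.obj) (F.obj X)) := by
  simp only [tensMap, consLift_cons, LinearMap.compl₁₂_apply]

theorem tensMap_mem {Y : D.Obj} : ∀ (L : List D.Obj) {X : D.Obj} {n : ℤ} {s : D.tens Y L X},
    s ∈ (D.tens Y L X).gr n →
      tensMap F L s ∈ (C.tens (F.obj Y) (L.map F.obj) (F.obj X)).gr n
  | [], _, _, _, h => F.map_mem h
  | Z :: L, X, n, s, h => by
    induction s, h using cons_mem_ind with
    | zero => rw [map_zero]; exact zero_mem _
    | add x y _ _ _ hx hy => rw [map_add]; exact add_mem hx hy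
    | smul a x _ _ hx => rw [map_smul]; exact Submodule.smul_mem _ _ hx
    | hom i j f s hij hf hs =>
      rw [tensMap_cons, ← hij]
      exact cons_mem (F.map_mem hf) (tensMap_mem L hs)

theorem tensMap_d {Y : D.Obj} : ∀ (L : List D.Obj) {X : D.Obj} (s : D.tens Y L X),
    tensMap F L ((D.tens Y L X).d s)
      = (C.tens (F.obj Y) (L.map F.obj) (F.obj X)).d (tensMap F L s)
  | [], _, s => F.map_d s
  | Z :: L, X, s => by
    induction s using cons_hom_ind with
    | zero => simp only [map_zero]
    | add x y hx hy => simp only [map_add, hx, hy]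
    | hom i j f s hf hs =>
      rw [d_cons _ hf, map_add, tensMap_cons, Units.smul_def, map_zsmul, tensMap_cons, tensMap_cons,
        tensMap_d L s, F.map_d]
      exact (d_cons _ (F.map_mem hf)).symm

theorem tensMap_lmul {X Y Z : D.Obj} (f : D.Hom Z X) : ∀ (L : List D.Obj) (s : D.tens Y L Z),
    tensMap F L (lmul L f s) = lmul (L.map F.obj) (F.map f) (tensMap F L s)
  | [], s => F.map_comp f s
  | W :: L, s => by
    induction s using cons_ind with
    | zero => simp only [map_zero]
    | add x y hx hy => simp only [map_add, hx, hy]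
    | cons g s =>
      rw [lmul_cons, tensMap_cons, tensMap_cons, F.map_comp]
      exact (lmul_cons _ _ _ _).symm

theorem tensMap_rmul {Y Y' : D.Obj} (g : D.Hom Y' Y) : ∀ (L : List D.Obj) {X : D.Obj}
    (s : D.tens Y L X),
    tensMap F L (rmul L s g) = rmul (L.map F.obj) (tensMap F L s) (F.map g)
  | [], _, s => F.map_comp s g
  | W :: L, _, s => by
    induction s using cons_ind with
    | zero => simp only [map_zero, LinearMap.zero_apply]
    | add x y hx hy => simp only [map_add, hx, hy, LinearMap.add_apply]
    | cons f s =>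
      rw [rmul_cons, tensMap_cons, tensMap_cons, tensMap_rmul g L s]
      exact (rmul_cons _ _ _ _).symm

/-- The map induced by a dg functor on the sums of tensor products. -/
noncomputable def barMap (Y X : D.Obj) : D.Bar Y X →ₗ[k] C.Bar (F.obj Y) (F.obj X) :=
  DirectSum.toModule k _ _ fun L => barOf (L.map F.obj) ∘ₗ tensMap F L

theorem barMap_barOf {X Y : D.Obj} (L : List D.Obj) (s : D.tens Y L X) :
    barMap F Y X (barOf L s) = barOf (L.map F.obj) (tensMap F L s) := by
  rw [barMap, barOf, DirectSum.toModule_lof]; rfl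

theorem barMap_barCons {X Y Z : D.Obj} (f : D.Hom Z X) (x : D.Bar Y Z) :
    barMap F Y X (barCons f x) = barCons (F.map f) (barMap F Y Z x) := by
  induction x using bar_of_ind with
  | zero => simp
  | add x y hx hy => simp only [map_add, hx, hy]
  | of L s =>
    rw [barCons_barOf, barMap_barOf, barMap_barOf, tensMap_cons, barCons_barOf]
    rfl

theorem barMap_barD {Y : D.Obj} : ∀ (L : List D.Obj) {X : D.Obj} (s : D.tens Y L X),
    barMap F Y X (barD L s) = barD (L.map F.obj) (tensMap F L s)
  | [], _, _ => by rw [barD_nil, map_zero]; rfl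
  | Z :: L, X, s => by
    induction s using cons_ind with
    | zero => simp only [map_zero]
    | add x y hx hy => simp only [map_add, hx, hy]
    | cons f s =>
      have h := barMap_barOf F L (lmul L f s)
      rw [tensMap_lmul] at h
      rw [barD_cons, map_sub, map_neg, barMap_barCons, barMap_barD L s, tensMap_cons]
      refine Eq.trans ?_ (barD_cons _ _ _).symm
      exact congrArg (fun x => - x - _) h

theorem tensMap_rot {X Z : D.Obj} (L : List D.Obj) (s : D.tens X (Z :: L) X) :
    tensMap F L (rot L s) = rot (L.map F.obj) (tensMap F (Z :: L) s) := by
  induction s using cons_hom_ind with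
  | zero => simp only [map_zero]
  | add x y hx hy => simp only [map_add, hx, hy]
  | hom i j f s hf hs =>
    rw [rot_cons L hf hs, Units.smul_def, map_zsmul, tensMap_rmul, tensMap_cons]
    refine Eq.trans ?_ (rot_cons _ (F.map_mem hf) (tensMap_mem F L hs)).symm
    rw [Units.smul_def]

/-- The map of cyclic bar complexes induced by a dg functor. -/
noncomputable def cycMap : D.Cyc →ₗ[k] C.Cyc := cyclicBarMap F

theorem cycMap_cycOf (X : D.Obj) (L : List D.Obj) (s : D.tens X L X) :
    cycMap F (cycOf X L s) = cycOf (F.obj X) (L.map F.obj) (tensMap F L s) := by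
  have := DirectSum.toModule_lof (R := k) (φ := fun p : D.Obj × List D.Obj =>
    cycOf (F.obj p.1) (p.2.map F.obj) ∘ₗ tensMap F p.2) (X, L) s
  exact this

theorem cycMap_cycIncl (X : D.Obj) (x : D.Bar X X) :
    cycMap F (cycIncl X x) = cycIncl (F.obj X) (barMap F X X x) := by
  induction x using bar_of_ind with
  | zero => simp
  | add x y hx hy => simp only [map_add, hx, hy]
  | of L s =>
    rw [barMap_barOf]
    refine ((congrArg _ (cycIncl_lof X L s)).trans (cycMap_cycOf F X L s)).trans ?_
    exact (cycIncl_lof (F.obj X) _ _).symm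

theorem cycMap_cycRot (X : D.Obj) (L : List D.Obj) (s : D.tens X L X) :
    cycMap F (cycRot X L s) = cycRot (F.obj X) (L.map F.obj) (tensMap F L s) := by
  cases L with
  | nil => rw [cycRot_nil, map_zero]; rfl
  | cons Z L =>
    simp only [cycRot, LinearMap.comp_apply]
    rw [cycMap_cycOf, tensMap_rot]
    rfl

theorem cycMap_cycDiff (x : D.Cyc) : cycMap F (D.cycDiff x) = C.cycDiff (cycMap F x) := by
  induction x using cyc_ind with
  | zero => simp
  | add x y hx hy => simp only [map_add, hx, hy]
  | of X L s =>
    rw [cycDiff, cycDiff, LinearMap.add_apply, LinearMap.add_apply, cycMap_cycOf, cycD_cycOf,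
      cycD_cycOf, cycDelta_cycOf, cycDelta_cycOf, map_add, map_add, cycMap_cycIncl, barMap_barD,
      cycMap_cycRot, Units.smul_def, map_zsmul, cycMap_cycOf, tensMap_d, List.length_map,
      Units.smul_def]

theorem cycMap_mem {n : ℤ} {x : D.Cyc} (hx : x ∈ D.cycInt.gr n) : cycMap F x ∈ C.cycInt.gr n := by
  refine cyc_mem_map _ _ (fun X L s hs => ?_) hx
  refine (congrArg (· ∈ C.cycInt.gr n) (cycMap_cycOf F X L s)).mpr (cycOf_mem ?_)
  rw [List.length_map]
  exact tensMap_mem F L hs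

/-- The component of a cyclic word. -/
noncomputable def cycProj (p : C.Obj × List C.Obj) : C.Cyc →ₗ[k] C.tens p.1 p.2 p.1 :=
  DirectSum.component k _ (fun p : C.Obj × List C.Obj => (C.tens p.1 p.2 p.1).carrier) p

theorem cycProj_cycOf_self (X : C.Obj) (L : List C.Obj) (s : C.tens X L X) :
    cycProj (X, L) (cycOf X L s) = s :=
  DirectSum.of_eq_same (β := fun p : C.Obj × List C.Obj => (C.tens p.1 p.2 p.1).carrier) (X, L) s

theorem cycProj_cycOf_of_ne {p : C.Obj × List C.Obj} {X : C.Obj} {L : List C.Obj} (h : p ≠ (X, L))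
    (s : C.tens X L X) : cycProj p (cycOf X L s) = 0 :=
  DirectSum.of_eq_of_ne (β := fun p : C.Obj × List C.Obj => (C.tens p.1 p.2 p.1).carrier) _ _ s h

/-- Injectivity on objects keeps distinct cyclic words in distinct summands, so injectivity can be
tested on components. -/
theorem cycMap_injective (hobj : Function.Injective F.obj)
    (hF : ∀ (L : List D.Obj) (X Y : D.Obj), Function.Injective (tensMap F L (X := X) (Y := Y))) :
    Function.Injective (cycMap F) := by
  rw [injective_iff_map_eq_zero]
  intro x hx
  have key : ∀ (p : D.Obj × List D.Obj) (x : D.Cyc),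
      cycProj (F.obj p.1, p.2.map F.obj) (cycMap F x) = tensMap F p.2 (cycProj p x) := by
    rintro ⟨X, L⟩ x
    induction x using cyc_ind with
    | zero => simp only [map_zero]
    | add x y hx hy => simp only [map_add, hx, hy]
    | of X' L' s =>
      rw [cycMap_cycOf]
      by_cases h : (X, L) = (X', L')
      · obtain ⟨rfl, rfl⟩ := Prod.mk.inj h
        exact (cycProj_cycOf_self _ _ _).trans
          (congrArg (tensMap F L) (cycProj_cycOf_self X L s)).symm
      · rw [cycProj_cycOf_of_ne h, map_zero]
        refine cycProj_cycOf_of_ne (fun h' => h ?_) _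
        obtain ⟨h1, h2⟩ := Prod.mk.inj h'
        exact Prod.ext (hobj h1) (List.map_injective_iff.mpr hobj h2)
  refine DFinsupp.ext fun p => hF p.2 p.1 p.1 ?_
  have := key p x
  rw [hx, map_zero] at this
  exact this.symm.trans (map_zero _).symm

end Functor

/-- Fullness makes each factor an isomorphism, so the tensor product is one without any flatness
over `k`. -/
theorem tensMap_fullIncl_bijective (B : Set C.Obj) {Y : (C.full B).Obj} :
    ∀ (L : List (C.full B).Obj) (X : (C.full B).Obj),
    Function.Bijective (tensMap (C.fullIncl B) L (X := X) (Y := Y))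
  | [], _ => Function.bijective_id
  | Z :: L, X => by
    have h := tensMap_fullIncl_bijective B L Z (Y := Y)
    have e : ⇑(tensMap (C.fullIncl B) (Z :: L) (X := X) (Y := Y))
        = TensorProduct.map (LinearMap.id (R := k) (M := C.Hom Z.1 X.1))
          (tensMap (C.fullIncl B) L (X := Z) (Y := Y)) := by
      have : (tensMap (C.fullIncl B) (Z :: L) (X := X) (Y := Y))
        = TensorProduct.map (LinearMap.id (R := k) (M := C.Hom Z.1 X.1))
          (tensMap (C.fullIncl B) L (X := Z) (Y := Y)) := TensorProduct.ext' fun f s =>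
            tensMap_cons (C.fullIncl B) L f s
      exact congrArg _ this
    rw [e]
    exact (TensorProduct.congr (LinearEquiv.refl k (C.Hom Z.1 X.1))
      (LinearEquiv.ofBijective _ h)).bijective

theorem cycMap_fullIncl_injective (B : Set C.Obj) : Function.Injective (cycMap (C.fullIncl B)) :=
  cycMap_injective _ Subtype.val_injective fun L X _ => (tensMap_fullIncl_bijective B L X).1

theorem range_cycMap_fullIncl (B : Set C.Obj) :
    LinearMap.range (cycMap (C.fullIncl B)) = cycSub (wordsIn B) := by
  apply le_antisymm
  · rintro _ ⟨x, rfl⟩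
    induction x using cyc_ind with
    | zero => simp
    | add x y hx hy => rw [map_add]; exact add_mem hx hy
    | of X L s =>
      rw [cycMap_cycOf]
      refine cycOf_mem_cycSub (And.intro X.2 fun Z hZ => ?_) _
      obtain ⟨Z, -, rfl⟩ := List.mem_map.mp hZ
      exact Z.2
  · refine Submodule.span_le.mpr ?_
    rintro _ ⟨X, L, s, ⟨hX, hL⟩, rfl⟩
    obtain ⟨L, rfl⟩ : ∃ L' : List B, L'.map Subtype.val = L :=
      ⟨L.pmap Subtype.mk hL, by simp [List.map_pmap]⟩
    let X' : (C.full B).Obj := ⟨X, hX⟩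
    obtain ⟨s, rfl⟩ := (tensMap_fullIncl_bijective B (Y := X') L X').2 s
    exact ⟨cycOf (C := C.full B) X' L s, cycMap_cycOf _ _ _ _⟩

end

end DGCat

namespace DGCat

variable {k : Type w} [CommRing k] {C : DGCat.{w, u, v} k}

section
open scoped Classical

/-! ### Generation -/

/-- The restriction of a representable functor along a dg functor. -/
noncomputable def corep {D : DGCat.{w, u', v'} k} (F : DGFunctor C D) (Y : D.Obj) :
    DGFunctorToMod.{w, u, v, v'} C where
  obj X := D.Hom Y (F.obj X)
  map := D.comp ∘ₗ F.map
  map_mem hf hx := D.comp_mem (F.map_mem hf) hx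
  map_d {X Y' n f} x hf := by
    simp only [LinearMap.comp_apply]
    rw [D.leibniz _ (F.map_mem hf), F.map_d, add_sub_cancel_right]
  map_id X x := by simp only [LinearMap.comp_apply, F.map_id, D.id_comp]
  map_comp g f x := by simp only [LinearMap.comp_apply, F.map_comp, D.assoc]

/-- An object is contractible if its identity is null-homotopic. -/
def IsContractible (D : DGCat.{w, u, v} k) (X : D.Obj) : Prop :=
  ∃ e ∈ (D.Hom X X).gr (-1), (D.Hom X X).d e = D.id X

/-- Only a sign changes: the convention is dε = -1 in the quotient, but de = 1 in `IsContractible`.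
-/
theorem isContractible_dgQuotBy_iff {B : Set C.Obj} {X : C.Obj} :
    (C.dgQuotBy B).IsContractible X ↔
      ∃ e : C.Bar X X, e ∈ (C.barGrading X X).gr (-1) ∧ e ∈ barSub B X X ∧
        barDer e = - barOf [] (C.id X) := by
  constructor
  · rintro ⟨e, he, hd⟩
    refine ⟨- e.1, neg_mem he, neg_mem e.2, ?_⟩
    exact (map_neg barDer _).trans (congrArg (- ·) (congrArg Subtype.val hd))
  · rintro ⟨e, he, heB, hd⟩
    refine ⟨⟨- e, neg_mem heB⟩, neg_mem he, Subtype.ext ?_⟩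
    exact (map_neg barDer _).trans ((congrArg (- ·) hd).trans (neg_neg _))

theorem isContractible_dgQuotBy_of_mem {B : Set C.Obj} {X : C.Obj} (hX : X ∈ B) :
    (C.dgQuotBy B).IsContractible X :=
  isContractible_dgQuotBy_iff.mpr ⟨C.barUnit X, barUnit_mem X,
    barCons_mem_barSub hX _ (barOf_nil_mem_barSub _), barDer_barUnit X⟩

theorem contractible_hom_of_isContractible {D : DGCat.{w, u, v} k} {X : D.Obj}
    (hX : D.IsContractible X) (Y : D.Obj) : (D.Hom Y X).Contractible := by
  obtain ⟨e, he, hd⟩ := hX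
  refine ⟨D.comp e, fun n x hx => ?_, fun x => ?_⟩
  · have := D.comp_mem he hx
    rwa [neg_add_eq_sub] at this
  · rw [D.leibniz _ he, hd, D.id_comp]
    simp

theorem isContractible_of_contractible_hom {D : DGCat.{w, u, v} k} {X : D.Obj}
    (hX : (D.Hom X X).Contractible) : D.IsContractible X := by
  obtain ⟨h, hm, hd⟩ := hX
  refine ⟨h (D.id X), by simpa using hm 0 _ (D.id_mem X), ?_⟩
  have := hd (D.id X)
  rwa [d_id, map_zero, add_zero] at this

/-- The test functor sends Y to the morphisms from X to Y in the quotient. For Y in `B`, composition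
with the null-homotopy of Y contracts its value, so generation contracts the endomorphisms of X;
applying the contraction to the identity of X gives the null-homotopy. -/
theorem Generates.isContractible {B : Set C.Obj} (hB : C.Generates B) (X : C.Obj) :
    (C.dgQuotBy B).IsContractible X :=
  isContractible_of_contractible_hom (hB (corep (C.toDGQuotBy B) X)
    (fun _ hY => contractible_hom_of_isContractible (isContractible_dgQuotBy_of_mem hY) X) X)

/-- On `B` the contraction must be ε itself, so that words over `B` are fixed; elsewhere any choice
will do. -/
theorem exists_homotopy_of_isContractible {B : Set C.Obj}
    (hB : ∀ X : C.Obj, (C.dgQuotBy B).IsContractible X) :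
    ∃ h : C.Cyc →ₗ[k] C.Cyc,
      (∀ {n : ℤ} {x : C.Cyc}, x ∈ C.cycInt.gr n → h x ∈ C.cycInt.gr (n - 1)) ∧
      (∀ x, x - (C.cycDiff (h x) + h (C.cycDiff x)) ∈ cycSub (wordsIn B)) ∧
      ∀ x ∈ cycSub (wordsIn B), C.cycDiff (h x) + h (C.cycDiff x) = 0 := by
  have : ∀ X, ∃ e : C.Bar X X, e ∈ (C.barGrading X X).gr (-1) ∧ e ∈ barSub B X X ∧
      barDer e = - barOf [] (C.id X) ∧ (X ∈ B → e = C.barUnit X) := by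
    intro X
    by_cases hX : X ∈ B
    · exact ⟨C.barUnit X, barUnit_mem X, barCons_mem_barSub hX _ (barOf_nil_mem_barSub _),
        barDer_barUnit X, fun _ => rfl⟩
    · obtain ⟨e, he, heB, hde⟩ := isContractible_dgQuotBy_iff.mp (hB X)
      exact ⟨e, he, heB, hde, fun h => absurd h hX⟩
  choose e he heB hde he' using this
  exact exists_homotopy_of_contractions he hde heB he'

theorem exists_deformationRetract_of_generates (B : Set C.Obj) (hB : C.Generates B) :
    ∃ R : DGMod.DeformationRetract C.cyclicBar (C.full B).cyclicBar,
      R.σ = cyclicBarMap (C.fullIncl B) := by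
  obtain ⟨h, hm, hr, hf⟩ := exists_homotopy_of_isContractible hB.isContractible
  have hσ := range_cycMap_fullIncl B
  refine DGMod.exists_deformationRetract (M := C.cyclicBar) (N := (C.full B).cyclicBar)
    (cyclicBarMap (C.fullIncl B)) (cycMap_fullIncl_injective B) (cycMap_mem (C.fullIncl B))
    (cycMap_cycDiff (C.fullIncl B)) h hm (fun x => ?_) (fun y => ?_)
  · have := hr x
    rw [← hσ] at this
    exact this
  · refine hf _ ?_
    rw [← hσ]
    exact ⟨y, rfl⟩

end

end DGCat

namespace DGCat

variable {k : Type w} [CommRing k] {C : DGCat.{w, u, v} k} {D : DGCat.{w, u', v'} k}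

/-! ### Twisted complexes of contractible objects -/

/-- The entries of a matrix of morphisms. -/
def suspEntry {X Y : C.susp.Obj} (i : Fin X.n) (j : Fin Y.n) :
    C.susp.Hom X Y →ₗ[k] C.Hom (X.obj i) (Y.obj j) :=
  LinearMap.proj (φ := fun j => (C.Hom (X.obj i) (Y.obj j)).carrier) j ∘ₗ
    LinearMap.proj (φ := fun i => ∀ j, (C.Hom (X.obj i) (Y.obj j)).carrier) i

theorem susp_hom_ext {X Y : C.susp.Obj} {f g : C.susp.Hom X Y}
    (h : ∀ i j, suspEntry i j f = suspEntry i j g) : f = g :=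
  funext fun i => funext fun j => h i j

theorem suspEntry_d {X Y : C.susp.Obj} (f : C.susp.Hom X Y) (i : Fin X.n) (j : Fin Y.n) :
    suspEntry i j ((C.susp.Hom X Y).d f)
      = (Y.shift j).negOnePow • (C.Hom (X.obj i) (Y.obj j)).d (suspEntry i j f) := rfl

theorem suspEntry_comp {X Y Z : C.susp.Obj} (g : C.susp.Hom Y Z) (f : C.susp.Hom X Y)
    (i : Fin X.n) (l : Fin Z.n) : suspEntry i l (C.susp.comp g f)
      = ∑ j, C.comp (suspEntry j l g) (suspEntry i j f) := rfl

theorem suspEntry_id_self (X : C.susp.Obj) (i : Fin X.n) :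
    suspEntry i i (C.susp.id X) = C.id (X.obj i) := dif_pos rfl

theorem suspEntry_id_of_ne (X : C.susp.Obj) {i j : Fin X.n} (h : i ≠ j) :
    suspEntry i j (C.susp.id X) = 0 := dif_neg h

/-- The extension of a dg functor to the additive suspended envelopes. -/
def suspMap (F : DGFunctor C D) : DGFunctor C.susp D.susp where
  obj X := ⟨X.n, X.shift, fun i => F.obj (X.obj i)⟩
  map {X Y} := LinearMap.pi fun i => LinearMap.pi fun j => F.map ∘ₗ
    suspEntry (C := C) (X := X) (Y := Y) i j
  map_mem hf i j := F.map_mem (hf i j)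
  map_d {X Y} f := by
    refine susp_hom_ext fun i j => ?_
    refine Eq.trans ?_ (suspEntry_d _ i j).symm
    change F.map (suspEntry (C := C) i j ((C.susp.Hom X Y).d f))
      = (Y.shift j).negOnePow • (D.Hom _ _).d (F.map (suspEntry (C := C) i j f))
    rw [suspEntry_d, Units.smul_def, map_zsmul, F.map_d, Units.smul_def]
  map_id X := by
    refine susp_hom_ext fun i j => ?_
    change F.map (suspEntry (C := C) i j (C.susp.id X)) = _
    by_cases h : i = j
    · subst h
      rw [suspEntry_id_self, F.map_id]
      exact (suspEntry_id_self _ i).symm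
    · exact ((congrArg F.map (suspEntry_id_of_ne (C := C) X h)).trans (map_zero _)).trans
        (suspEntry_id_of_ne (C := D) _ h).symm
  map_comp {X Y Z} g f := by
    refine susp_hom_ext fun i l => ?_
    change F.map (suspEntry (C := C) i l (C.susp.comp g f))
      = ∑ j, D.comp (F.map (suspEntry (C := C) j l g)) (F.map (suspEntry (C := C) i j f))
    simp only [suspEntry_comp, map_sum, F.map_comp]

/-- The image of a twisted object under a dg functor. -/
def twMapObj (F : DGFunctor C D) (X : C.TwObj) : D.TwObj :=
  ⟨F.obj X.obj, F.map X.α, F.map_mem X.α_mem, by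
    rw [← F.map_d, ← F.map_comp, ← map_add, X.mc, map_zero]⟩

/-- The extension of a dg functor to the twisted envelopes. -/
noncomputable def twMap (F : DGFunctor C D) : DGFunctor C.tw D.tw where
  obj := twMapObj F
  map {X Y} := F.map (X := X.obj) (Y := Y.obj)
  map_mem hf := F.map_mem hf
  map_d {X Y} f := by
    change F.map (twD X Y f) = twD (twMapObj F X) (twMapObj F Y) (F.map f)
    revert f
    refine DGMod.hom_ind (M := C.Hom X.obj Y.obj) (fun n f hf => ?_) ?_ fun f g hf hg => ?_
    · rw [twD_apply hf, twD_apply (X := twMapObj F X) (Y := twMapObj F Y) (F.map_mem hf)]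
      simp only [map_add, map_sub, Units.smul_def, map_zsmul, F.map_comp, F.map_d]
      rfl
    · rw [map_zero, map_zero]; exact (map_zero _).symm
    · rw [map_add (twD X Y), map_add F.map, map_add F.map, hf, hg]
      exact (map_add (twD (twMapObj F X) (twMapObj F Y)) _ _).symm
  map_id X := F.map_id X.obj
  map_comp g f := F.map_comp g f

theorem HomotopyEquivalent.map {X Y : C.Obj} (h : C.HomotopyEquivalent X Y) (F : DGFunctor C D) :
    D.HomotopyEquivalent (F.obj X) (F.obj Y) := by
  obtain ⟨f, hf, g, hg, hdf, hdg, ⟨h, hh, hdh⟩, ⟨h', hh', hdh'⟩⟩ := h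
  refine ⟨F.map f, F.map_mem hf, F.map g, F.map_mem hg, ?_, ?_, ⟨F.map h, F.map_mem hh, ?_⟩,
    ⟨F.map h', F.map_mem hh', ?_⟩⟩
  · rw [← F.map_d, hdf, map_zero]
  · rw [← F.map_d, hdg, map_zero]
  · rw [← F.map_d, ← hdh, map_sub, F.map_id, F.map_comp]
  · rw [← F.map_d, ← hdh', map_sub, F.map_id, F.map_comp]

/-- With de = 1 on Y, the morphism g e f bounds g f, and h bounds the difference between the
identity and g f. -/
theorem IsContractible.of_homotopyEquivalent {X Y : C.Obj} (hY : C.IsContractible Y)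
    (h : C.HomotopyEquivalent X Y) : C.IsContractible X := by
  obtain ⟨e, he, hde⟩ := hY
  obtain ⟨f, hf, g, hg, hdf, hdg, ⟨h, hh, hdh⟩, -⟩ := h
  refine ⟨C.comp g (C.comp e f) + h, add_mem ?_ hh, ?_⟩
  · have := C.comp_mem hg (C.comp_mem he hf)
    simpa using this
  · rw [map_add, ← hdh, C.leibniz _ hg, C.leibniz _ he, hde, hdg, hdf, C.id_comp]
    simp

theorem IsContractible.of_tw {T : C.tw.Obj} (hT : T.α = 0) (h : C.tw.IsContractible T) :
    C.IsContractible T.obj := by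
  obtain ⟨e, he, hde⟩ := h
  have he' : e ∈ (C.Hom T.obj T.obj).gr (-1) := he
  refine ⟨e, he, ?_⟩
  have hde' : twD T T e = C.id T.obj := hde
  have h1 : C.comp T.α e = 0 := by rw [hT]; exact LinearMap.map_zero₂ C.comp _
  have h2 : C.comp e T.α = 0 := by rw [hT]; exact map_zero _
  have h3 := twD_apply (X := T) (Y := T) he'
  rw [h1, h2, smul_zero, sub_zero, add_zero] at h3
  exact h3.symm.trans hde'

theorem IsContractible.of_toSusp {X : C.Obj} (h : C.susp.IsContractible (C.toSusp X)) :
    C.IsContractible X := by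
  obtain ⟨e, he, hde⟩ := h
  let z : Fin (C.toSusp X).n := (0 : Fin 1)
  refine ⟨suspEntry z z e, ?_, ?_⟩
  · have : suspEntry z z e ∈ (C.Hom X X).gr (-1 + 0 - 0) := he z z
    rw [show (-1 : ℤ) + 0 - 0 = -1 by norm_num] at this
    exact this
  · have h1 := congrArg (suspEntry z z) hde
    have h2 : suspEntry z z ((C.susp.Hom (C.toSusp X) (C.toSusp X)).d e)
        = (0 : ℤ).negOnePow • (C.Hom X X).d (suspEntry z z e) := suspEntry_d e z z
    rw [Int.negOnePow_zero, one_smul] at h2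
    exact h2.symm.trans (h1.trans (suspEntry_id_self _ z))

/-- Endomorphisms homotopic to zero form an ideal: (1 - de)² = 1 - d(e(2 - de)). Thus the error of
an approximate contraction can be squared. -/
theorem exists_null_homotopy_sq {X : C.Obj} {e : C.Hom X X} (he : e ∈ (C.Hom X X).gr (-1)) :
    ∃ e' ∈ (C.Hom X X).gr (-1), C.id X - (C.Hom X X).d e'
      = C.comp (C.id X - (C.Hom X X).d e) (C.id X - (C.Hom X X).d e) := by
  have hd : (C.Hom X X).d e ∈ (C.Hom X X).gr 0 := by simpa using DGMod.d_mem _ he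
  refine ⟨C.comp e (C.id X + (C.id X - (C.Hom X X).d e)), ?_, ?_⟩
  · simpa using C.comp_mem he (add_mem (C.id_mem X) (sub_mem (C.id_mem X) hd))
  · rw [C.leibniz _ he]
    simp only [map_add, map_sub, LinearMap.sub_apply, C.id_comp, C.comp_id, d_id, DGMod.d_d,
      sub_zero, add_zero, map_zero, smul_zero]
    abel

/-- The diagonal matrix of contractions of the summands is an approximate contraction whose error
involves only the twist, hence raises ρ by at least 1. Squaring the error repeatedly makes it raise
ρ by 2^m, and ρ is bounded. -/
theorem isContractible_tw_susp (T : C.susp.tw.Obj) (ρ : Fin T.obj.n → ℕ)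
    (hT : ∀ i, C.IsContractible (T.obj.obj i))
    (hα : ∀ i j, ¬ ρ i < ρ j → suspEntry (C := C) i j T.α = 0) :
    C.susp.tw.IsContractible T := by
  have key : ∀ m : ℕ, ∃ ε ∈ (C.susp.tw.Hom T T).gr (-1), ∀ i j, ¬ ρ i + 2 ^ m ≤ ρ j →
      suspEntry i j (C.susp.tw.id T - (C.susp.tw.Hom T T).d ε : C.susp.tw.Hom T T) = 0 := by
    intro m
    induction m with
    | zero =>
      choose e he hde using hT
      -- The sign cancels the factor (-1)^(shift) in the differential on morphisms between
      -- translates.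
      let ε : C.susp.Hom T.obj T.obj := fun i j =>
        if h : i = j then h ▸ ((T.obj.shift i).negOnePow • e i : C.Hom _ _) else 0
      have hε : ∀ i j, i ≠ j → suspEntry i j ε = 0 := fun i j h => dif_neg h
      have hε' : ∀ i, suspEntry i i ε = (T.obj.shift i).negOnePow • e i := fun i => dif_pos rfl
      have hεm : ε ∈ (C.susp.Hom T.obj T.obj).gr (-1) := by
        intro i j
        change suspEntry i j ε ∈ _
        by_cases h : i = j
        · subst h
          rw [hε', add_sub_cancel_right]
          exact DGMod.units_smul_mem _ _ (he i)
        · rw [hε _ _ h]; exact zero_mem _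
      refine ⟨ε, hεm, fun i j hij => ?_⟩
      rw [pow_zero, Nat.add_one_le_iff] at hij
      have h1 : (C.susp.tw.id T - (C.susp.tw.Hom T T).d ε : C.susp.tw.Hom T T)
          = C.susp.id T.obj - ((C.susp.Hom T.obj T.obj).d ε + C.susp.comp T.α ε
          - (-1 : ℤ).negOnePow • C.susp.comp ε T.α) :=
        congrArg (C.susp.id T.obj - ·) (twD_apply (X := T) (Y := T) hεm)
      have h2 : suspEntry i j (C.susp.comp T.α ε) = 0 := by
        rw [suspEntry_comp]
        refine Finset.sum_eq_zero fun l _ => ?_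
        by_cases h : i = l
        · subst h; rw [hα _ _ hij, map_zero, LinearMap.zero_apply]
        · rw [hε _ _ h, map_zero]
      have h3 : suspEntry i j (C.susp.comp ε T.α) = 0 := by
        rw [suspEntry_comp]
        refine Finset.sum_eq_zero fun l _ => ?_
        by_cases h : l = j
        · subst h; rw [hα _ _ hij, map_zero]
        · rw [hε _ _ h, map_zero, LinearMap.zero_apply]
      have h4 : suspEntry i j ((C.susp.Hom T.obj T.obj).d ε)
          = suspEntry i j (C.susp.id T.obj) := by
        rw [suspEntry_d]
        by_cases h : i = j
        · subst h
          rw [hε', Units.smul_def, Units.smul_def, map_zsmul, hde, smul_smul, ← Units.val_mul,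
            Int.units_mul_self, Units.val_one, one_smul, suspEntry_id_self]
        · rw [hε _ _ h, map_zero, smul_zero, suspEntry_id_of_ne _ h]
      rw [h1, Units.smul_def, map_sub, map_sub, map_add, map_zsmul, h2, h3, h4]
      simp
    | succ m ih =>
      obtain ⟨ε, hε, hN⟩ := ih
      obtain ⟨ε', hε', h1⟩ := exists_null_homotopy_sq hε
      refine ⟨ε', hε', fun i j hij => ?_⟩
      rw [h1]
      refine (suspEntry_comp _ _ i j).trans (Finset.sum_eq_zero fun l _ => ?_)
      -- A nonzero term needs both steps, i to l and l to j, to raise ρ by 2^m, hence a total of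
      -- 2^(m+1).
      by_cases h : ρ i + 2 ^ m ≤ ρ l
      · refine (congrArg (fun x => C.comp x _)
          (hN l j fun h' => hij (by rw [pow_succ]; omega))).trans ?_
        exact LinearMap.map_zero₂ C.comp _
      · exact (congrArg (C.comp _) (hN i l h)).trans (map_zero _)
  obtain ⟨m, hm⟩ : ∃ m : ℕ, ∀ j, ρ j < 2 ^ m := by
    refine ⟨∑ i, ρ i, fun j => lt_of_le_of_lt ?_ Nat.lt_two_pow_self⟩
    exact Finset.single_le_sum (f := ρ) (fun _ _ => Nat.zero_le _) (Finset.mem_univ j)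
  obtain ⟨ε, hε, hN⟩ := key m
  refine ⟨ε, hε, ?_⟩
  refine (sub_eq_zero.mp (susp_hom_ext fun i j => ?_)).symm
  refine (hN i j fun h => absurd (hm j) (by omega)).trans (map_zero _).symm

/-- The functor to the quotient extends to twisted complexes and preserves homotopy equivalences,
while all summands of the twisted complex become contractible. -/
theorem IsSemiorthogonal.isContractible {Γ : Type t} [PartialOrder Γ] {B : Γ → Set C.Obj}
    (hB : C.IsSemiorthogonal B) (X : C.Obj) : (C.dgQuotBy (⋃ γ, B γ)).IsContractible X := by
  classical
  obtain ⟨T, ℓ, hT, hα, h⟩ := hB.exists_twisted X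
  have h' := h.map (twMap (suspMap (C.toDGQuotBy (⋃ γ, B γ))))
  have hT' : (C.dgQuotBy (⋃ γ, B γ)).susp.tw.IsContractible
      ((twMap (suspMap (C.toDGQuotBy (⋃ γ, B γ)))).obj T) := by
    -- A numerical rank refining the partial order: if ℓ i < ℓ j, everything below i is below j, and
    -- i itself is below j but not below i.
    refine isContractible_tw_susp _ (fun i => (Finset.univ.filter fun j => ℓ j < ℓ i).card)
      (fun i => isContractible_dgQuotBy_of_mem (Set.mem_iUnion.mpr ⟨_, hT i⟩)) fun i j hij => ?_
    have : T.α i j = 0 := by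
      refine hα i j fun hlt => hij (Finset.card_lt_card ⟨fun l hl => ?_, fun hle => ?_⟩)
      · exact Finset.mem_filter.mpr ⟨Finset.mem_univ _, (Finset.mem_filter.mp hl).2.trans hlt⟩
      · exact lt_irrefl _ (Finset.mem_filter.mp
          (hle (Finset.mem_filter.mpr ⟨Finset.mem_univ i, hlt⟩))).2
    exact (congrArg (C.toDGQuotBy (⋃ γ, B γ)).map this).trans (map_zero _)
  have := hT'.of_homotopyEquivalent h'
  exact IsContractible.of_toSusp (IsContractible.of_tw (map_zero _) this)

end DGCat

/-! ### Tensor products with a contractible factor -/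

namespace DGMod

variable {k : Type w} [CommRing k]

theorem sgn_of_degree_neg_one {M : DGMod.{w, v} k} {h : M →ₗ[k] M}
    (hm : ∀ (n : ℤ) (x : M), x ∈ M.gr n → h x ∈ M.gr (n - 1)) (x : M) :
    M.sgn (h x) = - h (M.sgn x) := by
  induction x using hom_ind with
  | zero => simp
  | add x y hx hy => simp only [map_add, hx, hy, neg_add]
  | hom n x hx =>
    rw [sgn_apply _ hx, sgn_apply _ (hm n x hx), show n - 1 = n + 1 - 2 * 1 by ring,
      Int.negOnePow_sub, Int.negOnePow_two_mul, mul_one, Int.negOnePow_succ]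
    simp [Units.smul_def]

theorem tensor_contractible_of {M : DGMod.{w, v} k} {N : DGMod.{w, v'} k}
    (h : M ⊗[k] N →ₗ[k] M ⊗[k] N)
    (hm : ∀ (i j : ℤ) (x : M) (y : N), x ∈ M.gr i → y ∈ N.gr j →
      h (x ⊗ₜ[k] y) ∈ (M.tensor N).gr (i + j - 1))
    (hd : ∀ x y, (TensorProduct.map M.d LinearMap.id + TensorProduct.map M.sgn N.d :
      M ⊗[k] N →ₗ[k] M ⊗[k] N) (h (x ⊗ₜ[k] y))
      + h (M.d x ⊗ₜ[k] y + M.sgn x ⊗ₜ[k] N.d y) = x ⊗ₜ[k] y) : (M.tensor N).Contractible := by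
  refine ⟨h, fun n x hx => ?_, fun x => ?_⟩
  · refine tensor_mem_ind (p := fun x => h x ∈ (M.tensor N).gr (n - 1)) ?_ ?_ ?_ ?_ x hx
    · exact (congrArg (· ∈ (M.tensor N).gr (n - 1)) (map_zero h)).mpr (zero_mem _)
    · exact fun x y hx hy =>
        (congrArg (· ∈ (M.tensor N).gr (n - 1)) (map_add h x y)).mpr (add_mem hx hy)
    · exact fun a x hx => (congrArg (· ∈ (M.tensor N).gr (n - 1)) (map_smul h a x)).mpr
        (Submodule.smul_mem _ _ hx)
    · rintro i j f s rfl hf hs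
      exact hm i j f s hf hs
  · have : (TensorProduct.map M.d LinearMap.id + TensorProduct.map M.sgn N.d) ∘ₗ h
        + h ∘ₗ (TensorProduct.map M.d LinearMap.id + TensorProduct.map M.sgn N.d)
          = LinearMap.id :=
      TensorProduct.ext' fun x y => hd x y
    exact LinearMap.congr_fun this x

theorem Contractible.tensor_left {M : DGMod.{w, v} k} (hM : M.Contractible) (N : DGMod.{w, v'} k) :
    (M.tensor N).Contractible := by
  obtain ⟨h, hm, hd⟩ := hM
  refine tensor_contractible_of (TensorProduct.map h LinearMap.id) (fun i j x y hx hy => ?_)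
    fun x y => ?_
  · rw [show i + j - 1 = i - 1 + j by ring]
    exact tmul_mem (hm i x hx) hy
  · rw [map_add]
    simp only [LinearMap.add_apply, TensorProduct.map_tmul, LinearMap.id_apply]
    rw [sgn_of_degree_neg_one hm, TensorProduct.neg_tmul, add_add_add_comm, neg_add_cancel,
      add_zero, ← TensorProduct.add_tmul, hd]

/-- The homotopy is sgn ⊗ h; since sgn anticommutes with d, the mixed terms cancel. -/
theorem Contractible.tensor_right (M : DGMod.{w, v} k) {N : DGMod.{w, v'} k}
    (hN : N.Contractible) : (M.tensor N).Contractible := by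
  obtain ⟨h, hm, hd⟩ := hN
  refine tensor_contractible_of (TensorProduct.map M.sgn h) (fun i j x y hx hy => ?_)
    fun x y => ?_
  · rw [show i + j - 1 = i + (j - 1) by ring]
    exact tmul_mem (M.sgn_mem hx) (hm j y hy)
  · have hs : M.sgn (M.sgn x) = x := by
      induction x using hom_ind with
      | zero => simp
      | add x y hx hy => simp only [map_add, hx, hy]
      | hom n x hx => rw [sgn_apply _ (sgn_mem _ hx), sgn_apply _ hx, smul_smul,
          Int.units_mul_self, one_smul]
    rw [map_add]
    simp only [LinearMap.add_apply, TensorProduct.map_tmul, LinearMap.id_apply]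
    rw [sgn_d, hs, TensorProduct.neg_tmul, add_add_add_comm, add_neg_cancel, zero_add,
      ← TensorProduct.tmul_add, hd]

end DGMod

/-! ### Contractible words in a semi-orthogonal decomposition -/

namespace DGCat

variable {k : Type w} [CommRing k] {C : DGCat.{w, u, v} k}

section
open scoped Classical

/-- One contractible factor contracts the whole tensor product. If no factor is contracted this way,
the indices increase weakly along the word from Y to X, which bounds every intermediate index on
both sides; for a cyclic word, where Y = X, they are then all equal. -/
theorem contractible_tens {Γ : Type t} [PartialOrder Γ] {A : Set C.Obj} (g : C.Obj → Γ)
    (hg : ∀ X ∈ A, ∀ Y ∈ A, ¬ g Y ≤ g X → (C.Hom Y X).Contractible) {Y : C.Obj} (hY : Y ∈ A) :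
    ∀ (L : List C.Obj) (X : C.Obj), X ∈ A → (∀ Z ∈ L, Z ∈ A) → (C.tens Y L X).Contractible ∨
      (g Y ≤ g X ∧ ∀ Z ∈ L, g Y ≤ g Z ∧ g Z ≤ g X)
  | [], X, hX, _ => by
    by_cases h : g Y ≤ g X
    · exact Or.inr ⟨h, by simp⟩
    · exact Or.inl (hg X hX Y hY h)
  | Z :: L, X, hX, hL => by
    rw [List.forall_mem_cons] at hL
    by_cases h : g Z ≤ g X
    · rcases contractible_tens g hg hY L Z hL.1 hL.2 with h' | ⟨h1, h2⟩
      · exact Or.inl (h'.tensor_right _)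
      · refine Or.inr ⟨h1.trans h, ?_⟩
        rw [List.forall_mem_cons]
        exact ⟨⟨h1, h⟩, fun W hW => ⟨(h2 W hW).1, (h2 W hW).2.trans h⟩⟩
    · exact Or.inl ((hg X hX Z hL.1 h).tensor_left _)

/-! ### Lengths of cyclic words -/

/-- The cyclic words with less than `m + 1` letters. -/
def wordsLT (C : DGCat.{w, u, v} k) (m : ℕ) : Set (C.Obj × List C.Obj) := {p | p.2.length < m}

variable {B : Set C.Obj}

theorem cycSub_mono {V W : Set (C.Obj × List C.Obj)} (h : V ⊆ W) :
    (cycSub V : Submodule k C.Cyc) ≤ cycSub W := by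
  refine Submodule.span_mono ?_
  rintro _ ⟨X, L, s, hV, rfl⟩
  exact ⟨X, L, s, h hV, rfl⟩

theorem cycSub_map_mem {W : Set (C.Obj × List C.Obj)} {S : Submodule k C.Cyc}
    {φ : C.Cyc →ₗ[k] C.Cyc} (h : ∀ X L, (X, L) ∈ W → ∀ s, φ (cycOf X L s) ∈ S) {x : C.Cyc}
    (hx : x ∈ cycSub W) : φ x ∈ S := by
  induction hx using Submodule.span_induction with
  | zero => simp
  | add x y _ _ hx hy => rw [map_add]; exact add_mem hx hy
  | smul a x _ hx => rw [map_smul]; exact Submodule.smul_mem _ _ hx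
  | mem x hx =>
    obtain ⟨X, L, s, hW, rfl⟩ := hx
    exact h X L hW s

theorem cycSub_map_eq {W : Set (C.Obj × List C.Obj)} {φ ψ : C.Cyc →ₗ[k] C.Cyc}
    (h : ∀ X L, (X, L) ∈ W → ∀ s, φ (cycOf X L s) = ψ (cycOf X L s)) {x : C.Cyc}
    (hx : x ∈ cycSub W) : φ x = ψ x := by
  have := cycSub_map_mem (φ := φ - ψ) (S := ⊥) (fun X L hW s => by simp [h X L hW s]) hx
  simpa [sub_eq_zero] using this

/-- Composing two neighbours deletes one intermediate object and introduces none. -/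
theorem cycIncl_barD_mem {Y : C.Obj} : ∀ (m : ℕ) (L : List C.Obj), (∀ Z ∈ L, Z ∈ B) →
    L.length < m + 1 → ∀ {X : C.Obj} (s : C.tens Y L X), barD L s ∈ Submodule.span k
      {x | ∃ (L : List C.Obj) (s : C.tens Y L X), ((∀ Z ∈ L, Z ∈ B) ∧ L.length < m) ∧
        x = barOf L s}
  | m, [], _, _, _, _ => by rw [barD_nil]; exact zero_mem _
  | 0, _ :: _, _, h, _, _ => by simp at h
  | m + 1, Z :: L, hL, hm, X, s => by
    rw [List.forall_mem_cons] at hL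
    have hm' : L.length < m + 1 := by simpa using hm
    induction s using cons_ind with
    | zero => simp
    | add x y hx hy => rw [map_add]; exact add_mem hx hy
    | cons f s =>
      rw [barD_cons]
      refine sub_mem (neg_mem (Submodule.subset_span ⟨L, lmul L f s, ⟨hL.2, hm'⟩, rfl⟩)) ?_
      have := cycIncl_barD_mem m L hL.2 hm' s
      generalize barD L s = x at this ⊢
      induction this using Submodule.span_induction with
      | zero => simp
      | add x y _ _ hx hy => rw [map_add]; exact add_mem hx hy
      | smul a x _ hx => rw [map_smul]; exact Submodule.smul_mem _ _ hx
      | mem x hx =>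
        obtain ⟨L', s', ⟨h1, h2⟩, rfl⟩ := hx
        rw [barCons_barOf]
        refine Submodule.subset_span ⟨_, _, ⟨?_, ?_⟩, rfl⟩
        · rw [List.forall_mem_cons]; exact ⟨hL.1, h1⟩
        · simpa using h2

/-- The composition part strictly shortens words; this makes the perturbation argument finite. A
word of one letter is killed, which covers m = 0. -/
theorem cycDelta_cycOf_mem_cycSub {X : C.Obj} {L : List C.Obj} {m : ℕ}
    (hW : (X, L) ∈ wordsIn B) (hm : L.length < m + 1) (s : C.tens X L X) :
    C.cycDelta (cycOf X L s) ∈ cycSub (wordsIn B ∩ wordsLT C m) := by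
  rw [cycDelta_cycOf]
  refine add_mem ?_ ?_
  · have := cycIncl_barD_mem m L hW.2 hm s
    generalize barD L s = x at this ⊢
    induction this using Submodule.span_induction with
    | zero => simp
    | add x y _ _ hx hy => rw [map_add]; exact add_mem hx hy
    | smul a x _ hx => rw [map_smul]; exact Submodule.smul_mem _ _ hx
    | mem x hx =>
      obtain ⟨L', s', ⟨h1, h2⟩, rfl⟩ := hx
      have e : cycIncl X (barOf L' s') = cycOf X L' s' := cycIncl_lof X L' s'
      rw [e]
      exact cycOf_mem_cycSub (W := wordsIn B ∩ wordsLT C m) (L := L') ⟨⟨hW.1, h1⟩, h2⟩ _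
  · cases L with
    | nil => rw [cycRot_nil]; exact zero_mem _
    | cons Z L =>
      have hL := List.forall_mem_cons.mp hW.2
      exact cycOf_mem_cycSub (W := wordsIn B ∩ wordsLT C m) ⟨hL, Nat.lt_of_succ_lt_succ hm⟩ _

theorem cycDiff_mem_cycSub_inter {m : ℕ} {x : C.Cyc} (hx : x ∈ cycSub (wordsIn B ∩ wordsLT C m)) :
    C.cycDiff x ∈ cycSub (wordsIn B ∩ wordsLT C m) := by
  refine cycSub_map_mem (fun X L hW s => ?_) hx
  rw [cycDiff, LinearMap.add_apply, cycD_cycOf]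
  refine add_mem ?_ (cycDelta_cycOf_mem_cycSub hW.1 (lt_trans hW.2 (Nat.lt_succ_self m)) s)
  rw [Units.smul_def]
  exact zsmul_mem (cycOf_mem_cycSub hW _) _

theorem cycDiff_mem_cycSub {x : C.Cyc} (hx : x ∈ cycSub (wordsIn B)) :
    C.cycDiff x ∈ cycSub (wordsIn B) := by
  refine cycSub_map_mem (fun X L hW s => ?_) hx
  exact cycSub_mono Set.inter_subset_left (cycDiff_mem_cycSub_inter (m := L.length + 1)
    (cycOf_mem_cycSub (W := wordsIn B ∩ wordsLT C (L.length + 1)) ⟨hW, Nat.lt_succ_self _⟩ s))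

end

end DGCat

/-! ### Contraction of words by iteration -/

/-- As d² = 0, p commutes with d, so the geometric sum moves past d and multiplies dh + hd = 1 - p,
where it telescopes. -/
theorem Ring.geom_sum_homotopy {R : Type u} [Ring R] {d h p : R} (hd : d * d = 0)
    (hp : d * h + h * d = 1 - p) (n : ℕ) :
    d * (h * ∑ i ∈ Finset.range n, p ^ i) + (h * ∑ i ∈ Finset.range n, p ^ i) * d = 1 - p ^ n := by
  have hc : Commute p d := by
    have hp' : p = 1 - (d * h + h * d) := by rw [hp, sub_sub_cancel]
    change p * d = d * p
    rw [hp', sub_mul, mul_sub, add_mul, mul_add, one_mul, mul_one, mul_assoc h d d, hd, mul_zero,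
      add_zero, ← mul_assoc d d h, hd, zero_mul, zero_add, mul_assoc]
  have hs : (∑ i ∈ Finset.range n, p ^ i) * d = d * ∑ i ∈ Finset.range n, p ^ i := by
    rw [Finset.sum_mul, Finset.mul_sum]
    exact Finset.sum_congr rfl fun i _ => (hc.pow_left i)
  rw [mul_assoc h, hs, ← mul_assoc, ← mul_assoc, ← add_mul, hp, mul_neg_geom_sum]

namespace DGCat

variable {k : Type w} [CommRing k] {C : DGCat.{w, u, v} k}

section
open scoped Classical

/-- The operator on the cyclic bar complex given by operators `κ p` on its summands. -/
noncomputable def cycDiag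
    (κ : ∀ p : C.Obj × List C.Obj, C.tens p.1 p.2 p.1 →ₗ[k] C.tens p.1 p.2 p.1) :
    C.Cyc →ₗ[k] C.Cyc :=
  DirectSum.toModule k (C.Obj × List C.Obj) C.Cyc fun p => cycOf p.1 p.2 ∘ₗ κ p

theorem cycDiag_cycOf
    (κ : ∀ p : C.Obj × List C.Obj, C.tens p.1 p.2 p.1 →ₗ[k] C.tens p.1 p.2 p.1) (X : C.Obj)
    (L : List C.Obj) (s : C.tens X L X) : cycDiag κ (cycOf X L s) = cycOf X L (κ (X, L) s) := by
  rw [cycDiag, cycOf, DirectSum.toModule_lof]; rfl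

theorem cycDiag_mem_cycSub
    (κ : ∀ p : C.Obj × List C.Obj, C.tens p.1 p.2 p.1 →ₗ[k] C.tens p.1 p.2 p.1)
    {W : Set (C.Obj × List C.Obj)} {x : C.Cyc} (hx : x ∈ cycSub W) : cycDiag κ x ∈ cycSub W :=
  cycSub_map_mem (fun X L hW s => by rw [cycDiag_cycOf]; exact cycOf_mem_cycSub hW _) hx

/-- The homotopy contracting the summands of the cyclic bar complex with indices in `V`. -/
theorem exists_wordwise_homotopy {V : Set (C.Obj × List C.Obj)}
    (hV : ∀ p ∈ V, (C.tens p.1 p.2 p.1).Contractible) :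
    ∃ h : C.Cyc →ₗ[k] C.Cyc,
      (∀ {n : ℤ} {x : C.Cyc}, x ∈ C.cycInt.gr n → h x ∈ C.cycInt.gr (n - 1)) ∧
      (∀ W : Set (C.Obj × List C.Obj), ∀ x ∈ cycSub W, h x ∈ cycSub W) ∧
      (∀ X L, (X, L) ∈ V → ∀ s, C.cycD (h (cycOf X L s)) + h (C.cycD (cycOf X L s)) = cycOf X L s) ∧
      (∀ X L, (X, L) ∈ V → ∀ s, ∃ s', h (cycOf X L s) = cycOf X L s') ∧
      ∀ W : Set (C.Obj × List C.Obj), Disjoint W V → ∀ x ∈ cycSub W, h x = 0 := by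
  have : ∀ p : C.Obj × List C.Obj, ∃ κ : C.tens p.1 p.2 p.1 →ₗ[k] C.tens p.1 p.2 p.1,
      (∀ (n : ℤ) (x : C.tens p.1 p.2 p.1), x ∈ (C.tens p.1 p.2 p.1).gr n →
        κ x ∈ (C.tens p.1 p.2 p.1).gr (n - 1)) ∧
      (p ∈ V → ∀ x, (C.tens p.1 p.2 p.1).d (κ x) + κ ((C.tens p.1 p.2 p.1).d x)
        = (p.2.length : ℤ).negOnePow • x) ∧ (p ∉ V → κ = 0) := by
    intro p
    by_cases hp : p ∈ V
    · obtain ⟨κ, h1, h2⟩ := hV p hp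
      -- The sign matches the differential (-1)^r d of the translate Σ^r.
      refine ⟨(p.2.length : ℤ).negOnePow • κ, fun n x hx =>
        DGMod.units_smul_mem _ _ (h1 n x hx), fun _ x => ?_, fun h => absurd hp h⟩
      simp only [LinearMap.smul_apply, Units.smul_def, map_zsmul]
      rw [← smul_add, h2]
    · exact ⟨0, fun n x _ => zero_mem _, fun h => absurd h hp, fun _ => rfl⟩
  choose κ h1 h2 h3 using this
  refine ⟨cycDiag κ, fun {n x} hx => ?_, fun W x hx => cycDiag_mem_cycSub κ hx,
    fun X L hp s => ?_, fun X L _ s => ⟨_, cycDiag_cycOf κ X L s⟩, fun W hW x hx => ?_⟩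
  · refine cyc_mem_map _ _ (fun X L s hs => ?_) hx
    refine (congrArg (· ∈ C.cycInt.gr (n - 1)) (cycDiag_cycOf κ X L s)).mpr (cycOf_mem ?_)
    have := h1 (X, L) _ _ hs
    rwa [show n + (L.length : ℤ) - 1 = n - 1 + L.length by ring] at this
  · rw [cycDiag_cycOf, cycD_cycOf, cycD_cycOf, Units.smul_def, Units.smul_def, map_zsmul,
      cycDiag_cycOf, ← smul_add, ← map_add, h2 (X, L) hp, Units.smul_def, map_zsmul, smul_smul,
      ← Units.val_mul, Int.units_mul_self, Units.val_one, one_smul]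
  · refine cycSub_map_eq (ψ := 0) (fun X L hp s => ?_) hx
    rw [cycDiag_cycOf, h3 (X, L) (Set.disjoint_left.mp hW hp)]
    exact map_zero _

/-- Let h contract each word over `A` outside Ω for the internal differential, and vanish on Ω. Then
P = 1 - (dh + hd) fixes Ω and, modulo Ω, shortens words, so a power of P sends any given word into
Ω. The series h(1 + P + P² + ⋯) is finite on each word, because h vanishes on Ω, and is a homotopy
from the identity to the limit of the powers of P. -/
theorem exists_homotopy_of_contractible_words {A : Set C.Obj} {Ω : Set (C.Obj × List C.Obj)}
    (hΩ : ∀ x ∈ (cycSub Ω : Submodule k C.Cyc), C.cycDiff x ∈ cycSub Ω)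
    (hc : ∀ p ∈ wordsIn A, p ∉ Ω → (C.tens p.1 p.2 p.1).Contractible) :
    ∃ h : C.Cyc →ₗ[k] C.Cyc,
      (∀ {n : ℤ} {x : C.Cyc}, x ∈ C.cycInt.gr n → h x ∈ C.cycInt.gr (n - 1)) ∧
      (∀ x ∈ cycSub (wordsIn A), x - (C.cycDiff (h x) + h (C.cycDiff x)) ∈ cycSub Ω) ∧
      ∀ x ∈ cycSub Ω, C.cycDiff (h x) + h (C.cycDiff x) = 0 := by
  obtain ⟨h, hm, hW, hD, hs, h0⟩ := exists_wordwise_homotopy (C := C) (V := wordsIn A \ Ω)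
    fun p hp => hc p hp.1 hp.2
  replace h0 := h0 Ω disjoint_sdiff_self_right
  let V : ℕ → Set (C.Obj × List C.Obj) := fun m => (wordsIn A ∩ wordsLT C m) ∪ Ω
  have hVmono : Monotone V := fun i j hij =>
    Set.union_subset_union_left _ (Set.inter_subset_inter_right _ fun p hp => lt_of_lt_of_le hp hij)
  have hV0 : V 0 = Ω := by
    ext p
    simp [V, wordsLT]
  let d : Module.End k C.Cyc := C.cycDiff
  let h' : Module.End k C.Cyc := h
  let P : Module.End k C.Cyc := 1 - (d * h' + h' * d)
  have hP : ∀ x, P x = x - (C.cycDiff (h x) + h (C.cycDiff x)) := fun _ => rfl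
  have hPΩ : ∀ x ∈ cycSub Ω, P x = x := fun x hx => by
    rw [hP, h0 x hx, h0 _ (hΩ x hx), map_zero, add_zero, sub_zero]
  have hPV : ∀ m, ∀ x ∈ cycSub (V (m + 1)), P x ∈ cycSub (V m) := by
    intro m x hx
    refine cycSub_map_mem (φ := P) (fun X L hXL s => ?_) hx
    by_cases hp : (X, L) ∈ Ω
    · rw [hPΩ _ (cycOf_mem_cycSub hp s)]
      exact cycOf_mem_cycSub (W := V m) (Or.inr hp) s
    · have hA := hXL.resolve_right hp
      -- The internal part of the differential contributes the whole word, which cancels against the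
      -- identity; only the length-decreasing part is left.
      have e : P (cycOf X L s)
          = - (C.cycDelta (h (cycOf X L s)) + h (C.cycDelta (cycOf X L s))) := by
        rw [hP, cycDiff, LinearMap.add_apply, LinearMap.add_apply, map_add, add_add_add_comm,
          hD X L ⟨hA.1, hp⟩, sub_add_cancel_left]
      rw [e]
      obtain ⟨s', hs'⟩ := hs X L ⟨hA.1, hp⟩ s
      rw [hs']
      refine cycSub_mono Set.subset_union_left (neg_mem (add_mem ?_ (hW _ _ ?_)))
      · exact cycDelta_cycOf_mem_cycSub hA.1 hA.2 s'
      · exact cycDelta_cycOf_mem_cycSub hA.1 hA.2 s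
  have hPpow : ∀ m, ∀ x ∈ cycSub (V m), (P ^ m) x ∈ cycSub Ω := by
    intro m
    induction m with
    | zero => intro x hx; rw [hV0] at hx; exact hx
    | succ m ih =>
      intro x hx
      rw [pow_succ]
      exact ih _ (hPV m x hx)
  have hdV : ∀ m, ∀ x ∈ cycSub (V m), C.cycDiff x ∈ cycSub (V m) := by
    intro m x hx
    refine cycSub_map_mem (fun X L hXL s => ?_) hx
    rcases hXL with hp | hp
    · exact cycSub_mono Set.subset_union_left (cycDiff_mem_cycSub_inter (cycOf_mem_cycSub hp s))
    · exact cycSub_mono Set.subset_union_right (hΩ _ (cycOf_mem_cycSub hp s))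
  let H : ℕ → Module.End k C.Cyc := fun n => h' * ∑ i ∈ Finset.range n, P ^ i
  have hHd : ∀ n x, C.cycDiff (H n x) + H n (C.cycDiff x) = x - (P ^ n) x := fun n x =>
    LinearMap.congr_fun (Ring.geom_sum_homotopy (d := d) (h := h') (p := P)
      (LinearMap.ext cycDiff_cycDiff) (sub_sub_cancel _ _).symm n) x
  have hHstep : ∀ n x, H (n + 1) x = H n x + h ((P ^ n) x) := fun n x => by
    change h ((∑ i ∈ Finset.range (n + 1), P ^ i : Module.End k C.Cyc) x)
      = h ((∑ i ∈ Finset.range n, P ^ i : Module.End k C.Cyc) x) + h ((P ^ n) x)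
    rw [Finset.sum_range_succ, LinearMap.add_apply, map_add]
  -- Further summands are h applied to elements over Ω, hence zero.
  have hHstable : ∀ m n, m ≤ n → ∀ x ∈ cycSub (V m), H n x = H m x := by
    intro m n hmn x hx
    induction n, hmn using Nat.le_induction with
    | base => rfl
    | succ n hmn ih =>
      rw [hHstep, ih, h0 _ (hPpow n x (cycSub_mono (hVmono hmn) hx)), add_zero]
  have hPgr : ∀ {n : ℤ} {x : C.Cyc}, x ∈ C.cycInt.gr n → P x ∈ C.cycInt.gr n := by
    intro n x hx
    rw [hP]
    refine Submodule.sub_mem _ hx (Submodule.add_mem _ ?_ ?_)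
    · have := C.cyclicBar.d_mem (hm hx)
      rwa [sub_add_cancel] at this
    · have := hm (C.cyclicBar.d_mem hx)
      rwa [add_sub_cancel_right] at this
  have hPpowgr : ∀ i {n : ℤ} {x : C.Cyc}, x ∈ C.cycInt.gr n → (P ^ i) x ∈ C.cycInt.gr n := by
    intro i n
    induction i with
    | zero => exact fun hx => hx
    | succ i ih => exact fun hx => by rw [pow_succ]; exact ih (hPgr hx)
  have hHgr : ∀ i {n : ℤ} {x : C.Cyc}, x ∈ C.cycInt.gr n → H i x ∈ C.cycInt.gr (n - 1) := by
    intro i n x hx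
    refine hm ?_
    rw [LinearMap.sum_apply]
    exact Submodule.sum_mem _ fun i _ => hPpowgr i hx
  -- The stable value, taken word by word: a word over `A` whose list has length r lies in `V (r +
  -- 1)`, and so r + 1 summands suffice.
  let K : C.Cyc →ₗ[k] C.Cyc := DirectSum.toModule k (C.Obj × List C.Obj) C.Cyc fun p =>
    H (p.2.length + 1) ∘ₗ cycOf p.1 p.2
  have hK : ∀ X L s, K (cycOf X L s) = H (L.length + 1) (cycOf X L s) := fun X L s => by
    simp only [K]
    rw [cycOf, DirectSum.toModule_lof]; rfl
  have hKH : ∀ m, ∀ x ∈ cycSub (V m), K x = H m x := by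
    intro m x hx
    refine cycSub_map_eq (ψ := H m) (fun X L hXL s => ?_) hx
    rw [hK]
    rcases hXL with hp | hp
    · exact (hHstable _ _ hp.2 _ (cycOf_mem_cycSub
        (W := V (L.length + 1)) (Or.inl ⟨hp.1, Nat.lt_succ_self _⟩) s)).symm
    · have : cycOf X L s ∈ cycSub (V 0) := by rw [hV0]; exact cycOf_mem_cycSub hp s
      rw [hHstable 0 _ (Nat.zero_le _) _ this, hHstable 0 m (Nat.zero_le _) _ this]
  have hKd : ∀ m, ∀ x ∈ cycSub (V m), C.cycDiff (K x) + K (C.cycDiff x) = x - (P ^ m) x :=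
    fun m x hx => by rw [hKH m x hx, hKH m _ (hdV m x hx), hHd]
  refine ⟨K, fun {n x} hx => ?_, fun x hx => ?_, fun x hx => ?_⟩
  · refine cyc_mem_map _ _ (fun X L s hs => ?_) hx
    refine (congrArg (· ∈ C.cycInt.gr (n - 1)) (hK X L s)).mpr ?_
    exact hHgr _ (cycOf_mem hs)
  · have : ∃ m, x ∈ cycSub (V m) := by
      induction hx using Submodule.span_induction with
      | zero => exact ⟨0, zero_mem _⟩
      | add x y _ _ hx hy =>
        obtain ⟨i, hi⟩ := hx
        obtain ⟨j, hj⟩ := hy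
        exact ⟨max i j, add_mem (cycSub_mono (hVmono (le_max_left i j)) hi)
          (cycSub_mono (hVmono (le_max_right i j)) hj)⟩
      | smul a x _ hx =>
        obtain ⟨i, hi⟩ := hx
        exact ⟨i, Submodule.smul_mem _ _ hi⟩
      | mem x hx =>
        obtain ⟨X, L, s, hp, rfl⟩ := hx
        exact ⟨L.length + 1, cycOf_mem_cycSub (W := V (L.length + 1))
          (Or.inl ⟨hp, Nat.lt_succ_self _⟩) s⟩
    obtain ⟨m, hm⟩ := this
    rw [hKd m x hm, sub_sub_cancel]
    exact hPpow m x hm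
  · rw [hKd 0 x (by rwa [hV0]), pow_zero]
    exact sub_self x

/-- Homotopies from the identity to a map with values in `S`, and on `S` to one with values
in `T ≤ S`, compose. -/
theorem exists_homotopy_trans {S T : Submodule k C.Cyc} (hTS : T ≤ S)
    {h₁ h₂ : C.Cyc →ₗ[k] C.Cyc}
    (hm₁ : ∀ {n : ℤ} {x : C.Cyc}, x ∈ C.cycInt.gr n → h₁ x ∈ C.cycInt.gr (n - 1))
    (hm₂ : ∀ {n : ℤ} {x : C.Cyc}, x ∈ C.cycInt.gr n → h₂ x ∈ C.cycInt.gr (n - 1))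
    (hr₁ : ∀ x, x - (C.cycDiff (h₁ x) + h₁ (C.cycDiff x)) ∈ S)
    (hf₁ : ∀ x ∈ S, C.cycDiff (h₁ x) + h₁ (C.cycDiff x) = 0)
    (hr₂ : ∀ x ∈ S, x - (C.cycDiff (h₂ x) + h₂ (C.cycDiff x)) ∈ T)
    (hf₂ : ∀ x ∈ T, C.cycDiff (h₂ x) + h₂ (C.cycDiff x) = 0) :
    ∃ h : C.Cyc →ₗ[k] C.Cyc,
      (∀ {n : ℤ} {x : C.Cyc}, x ∈ C.cycInt.gr n → h x ∈ C.cycInt.gr (n - 1)) ∧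
      (∀ x, x - (C.cycDiff (h x) + h (C.cycDiff x)) ∈ T) ∧
      ∀ x ∈ T, C.cycDiff (h x) + h (C.cycDiff x) = 0 := by
  -- p is the chain map onto S obtained from h₁. The composite homotopy is h₁ + h₂ p, so h₂ is used
  -- only after landing in S.
  let p : C.Cyc →ₗ[k] C.Cyc := LinearMap.id - (C.cycDiff ∘ₗ h₁ + h₁ ∘ₗ C.cycDiff)
  have hp : ∀ x, p x = x - (C.cycDiff (h₁ x) + h₁ (C.cycDiff x)) := fun _ => rfl
  have hpd : ∀ x, p (C.cycDiff x) = C.cycDiff (p x) := fun x => by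
    simp only [hp, map_sub, map_add, cycDiff_cycDiff, map_zero, add_zero, zero_add]
  have hpS : ∀ x ∈ S, p x = x := fun x hx => by rw [hp, hf₁ x hx, sub_zero]
  have hpgr : ∀ {n : ℤ} {x : C.Cyc}, x ∈ C.cycInt.gr n → p x ∈ C.cycInt.gr n := by
    intro n x hx
    rw [hp]
    refine Submodule.sub_mem _ hx (Submodule.add_mem _ ?_ ?_)
    · have := C.cyclicBar.d_mem (hm₁ hx)
      rwa [sub_add_cancel] at this
    · have := hm₁ (C.cyclicBar.d_mem hx)
      rwa [add_sub_cancel_right] at this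
  have key : ∀ x, C.cycDiff ((h₁ + h₂ ∘ₗ p) x) + (h₁ + h₂ ∘ₗ p) (C.cycDiff x)
      = (C.cycDiff (h₁ x) + h₁ (C.cycDiff x))
        + (C.cycDiff (h₂ (p x)) + h₂ (C.cycDiff (p x))) := fun x => by
    simp only [LinearMap.add_apply, LinearMap.comp_apply, map_add, hpd]
    exact add_add_add_comm _ _ _ _
  refine ⟨h₁ + h₂ ∘ₗ p, fun hx => Submodule.add_mem _ (hm₁ hx) (hm₂ (hpgr hx)), fun x => ?_,
    fun x hx => ?_⟩
  · rw [key, ← sub_sub, ← hp]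
    exact hr₂ _ (hr₁ x)
  · rw [key, hf₁ x (hTS hx), zero_add, hpS x (hTS hx), hf₂ x hx]

end

end DGCat

namespace DGCat

variable {k : Type w} [CommRing k] {C : DGCat.{w, u, v} k}

section
open scoped Classical

/-- Two stages: contractions in the quotient restrict to words over the union of the pieces, then
semi-orthogonality removes the words that mix pieces. -/
theorem IsSemiorthogonal.exists_homotopy {Γ : Type t} [PartialOrder Γ] [Finite Γ]
    {B : Γ → Set C.Obj} (hB : C.IsSemiorthogonal B) :
    ∃ h : C.Cyc →ₗ[k] C.Cyc,
      (∀ {n : ℤ} {x : C.Cyc}, x ∈ C.cycInt.gr n → h x ∈ C.cycInt.gr (n - 1)) ∧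
      (∀ x, x - (C.cycDiff (h x) + h (C.cycDiff x)) ∈ cycSub (⋃ γ, wordsIn (B γ))) ∧
      ∀ x ∈ cycSub (⋃ γ, wordsIn (B γ)), C.cycDiff (h x) + h (C.cycDiff x) = 0 := by
  obtain ⟨h₁, hm₁, hr₁, hf₁⟩ := exists_homotopy_of_isContractible hB.isContractible
  have hsub : (⋃ γ, wordsIn (B γ)) ⊆ wordsIn (⋃ γ, B γ) :=
    Set.iUnion_subset fun γ p hp => ⟨Set.mem_iUnion_of_mem γ hp.1,
      fun Z hZ => Set.mem_iUnion_of_mem γ (hp.2 Z hZ)⟩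
  have hd : ∀ x ∈ (cycSub (⋃ γ, wordsIn (B γ)) : Submodule k C.Cyc),
      C.cycDiff x ∈ cycSub (⋃ γ, wordsIn (B γ)) := by
    intro x hx
    refine cycSub_map_mem (fun X L hXL s => ?_) hx
    obtain ⟨γ, hγ⟩ := Set.mem_iUnion.mp hXL
    exact cycSub_mono (Set.subset_iUnion (fun γ => wordsIn (B γ)) γ)
      (cycDiff_mem_cycSub (cycOf_mem_cycSub hγ s))
  have hc : ∀ p ∈ wordsIn (⋃ γ, B γ), p ∉ ⋃ γ, wordsIn (B γ) →
      (C.tens p.1 p.2 p.1).Contractible := by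
    rintro ⟨X, L⟩ ⟨hX, hL⟩ hp
    have hg : ∀ Z, ∃ γ, Z ∈ ⋃ γ, B γ → Z ∈ B γ := by
      intro Z
      by_cases hZ : Z ∈ ⋃ γ, B γ
      · exact (Set.mem_iUnion.mp hZ).imp fun _ h _ => h
      -- An arbitrary index: objects outside the union do not occur in the words considered, and X
      -- guarantees that there is an index at all.
      · exact ⟨(Set.mem_iUnion.mp hX).choose, fun h => absurd h hZ⟩
    choose g hg using hg
    refine (contractible_tens g (fun Z hZ Y hY hle =>
      hB.contractible _ _ hle Y (hg Y hY) Z (hg Z hZ)) hX L X hX hL).resolve_right ?_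
    rintro ⟨-, hLg⟩
    refine hp (Set.mem_iUnion_of_mem (g X) ⟨hg X hX, fun Z hZ => ?_⟩)
    -- The word starts and ends at X, so each index is both above and below that of X.
    rw [le_antisymm (hLg Z hZ).1 (hLg Z hZ).2]
    exact hg Z (hL Z hZ)
  obtain ⟨h₂, hm₂, hr₂, hf₂⟩ := exists_homotopy_of_contractible_words hd hc
  exact exists_homotopy_trans (cycSub_mono hsub) hm₁ hm₂ hr₁ hf₁ hr₂ hf₂

/-- The projection of the cyclic bar complex to the words starting with an object of `A`. -/
noncomputable def cycRestrict (A : Set C.Obj) : C.Cyc →ₗ[k] C.Cyc :=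
  cycDiag fun p => if p.1 ∈ A then LinearMap.id else 0

theorem cycRestrict_eq_self {A : Set C.Obj} {x : C.Cyc} (hx : x ∈ cycSub (wordsIn A)) :
    cycRestrict A x = x := by
  refine cycSub_map_eq (ψ := LinearMap.id) (fun X L hXL s => ?_) hx
  rw [cycRestrict, cycDiag_cycOf, if_pos hXL.1]
  rfl

theorem cycRestrict_eq_zero {A A' : Set C.Obj} (h : Disjoint A A') {x : C.Cyc}
    (hx : x ∈ cycSub (wordsIn A')) : cycRestrict A x = 0 := by
  refine cycSub_map_eq (ψ := 0) (fun X L hXL s => ?_) hx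
  rw [cycRestrict, cycDiag_cycOf, if_neg (Set.disjoint_right.mp h hXL.1)]
  exact map_zero _

/-- The words that stay in one piece span exactly the image of the direct sum. Disjointness of the
pieces makes the map injective: an object would otherwise contribute once for every piece containing
it. -/
theorem exists_deformationRetract_of_isSemiorthogonal {Γ : Type t} [PartialOrder Γ] [Finite Γ]
    (B : Γ → Set C.Obj) (hB : C.IsSemiorthogonal B)
    (hdisj : ∀ γ γ', γ ≠ γ' → Disjoint (B γ) (B γ')) :
    ∃ R : DGMod.DeformationRetract C.cyclicBar
        (DGMod.directSum fun γ => (C.full (B γ)).cyclicBar),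
      R.σ = DGMod.directSumDesc (fun γ => (C.full (B γ)).cyclicBar)
        fun γ => cyclicBarMap (C.fullIncl (B γ)) := by
  obtain ⟨h, hm, hr, hf⟩ := hB.exists_homotopy
  let N : DGMod.{w, max t u v} k := DGMod.directSum fun γ => (C.full (B γ)).cyclicBar
  let σ : N →ₗ[k] C.Cyc := DGMod.directSumDesc (fun γ => (C.full (B γ)).cyclicBar)
    fun γ => cyclicBarMap (C.fullIncl (B γ))
  let ι : ∀ γ, (C.full (B γ)).Cyc →ₗ[k] N := fun γ =>
    DirectSum.lof k Γ (fun γ => (C.full (B γ)).cyclicBar.carrier) γ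
  have hσι : ∀ γ y, σ (ι γ y) = cycMap (C.fullIncl (B γ)) y := fun γ y =>
    DirectSum.toModule_lof k (φ := fun γ =>
      (cyclicBarMap (C.fullIncl (B γ)) : (C.full (B γ)).cyclicBar →ₗ[k] C.cyclicBar)) γ y
  have hsum : ∀ y : N, y
      = ∑ γ ∈ DFinsupp.support (β := fun γ => (C.full (B γ)).cyclicBar.carrier) y,
      ι γ (DFinsupp.toFun (β := fun γ => (C.full (B γ)).cyclicBar.carrier) y γ) := fun y =>
    (DirectSum.sum_support_of y).symm
  have hind : ∀ {q : N → Prop}, q 0 → (∀ x y, q x → q y → q (x + y)) → (∀ γ y, q (ι γ y)) →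
      ∀ y, q y := fun h0 hadd hι y =>
    DirectSum.induction_on (β := fun γ => (C.full (B γ)).cyclicBar.carrier) y h0 hι hadd
  have hmem : ∀ γ y, cycMap (C.fullIncl (B γ)) y ∈ cycSub (wordsIn (B γ)) := fun γ y => by
    rw [← range_cycMap_fullIncl]; exact ⟨y, rfl⟩
  have hle : ∀ γ, (cycSub (wordsIn (B γ)) : Submodule k C.Cyc) ≤ cycSub (⋃ γ, wordsIn (B γ)) :=
    fun γ => cycSub_mono (Set.subset_iUnion (fun γ => wordsIn (B γ)) γ)
  have hσmem : ∀ y, σ y ∈ cycSub (⋃ γ, wordsIn (B γ)) := by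
    refine hind ?_ (fun x y hx hy => ?_) fun γ y => ?_
    · rw [map_zero]; exact zero_mem _
    · rw [map_add]; exact add_mem hx hy
    · rw [hσι]; exact hle γ (hmem γ y)
  have hrange : cycSub (⋃ γ, wordsIn (B γ)) ≤ LinearMap.range σ := by
    refine Submodule.span_le.mpr ?_
    rintro _ ⟨X, L, s, hXL, rfl⟩
    obtain ⟨γ, hγ⟩ := Set.mem_iUnion.mp hXL
    have := cycOf_mem_cycSub hγ s
    rw [← range_cycMap_fullIncl] at this
    obtain ⟨y, hy⟩ := this
    exact ⟨ι γ y, (hσι γ y).trans hy⟩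
  have hσd : ∀ y, σ (N.d y) = C.cycDiff (σ y) := by
    refine hind ?_ (fun x y hx hy => ?_) fun γ y => ?_
    · simp only [map_zero]
    · simp only [map_add, hx, hy]
    · refine (congrArg σ (DirectSum.lmap_lof (R := k) (f := fun γ => (C.full (B γ)).cyclicBar.d)
        γ y)).trans ?_
      refine (hσι γ _).trans ((cycMap_cycDiff _ y).trans ?_)
      exact congrArg C.cycDiff (hσι γ y).symm
  refine DGMod.exists_deformationRetract (M := C.cyclicBar) (N := N) σ ?_ ?_ hσd h hm
    (fun x => hrange (hr x)) (fun y => hf _ (hσmem y))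
  · refine (injective_iff_map_eq_zero σ).mpr fun y hy => ?_
    -- Within the image of σ the first letter of a word determines its piece, so restricting to
    -- first letters in `B γ` recovers the component at γ.
    have key : ∀ γ y, cycRestrict (B γ) (σ y) = cycMap (C.fullIncl (B γ))
        (DFinsupp.toFun (β := fun γ => (C.full (B γ)).cyclicBar.carrier) y γ) := by
      intro γ
      refine hind ?_ (fun x y hx hy => ?_) fun γ' y => ?_
      · rw [map_zero, map_zero]
        exact (map_zero (cycMap (C.fullIncl (B γ)))).symm
      · rw [map_add, map_add, hx, hy]
        exact (map_add (cycMap (C.fullIncl (B γ))) _ _).symm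
      · rw [hσι]
        by_cases e : γ = γ'
        · subst e
          rw [cycRestrict_eq_self (hmem γ y)]
          exact congrArg (cycMap (C.fullIncl (B γ))) (DirectSum.of_eq_same
            (β := fun γ => (C.full (B γ)).cyclicBar.carrier) γ y).symm
        · rw [cycRestrict_eq_zero (hdisj _ _ e) (hmem γ' y)]
          exact ((congrArg (cycMap (C.fullIncl (B γ))) (DirectSum.of_eq_of_ne
            (β := fun γ => (C.full (B γ)).cyclicBar.carrier) γ' γ y e)).trans
              (map_zero _)).symm
    refine DFinsupp.ext fun γ => cycMap_fullIncl_injective (B γ) ?_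
    have := key γ y
    rw [hy, map_zero] at this
    exact this.symm.trans (map_zero (cycMap (C.fullIncl (B γ)))).symm
  · intro n y hy
    rw [hsum y, map_sum]
    refine Submodule.sum_mem _ fun γ _ => ?_
    refine (congrArg (· ∈ C.cycInt.gr n) (hσι γ _)).mpr (cycMap_mem _ (hy γ))

end

end DGCat

theorem mainTheorem4 {k : Type w} [CommRing k] (C : DGCat.{w, u, v} k) :
    (∀ B : Set C.Obj, C.Generates B →
      ∃ R : DGMod.DeformationRetract C.cyclicBar (C.full B).cyclicBar,
        R.σ = DGCat.cyclicBarMap (C.fullIncl B)) ∧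
    (∀ {Γ : Type t} [PartialOrder Γ] [Finite Γ] (B : Γ → Set C.Obj), C.IsSemiorthogonal B →
      (∀ γ γ', γ ≠ γ' → Disjoint (B γ) (B γ')) →
      ∃ R : DGMod.DeformationRetract C.cyclicBar
          (DGMod.directSum fun γ => (C.full (B γ)).cyclicBar),
        R.σ = DGMod.directSumDesc (fun γ => (C.full (B γ)).cyclicBar)
          fun γ => DGCat.cyclicBarMap (C.fullIncl (B γ))) :=
  ⟨DGCat.exists_deformationRetract_of_generates,
    DGCat.exists_deformationRetract_of_isSemiorthogonal⟩
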